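/- Let $\mathfrak g$ be one of the affine types $A^{(2)}_{2n}$ ($n\ge 2$), $A^{(2)}_{2n-1}$ ($n\ge 3$), $A^{(2)\dagger}_{2n-1}$ ($n\ge 3$), $C^{(1)}_n$ ($n\ge 2$), where $A^{(2)\dagger}_{2n-1}$ is $A^{(2)}_{2n-1}$ with the 0-vertex chosen at the other end of the Dynkin diagram. The associated simple Lie algebra $\overline{\mathfrak g}$ is $B_n$, $C_n$, $D_n$, $C_n$ respectively. Let $K$ be a field of characteristic $0$ and $q\in K$ transcendental over $\mathbf Q$; for $A^{(2)}_{2n}$ suppose that $q$ has a square root $q^{1/2}\in K$, and put $[2]_n=q^{1/2}+q^{-1/2}$. Let $J=\{0,\pm1,\dots,\pm n\}$ for $A^{(2)}_{2n}$ and $J=\{\pm1,\dots,\pm n\}$ otherwise, ordered by $1\prec 2\prec\cdots\prec n\,(\prec 0)\prec -n\prec\cdots\prec -1$. Let $V=\bigoplus_{j\in J}Kv_j$, with matrix units $E_{ij}v_k=\delta_{jk}v_i$. The algebra $U_q(\overline{\mathfrak g})$, generated by $e_i,f_i,t_i^{\pm1}$ ($1\le i\le n$), acts on $V$ as follows. For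 $1\le i\le n-1$, $$e_i=E_{i,i+1}+E_{-i-1,-i},\qquad t_i=\sum_{j\in J}q^{\delta_{ji}-\delta_{j,i+1}+\delta_{j,-i-1}-\delta_{j,-i}}E_{jj};$$ for $i=n$, * $e_n=[2]_nE_{n0}+E_{0,-n}$, $t_n=\sum_j q^{\delta_{jn}-\delta_{j,-n}}E_{jj}$ for $A^{(2)}_{2n}$; * $e_n=E_{n,-n}$, $t_n=\sum_j q^{2\delta_{jn}-2\delta_{j,-n}}E_{jj}$ for $A^{(2)}_{2n-1}$ and $C^{(1)}_n$; * $e_n=E_{n-1,-n}+E_{n,-n+1}$, $t_n=\sum_j q^{\delta_{j,n-1}+\delta_{jn}-\delta_{j,-n}-\delta_{j,-n+1}}E_{jj}$ for $A^{(2)\dagger}_{2n-1}$; and $f_i$ acts by the transpose of $e_i$, except that $f_n=E_{0n}+[2]_nE_{-n,0}$ for $A^{(2)}_{2n}$. It acts on $V\otimes V$ through $\Delta(e_i)=e_i\otimes t_i^{-1}+1\otimes e_i$, $\Delta(f_i)=f_i\otimes1+t_i\otimes f_i$, $\Delta(t_i)=t_i\otimes t_i$. A vector has weight $\lambda=\sum_k\lambda_k\epsilon_k$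 if $t_i$ acts on it by $q^{(\alpha_i|\lambda)}$ for $1\le i\le n$, where $(\epsilon_k|\epsilon_l)=\delta_{kl}$, $\alpha_i=\epsilon_i-\epsilon_{i+1}$ for $i<n$, and $\alpha_n=\epsilon_n,\ 2\epsilon_n,\ \epsilon_{n-1}+\epsilon_n$ for $\overline{\mathfrak g}=B_n,C_n,D_n$; a highest weight vector is a nonzero vector having a weight and killed by $e_1,\dots,e_n$. For $z\in K$ the $R$-matrix on $V\otimes V$ is $$\begin{aligned}\check R(z)={}&(1-q^2z)(1-\xi z)\sum_{i\ne0}E_{ii}\otimes E_{ii}+q(1-z)(1-\xi z)\sum_{i\ne\pm j}E_{ij}\otimes E_{ji}\\&+(1-q^2)(1-\xi z)\Bigl(\sum_{i\succ j,\,i\ne-j}+z\sum_{i\prec j,\,i\ne-j}\Bigr)E_{ii}\otimes E_{jj}+\sum_{i,j}a_{ij}(z)E_{-i,j}\otimes E_{i,-j},\end{aligned}$$ with all indices in $J$ and $$a_{ij}(z)=\begin{cases}(q^2-\xi z)(1-z)+\delta_{i0}(1-q)(q+z)(1-\xi z)&(i=j),\\(1-q^2)\bigl(\varepsilon_j\varepsilon_i^{-1}(-q)^{\overline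 j-\overline i}(z-1)+\delta_{i,-j}(1-\xi z)\bigr)&(i\prec j),\\(1-q^2)z\bigl(\varepsilon_j\varepsilon_i^{-1}\xi(-q)^{\overline j-\overline i}(z-1)+\delta_{i,-j}(1-\xi z)\bigr)&(i\succ j).\end{cases}$$ Here $\varepsilon_j=1$ for all $j$ for $A^{(2)\dagger}_{2n-1}$, and $\varepsilon_j=1,\ [2]_n,\ -1$ for $j>0$, $j=0$, $j<0$ for the other types; $\overline j=j,\ n+1,\ j+N$ for $j>0$, $j=0$, $j<0$; and $(N,\xi)$ is $(2n+1,-q^{2n+1})$, $(2n+2,-q^{2n})$, $(2n,-q^{2n})$, $(2n+2,q^{2n+2})$ for $A^{(2)}_{2n}$, $A^{(2)}_{2n-1}$, $A^{(2)\dagger}_{2n-1}$, $C^{(1)}_n$ respectively. **Proposition.** For $\lambda\in\{2\epsilon_1,\ \epsilon_1+\epsilon_2,\ 0\}$ let $V(\lambda)\subset V\otimes V$ be the $U_q(\overline{\mathfrak g})$-submodule generated by the highest weight vectors of weight $\lambda$. (One has $2\epsilon_1=2\overline\Lambda_1$, and $V(\epsilon_1+\epsilon_2)$ is the component written $V(\overline\Lambda_2)$.)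 These three submodules are irreducible, $V\otimes V=V(2\epsilon_1)\oplus V(\epsilon_1+\epsilon_2)\oplus V(0)$, and for the projections $P_{2\epsilon_1},P_{\epsilon_1+\epsilon_2},P_0$ of this decomposition and all $z\in K$, $$\check R(z)=(1-q^2z)(1-\xi z)P_{2\epsilon_1}+(1-\xi z)(z-q^2)P_{\epsilon_1+\epsilon_2}+(1-q^2z)(z-\xi)P_0$$ for $A^{(2)}_{2n}$, $A^{(2)\dagger}_{2n-1}$, $C^{(1)}_n$, and $$\check R(z)=(1-q^2z)(1-\xi z)P_{2\epsilon_1}+(1-\xi z)(z-q^2)P_{\epsilon_1+\epsilon_2}+(z-q^2)(z-\xi)P_0$$ for $A^{(2)}_{2n-1}$. -/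

import Mathlib

open scoped TensorProduct

namespace QWedge

/-- The affine types: `A^{(2)}_{2n}`, `A^{(2)}_{2n-1}`, the relabelled `A^{(2)†}_{2n-1}`
(0-vertex at the other end of the diagram), and `C^{(1)}_n`.  The associated simple Lie algebras
are `B_n`, `C_n`, `D_n`, `C_n` respectively. -/
inductive AffType
  | A2even
  | A2odd
  | A2oddDagger
  | C1
  deriving DecidableEq

/-- The smallest admissible rank of each type. -/
def AffType.minRank : AffType → ℕ
  | .A2even => 2
  | .A2odd => 3
  | .A2oddDagger => 3
  | .C1 => 2

/-- The index set `J`: `{0, ±1, …, ±n}` for `A^{(2)}_{2n}`, and `{±1, …, ±n}` otherwise. -/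
noncomputable def J (ty : AffType) (n : ℕ) : Finset ℤ :=
  (Finset.Icc (-(n : ℤ)) n).filter fun j => ty = .A2even ∨ j ≠ 0

/-- Position of an index in the linear order `1 ≺ 2 ≺ ⋯ ≺ n (≺ 0) ≺ -n ≺ ⋯ ≺ -2 ≺ -1`. -/
def pos (n : ℕ) (j : ℤ) : ℤ :=
  if 0 < j then j else if j = 0 then n + 1 else j + (2 * n + 2)

/-- The linear order `1 ≺ 2 ≺ ⋯ ≺ n (≺ 0) ≺ -n ≺ ⋯ ≺ -2 ≺ -1`. -/
def Prec (n : ℕ) (i j : ℤ) : Prop := pos n i < pos n j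

instance (n : ℕ) (i j : ℤ) : Decidable (Prec n i j) :=
  inferInstanceAs (Decidable (pos n i < pos n j))

/-- Kronecker delta. -/
def dlt (i j : ℤ) : ℤ := if i = j then 1 else 0

/-- The exponent of `q` in the eigenvalue of `π(t_i)`, `1 ≤ i ≤ n`, on `v_j`. -/
def tExp (ty : AffType) (n : ℕ) (i j : ℤ) : ℤ :=
  if i < n then dlt j i - dlt j (i + 1) + dlt j (-i - 1) - dlt j (-i)
  else match ty with
    | .A2even => dlt j n - dlt j (-n)
    | .A2odd => 2 * dlt j n - 2 * dlt j (-n)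
    | .C1 => 2 * dlt j n - 2 * dlt j (-n)
    | .A2oddDagger => dlt j (n - 1) + dlt j n - dlt j (-n) - dlt j (-n + 1)

/-- For a weight `lam = ∑ lam_k ε_k`, the number `(α_i | lam)`, `1 ≤ i ≤ n`, where
`(ε_k | ε_l) = δ_{kl}` and `α_i = ε_i - ε_{i+1}` for `i < n`, while `α_n` is `ε_n`
(type `B_n`), `2 ε_n` (type `C_n`) or `ε_{n-1} + ε_n` (type `D_n`). -/
def rootPairing (ty : AffType) (n : ℕ) (i : ℤ) (lam : ℤ → ℤ) : ℤ :=
  if i < n then lam i - lam (i + 1)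
  else match ty with
    | .A2even => lam n
    | .A2odd => 2 * lam n
    | .C1 => 2 * lam n
    | .A2oddDagger => lam (n - 1) + lam n

/-- The integer `N`. -/
def bigN (ty : AffType) (n : ℕ) : ℤ :=
  match ty with
  | .A2even => 2 * n + 1
  | .A2odd => 2 * n + 2
  | .A2oddDagger => 2 * n
  | .C1 => 2 * n + 2

/-- The integer `j̄`: it is `j` for `j > 0`, `n + 1` for `j = 0`, `j + N` for `j < 0`. -/
def bar (ty : AffType) (n : ℕ) (j : ℤ) : ℤ :=
  if 0 < j then j else if j = 0 then n + 1 else j + bigN ty n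

noncomputable section

variable {K : Type*} [Field K]

/-- The parameter `ξ`. -/
def xi (ty : AffType) (n : ℕ) (q : K) : K :=
  match ty with
  | .A2even => -q ^ (2 * n + 1)
  | .A2odd => -q ^ (2 * n)
  | .A2oddDagger => -q ^ (2 * n)
  | .C1 => q ^ (2 * n + 2)

/-- `[2]_n = q_n + q_n⁻¹` for `A^{(2)}_{2n}`, where `q_n = qh` is a square root of `q`. -/
def two (qh : K) : K := qh + qh⁻¹

/-- The signs `ε_j`.  (The value at `j = 0` matters for `A^{(2)}_{2n}` only.) -/
def eps (ty : AffType) (qh : K) (j : ℤ) : K :=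
  match ty with
  | .A2oddDagger => 1
  | _ => if 0 < j then 1 else if j = 0 then two qh else -1

/-- The coefficients `a_{ij}(z)`. -/
def a (ty : AffType) (n : ℕ) (q qh z : K) (i j : ℤ) : K :=
  if i = j then
    (q ^ 2 - xi ty n q * z) * (1 - z) +
      (if i = 0 then (1 - q) * (q + z) * (1 - xi ty n q * z) else 0)
  else if Prec n i j then
    (1 - q ^ 2) * (eps ty qh j * (eps ty qh i)⁻¹ * (-q) ^ (bar ty n j - bar ty n i) * (z - 1) +
      (if i = -j then 1 - xi ty n q * z else 0))
  else
    (1 - q ^ 2) * z *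
      (eps ty qh j * (eps ty qh i)⁻¹ * xi ty n q * (-q) ^ (bar ty n j - bar ty n i) * (z - 1) +
        (if i = -j then 1 - xi ty n q * z else 0))

variable (K) in
/-- The vector space `V = ⨁_{j ∈ J} K v_j`. -/
abbrev V (ty : AffType) (n : ℕ) : Type _ := ↥(J ty n) → K

/-- The matrix unit `E_{ij}`, i.e. `E_{ij} v_k = δ_{jk} v_i` (it is `0` unless `i, j ∈ J`). -/
def E (ty : AffType) (n : ℕ) (i j : ℤ) : Module.End K (V K ty n) :=
  Matrix.toLin' (Matrix.of fun k l : ↥(J ty n) => if (k : ℤ) = i ∧ (l : ℤ) = j then (1 : K) else 0)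

/-- The operators `π(e_i)`, `1 ≤ i ≤ n`. -/
def piE (ty : AffType) (n : ℕ) (qh : K) (i : ℤ) : Module.End K (V K ty n) :=
  if i < n then E ty n i (i + 1) + E ty n (-i - 1) (-i)
  else match ty with
    | .A2even => two qh • E .A2even n n 0 + E .A2even n 0 (-n)
    | .A2odd => E .A2odd n n (-n)
    | .C1 => E .C1 n n (-n)
    | .A2oddDagger => E .A2oddDagger n (n - 1) (-n) + E .A2oddDagger n n (-n + 1)

/-- The operators `π(f_i)`, `1 ≤ i ≤ n`. -/
def piF (ty : AffType) (n : ℕ) (qh : K) (i : ℤ) : Module.End K (V K ty n) :=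
  if i < n then E ty n (i + 1) i + E ty n (-i) (-i - 1)
  else match ty with
    | .A2even => E .A2even n 0 n + two qh • E .A2even n (-n) 0
    | .A2odd => E .A2odd n (-n) n
    | .C1 => E .C1 n (-n) n
    | .A2oddDagger => E .A2oddDagger n (-n) (n - 1) + E .A2oddDagger n (-n + 1) n

/-- The operators `π(t_i)`, `1 ≤ i ≤ n`. -/
def piT (ty : AffType) (n : ℕ) (q : K) (i : ℤ) : Module.End K (V K ty n) :=
  ∑ j ∈ J ty n, q ^ tExp ty n i j • E ty n j j

/-- The operators `π(t_i⁻¹) = π(t_i)⁻¹`, `1 ≤ i ≤ n`. -/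
def piTinv (ty : AffType) (n : ℕ) (q : K) (i : ℤ) : Module.End K (V K ty n) :=
  ∑ j ∈ J ty n, q ^ (-tExp ty n i j) • E ty n j j

variable (K) in
/-- The space `V ⊗ V`. -/
abbrev VV (ty : AffType) (n : ℕ) : Type _ := V K ty n ⊗[K] V K ty n

/-- `(π ⊗ π)Δ(e_i)` with `Δ(e_i) = e_i ⊗ t_i⁻¹ + 1 ⊗ e_i`. -/
def deltaE (ty : AffType) (n : ℕ) (q qh : K) (i : ℤ) : Module.End K (VV K ty n) :=
  TensorProduct.map (piE ty n qh i) (piTinv ty n q i) +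
    TensorProduct.map LinearMap.id (piE ty n qh i)

/-- `(π ⊗ π)Δ(f_i)` with `Δ(f_i) = f_i ⊗ 1 + t_i ⊗ f_i`. -/
def deltaF (ty : AffType) (n : ℕ) (q qh : K) (i : ℤ) : Module.End K (VV K ty n) :=
  TensorProduct.map (piF ty n qh i) LinearMap.id +
    TensorProduct.map (piT ty n q i) (piF ty n qh i)

/-- `(π ⊗ π)Δ(t_i)` with `Δ(t_i) = t_i ⊗ t_i`. -/
def deltaT (ty : AffType) (n : ℕ) (q : K) (i : ℤ) : Module.End K (VV K ty n) :=
  TensorProduct.map (piT ty n q i) (piT ty n q i)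

/-- `(π ⊗ π)Δ(t_i⁻¹)`. -/
def deltaTinv (ty : AffType) (n : ℕ) (q : K) (i : ℤ) : Module.End K (VV K ty n) :=
  TensorProduct.map (piTinv ty n q i) (piTinv ty n q i)

/-- The image of `U_q(ḡ)` (generated by `e_i, f_i, t_i^{±1}`, `1 ≤ i ≤ n`) in `End(V ⊗ V)` under
`(π ⊗ π)Δ`.  The `U_q(ḡ)`-submodules of `V ⊗ V` are the submodules over this algebra. -/
def Uq (ty : AffType) (n : ℕ) (q qh : K) : Subalgebra K (Module.End K (VV K ty n)) :=
  Algebra.adjoin K {x | ∃ i : ℤ, 1 ≤ i ∧ i ≤ n ∧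
    (x = deltaE ty n q qh i ∨ x = deltaF ty n q qh i ∨
      x = deltaT ty n q i ∨ x = deltaTinv ty n q i)}

/-- `u` is annihilated by all `e_i` and has weight `lam` for `U_q(ḡ)`: `t_i u = q^{(α_i|lam)} u`
for `1 ≤ i ≤ n`. -/
def IsHighestWeight (ty : AffType) (n : ℕ) (q qh : K) (lam : ℤ → ℤ) (u : VV K ty n) : Prop :=
  ∀ i : ℤ, 1 ≤ i → i ≤ n →
    deltaE ty n q qh i u = 0 ∧ deltaT ty n q i u = q ^ rootPairing ty n i lam • u

/-- The highest weights of the three components: `2ε_1 = 2Λ̄_1`, `ε_1 + ε_2` (written `Λ̄_2`),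
and `0`. -/
def weight : Fin 3 → ℤ → ℤ
  | 0 => fun k => 2 * dlt k 1
  | 1 => fun k => dlt k 1 + dlt k 2
  | 2 => fun _ => 0

/-- The component of `V ⊗ V` of highest weight `weight k`: the `U_q(ḡ)`-submodule generated by
the highest weight vectors of that weight. -/
def component (ty : AffType) (n : ℕ) (q qh : K) (k : Fin 3) :
    Submodule (Uq ty n q qh) (VV K ty n) :=
  Submodule.span (Uq ty n q qh) {u | IsHighestWeight ty n q qh (weight k) u}

/-- A `U_q(ḡ)`-submodule of `V ⊗ V` is irreducible: it is nonzero, and it contains no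
`U_q(ḡ)`-submodule besides `0` and itself (an atom of the lattice of submodules). -/
def IsIrreducible (ty : AffType) (n : ℕ) (q qh : K)
    (W : Submodule (Uq ty n q qh) (VV K ty n)) : Prop :=
  IsAtom W

/-- The `R`-matrix `Ř(z)` on `V ⊗ V`. -/
def Rcheck (ty : AffType) (n : ℕ) (q qh z : K) : Module.End K (VV K ty n) :=
  ((1 - q ^ 2 * z) * (1 - xi ty n q * z)) •
      (∑ i ∈ J ty n with i ≠ 0, TensorProduct.map (E ty n i i) (E ty n i i)) +
    (q * (1 - z) * (1 - xi ty n q * z)) •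
      (∑ i ∈ J ty n, ∑ j ∈ J ty n with i ≠ j ∧ i ≠ -j,
        TensorProduct.map (E ty n i j) (E ty n j i)) +
    ((1 - q ^ 2) * (1 - xi ty n q * z)) •
      ((∑ i ∈ J ty n, ∑ j ∈ J ty n with Prec n j i ∧ i ≠ -j,
          TensorProduct.map (E ty n i i) (E ty n j j)) +
        z • ∑ i ∈ J ty n, ∑ j ∈ J ty n with Prec n i j ∧ i ≠ -j,
          TensorProduct.map (E ty n i i) (E ty n j j)) +
    ∑ i ∈ J ty n, ∑ j ∈ J ty n,
      a ty n q qh z i j • TensorProduct.map (E ty n (-i) j) (E ty n i (-j))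

/-- The eigenvalues of `Ř(z)` on the three components. -/
def eigenvalue (ty : AffType) (n : ℕ) (q z : K) : Fin 3 → K
  | 0 => (1 - q ^ 2 * z) * (1 - xi ty n q * z)
  | 1 => (1 - xi ty n q * z) * (z - q ^ 2)
  | 2 =>
    match ty with
    | .A2odd => (z - q ^ 2) * (z - xi ty n q)
    | _ => (1 - q ^ 2 * z) * (z - xi ty n q)

end

end QWedge

/-! ### Basis vectors, coordinates, and the matrix coefficients of the generators. -/

namespace QWedge

noncomputable section

variable {K : Type*} [Field K]

/-! Write T for `braid`, that is Ř(0), and C for `contraction`, the rank one operator u ↦ ⟨u⟩w built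
from the invariant vector w (`invVec`) and the invariant form (`invForm`). The whole family is a
Baxterization of these two operators (`Rcheck_eq`): Ř(z) = (1 - ξz)((1 - z)T + z(1 - q²)) - z(1 -
z)(1 - q²)ξ C. Neither T nor C involves ξ. Both commute with the image of U_q, so Ř(z) does too, and
on a submodule generated by a single vector it acts by a scalar as soon as that vector is an
eigenvector.

Commutation with the e_p is a finite check on the few indices that e_p touches
(`braid_comp_deltaE_of_block`). The f_p follow by the symmetry v_k ⊗ v_l ↦ v_{-l} ⊗ v_{-k}, which
exchanges Δ(e_p) and Δ(f_p). The t_p act diagonally.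

Highest weight vectors are found by elementary means. A vector killed by every e_p has a leading
term v_k ⊗ v_1 (`exists_leading`), and if it is also homogeneous then k is 1, 2 or -1
(`Killed.classification`). This gives v_1 ⊗ v_1, v_1 ⊗ v_2 - q v_2 ⊗ v_1 and w, each up to a scalar.
Ř(z) is computed directly on the first two. For w one uses that w spans the zero-weight killed
vectors, that T preserves this line, and the closed form of `invNorm`, the value ⟨w⟩ (a quantum
dimension up to sign).

No complete reducibility theorem is used. Every nonzero submodule contains a homogeneous killed
vector (`exists_killed_homogeneous`), hence one of the three vectors. Since T has three distinct
eigenvalues on them, a nonzero submodule of a component must contain its generator, which gives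
irreducibility. The components span by the dual argument: a nonzero annihilator of their sum would
contain a homogeneous functional killed by the transposed f_p, the same classification applies to
it, and it cannot vanish on all three vectors because 1 + q² and ⟨w⟩ are nonzero. The projections
are the Lagrange interpolation polynomials of T. -/

theorem mem_J {ty : AffType} {n : ℕ} {k : ℤ} :
    k ∈ J ty n ↔ (-(n : ℤ) ≤ k ∧ k ≤ n) ∧ (ty = .A2even ∨ k ≠ 0) := by
  simp [J]

theorem mem_J_of_ne {ty : AffType} {n : ℕ} {k : ℤ} (h1 : -(n : ℤ) ≤ k) (h2 : k ≤ n) (h0 : k ≠ 0) :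
    k ∈ J ty n := mem_J.2 ⟨⟨h1, h2⟩, Or.inr h0⟩

theorem neg_mem_J {ty : AffType} {n : ℕ} {k : ℤ} : -k ∈ J ty n ↔ k ∈ J ty n := by
  simp only [mem_J, neg_ne_zero]; constructor <;> rintro ⟨_, h⟩ <;> exact ⟨by omega, h⟩

/-- The basis vector `v_k`; it is `0` unless `k ∈ J`. -/
def vb (ty : AffType) (n : ℕ) (k : ℤ) : V K ty n := fun j => if (j : ℤ) = k then 1 else 0

/-- The coordinate functional `v ↦ v_k`; it is `0` unless `k ∈ J`. -/
def ev (ty : AffType) (n : ℕ) (k : ℤ) : V K ty n →ₗ[K] K :=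
  if h : k ∈ J ty n then LinearMap.proj ⟨k, h⟩ else 0

theorem vb_eq_zero {ty : AffType} {n : ℕ} {k : ℤ} (h : k ∉ J ty n) :
    (vb ty n k : V K ty n) = 0 := by
  funext j
  have : (j : ℤ) ≠ k := fun e => h (e ▸ j.2)
  simp [vb, this]

theorem ev_eq_zero {ty : AffType} {n : ℕ} {k : ℤ} (h : k ∉ J ty n) :
    (ev ty n k : V K ty n →ₗ[K] K) = 0 := by
  simp [ev, h]

theorem vb_eq_single {ty : AffType} {n : ℕ} (k : J ty n) :
    (vb ty n k : V K ty n) = Pi.single k 1 := by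
  funext j
  rw [Pi.single_apply]
  exact if_congr Subtype.ext_iff.symm rfl rfl

theorem ev_vb {ty : AffType} {n : ℕ} {k l : ℤ} (hl : l ∈ J ty n) :
    ev ty n k (vb ty n l : V K ty n) = if k = l then 1 else 0 := by
  by_cases hk : k ∈ J ty n
  · simp [ev, hk, vb]
  · have : k ≠ l := fun e => hk (e ▸ hl)
    simp [ev_eq_zero hk, this]

theorem E_vb {ty : AffType} {n : ℕ} {i j k : ℤ} (hk : k ∈ J ty n) :
    E ty n i j (vb ty n k : V K ty n) = if k = j then vb ty n i else 0 := by
  have : (vb ty n k : V K ty n) = Pi.single ⟨k, hk⟩ 1 := vb_eq_single ⟨k, hk⟩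
  rw [E, this, Matrix.toLin'_apply, Matrix.mulVec_single_one]
  funext x
  by_cases h : k = j <;> simp [vb, h, Matrix.col_apply]

theorem V_hom_ext {ty : AffType} {n : ℕ} {W : Type*} [AddCommMonoid W] [Module K W]
    {f g : V K ty n →ₗ[K] W} (h : ∀ k ∈ J ty n, f (vb ty n k) = g (vb ty n k)) : f = g := by
  refine LinearMap.pi_ext' fun k => LinearMap.ext_ring ?_
  simpa [vb_eq_single] using h k k.2

/-- The basis vector `v_k ⊗ v_l` of `V ⊗ V`. -/
def tb (ty : AffType) (n : ℕ) (k l : ℤ) : VV K ty n := vb ty n k ⊗ₜ[K] vb ty n l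

/-- The coordinate functional of `v_k ⊗ v_l`. -/
def cf (ty : AffType) (n : ℕ) (k l : ℤ) : VV K ty n →ₗ[K] K :=
  LinearMap.mul' K K ∘ₗ TensorProduct.map (ev ty n k) (ev ty n l)

theorem cf_tb {ty : AffType} {n : ℕ} {k l a b : ℤ} (ha : a ∈ J ty n) (hb : b ∈ J ty n) :
    cf ty n k l (tb ty n a b : VV K ty n) = if k = a ∧ l = b then 1 else 0 := by
  simp only [cf, tb, LinearMap.comp_apply, TensorProduct.map_tmul, LinearMap.mul'_apply,
    ev_vb ha, ev_vb hb]
  split_ifs <;> simp_all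

theorem tb_eq_zero_left {ty : AffType} {n : ℕ} {k l : ℤ} (h : k ∉ J ty n) :
    (tb ty n k l : VV K ty n) = 0 := by simp [tb, vb_eq_zero h]

theorem tb_eq_zero_right {ty : AffType} {n : ℕ} {k l : ℤ} (h : l ∉ J ty n) :
    (tb ty n k l : VV K ty n) = 0 := by simp [tb, vb_eq_zero h]

theorem cf_eq_zero_left {ty : AffType} {n : ℕ} {k l : ℤ} (h : k ∉ J ty n) :
    (cf ty n k l : VV K ty n →ₗ[K] K) = 0 := by simp [cf, ev_eq_zero h]

theorem cf_eq_zero_right {ty : AffType} {n : ℕ} {k l : ℤ} (h : l ∉ J ty n) :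
    (cf ty n k l : VV K ty n →ₗ[K] K) = 0 := by simp [cf, ev_eq_zero h]

theorem VV_hom_ext {ty : AffType} {n : ℕ} {W : Type*} [AddCommMonoid W] [Module K W]
    {f g : VV K ty n →ₗ[K] W}
    (h : ∀ k ∈ J ty n, ∀ l ∈ J ty n, f (tb ty n k l) = g (tb ty n k l)) : f = g := by
  refine TensorProduct.ext (V_hom_ext fun k hk => V_hom_ext fun l hl => ?_)
  exact h k hk l hl

theorem eq_sum_cf {ty : AffType} {n : ℕ} (u : VV K ty n) :
    u = ∑ k ∈ J ty n, ∑ l ∈ J ty n, cf ty n k l u • tb ty n k l := by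
  have : (LinearMap.id : VV K ty n →ₗ[K] VV K ty n) =
      ∑ k ∈ J ty n, ∑ l ∈ J ty n, (cf ty n k l).smulRight (tb ty n k l) := by
    refine VV_hom_ext fun k hk l hl => ?_
    simp only [LinearMap.sum_apply, LinearMap.smulRight_apply, cf_tb hk hl, ite_smul, one_smul,
      zero_smul, LinearMap.id_apply]
    rw [Finset.sum_eq_single k, Finset.sum_eq_single l] <;> simp_all
  simpa using congrArg (fun f => f u) this

theorem VV_ext {ty : AffType} {n : ℕ} {u v : VV K ty n}
    (h : ∀ k l, cf ty n k l u = cf ty n k l v) : u = v := by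
  rw [eq_sum_cf u, eq_sum_cf v]
  simp only [h]

theorem piT_vb {ty : AffType} {n : ℕ} {q : K} {i k : ℤ} :
    piT ty n q i (vb ty n k) = q ^ tExp ty n i k • vb ty n k := by
  by_cases hk : k ∈ J ty n
  · simp only [piT, LinearMap.sum_apply, LinearMap.smul_apply, E_vb hk]
    rw [Finset.sum_eq_single k] <;> simp_all [eq_comm]
  · simp [vb_eq_zero hk]

theorem piTinv_vb {ty : AffType} {n : ℕ} {q : K} {i k : ℤ} :
    piTinv ty n q i (vb ty n k) = q ^ (-tExp ty n i k) • vb ty n k := by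
  by_cases hk : k ∈ J ty n
  · simp only [piTinv, LinearMap.sum_apply, LinearMap.smul_apply, E_vb hk]
    rw [Finset.sum_eq_single k] <;> simp_all [eq_comm]
  · simp [vb_eq_zero hk]

theorem ev_comp_piT {ty : AffType} {n : ℕ} {q : K} {i k : ℤ} :
    ev ty n k ∘ₗ piT ty n q i = q ^ tExp ty n i k • ev ty n k := by
  refine V_hom_ext fun l hl => ?_
  simp only [LinearMap.comp_apply, piT_vb, map_smul, ev_vb hl, LinearMap.smul_apply]
  split_ifs with h <;> simp [h]

theorem ev_comp_piTinv {ty : AffType} {n : ℕ} {q : K} {i k : ℤ} :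
    ev ty n k ∘ₗ piTinv ty n q i = q ^ (-tExp ty n i k) • ev ty n k := by
  refine V_hom_ext fun l hl => ?_
  simp only [LinearMap.comp_apply, piTinv_vb, map_smul, ev_vb hl, LinearMap.smul_apply]
  split_ifs with h <;> simp [h]

/-- `f_p` maps `v_k` to a nonzero multiple of `v_{dn p k}`, and to `0` if `dn p k = n + 1`. -/
def dn (ty : AffType) (n : ℕ) (p k : ℤ) : ℤ :=
  if p < n then (if k = p then p + 1 else if k = -p - 1 then -p else n + 1)
  else match ty with
    | .A2even => if k = n then 0 else if k = 0 then -n else n + 1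
    | .A2odd => if k = n then -n else n + 1
    | .C1 => if k = n then -n else n + 1
    | .A2oddDagger => if k = n - 1 then -n else if k = n then -n + 1 else n + 1

/-- The coefficient of `v_k` in `e_p v_{dn p k}`. -/
def cE (ty : AffType) (n : ℕ) (qh : K) (p k : ℤ) : K :=
  if ty = .A2even ∧ p = n ∧ k = n then two qh else 1

/-- The coefficient of `v_{dn p k}` in `f_p v_k`. -/
def cF (ty : AffType) (n : ℕ) (qh : K) (p k : ℤ) : K :=
  if ty = .A2even ∧ p = n ∧ k = 0 then two qh else 1

theorem succ_notMem_J {ty : AffType} {n : ℕ} : (n : ℤ) + 1 ∉ J ty n := by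
  rw [mem_J]; omega

theorem piF_vb {ty : AffType} {n : ℕ} (hn : ty.minRank ≤ n) {qh : K} {p k : ℤ} (h1 : 1 ≤ p)
    (h2 : p ≤ n) :
    piF ty n qh p (vb ty n k) = cF ty n qh p k • vb ty n (dn ty n p k) := by
  by_cases hk : k ∈ J ty n
  · have hv : (vb ty n (n + 1) : V K ty n) = 0 := vb_eq_zero succ_notMem_J
    rcases h2.lt_or_eq with h | rfl
    · simp only [piF, dn, cF, h, h.ne, if_true, LinearMap.add_apply, E_vb hk, false_and, and_false,
        if_false, one_smul]
      split_ifs <;> first | omega | simp [hv]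
    · cases ty <;> simp only [AffType.minRank] at hn <;>
        simp only [piF, dn, cF, lt_irrefl, if_false, LinearMap.add_apply, LinearMap.smul_apply,
          E_vb hk, true_and, reduceCtorEq, false_and] <;>
        split_ifs <;> first | omega | simp [hv]
  · rw [vb_eq_zero hk, map_zero]
    -- Outside J the value of `dn` is the sentinel n + 1, also outside J, so both sides vanish and
    -- no membership hypothesis on k is needed.
    have : dn ty n p k = n + 1 := by
      have := mem_J.not.1 hk
      unfold dn
      cases ty <;> simp only [AffType.minRank, reduceCtorEq, true_or, false_or, and_true] at * <;>
        split_ifs <;> omega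
    rw [this, vb_eq_zero succ_notMem_J, smul_zero]

/-- Up to the position of the factor [2]_n, e_p is the transpose of f_p. Hence the index map `dn`
that describes f_p on basis vectors also describes e_p on coordinates, and vectors and functionals
can be treated by one combinatorial argument. -/
theorem ev_comp_piE {ty : AffType} {n : ℕ} (hn : ty.minRank ≤ n) {qh : K} {p k : ℤ} (h1 : 1 ≤ p)
    (h2 : p ≤ n) :
    ev ty n k ∘ₗ piE ty n qh p = cE ty n qh p k • ev ty n (dn ty n p k) := by
  refine V_hom_ext fun l hl => ?_
  have hl' := mem_J.1 hl
  have e1 : ∀ (m r : ℤ), ev ty n k (if l = m then vb ty n r else 0 : V K ty n) =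
    if l = m ∧ k = r ∧ k ∈ J ty n then 1 else 0 := by
    intro m r
    by_cases hr : r ∈ J ty n
    · split_ifs with h h' h' <;> simp_all [ev_vb]
    · have : ¬(l = m ∧ k = r ∧ k ∈ J ty n) := fun h => hr (h.2.1 ▸ h.2.2)
      rw [vb_eq_zero hr, if_neg this]; simp
  simp only [LinearMap.comp_apply, LinearMap.smul_apply, ev_vb hl]
  rcases h2.lt_or_eq with h | rfl
  · simp only [piE, dn, cE, h, h.ne, if_true, LinearMap.add_apply, E_vb hl, false_and, and_false,
      if_false, one_smul, map_add, e1, mem_J]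
    cases ty <;> simp only [AffType.minRank, reduceCtorEq, true_or, false_or, and_true] at * <;>
    split_ifs <;> first | omega | simp
  · cases ty <;> simp only [AffType.minRank, reduceCtorEq, true_or, false_or, and_true] at * <;>
      simp only [piE, dn, cE, lt_irrefl, if_false, LinearMap.add_apply, LinearMap.smul_apply,
        E_vb hl, true_and, reduceCtorEq, false_and, map_add, map_smul, e1, mem_J,
        true_or, false_or, and_true] <;>
      split_ifs <;> first | omega | simp

/-- Turns annihilation by Δ(e_p) into a two-term recurrence on coordinates, of the shape of `raise`
below. -/
theorem cf_comp_deltaE {ty : AffType} {n : ℕ} (hn : ty.minRank ≤ n) {q qh : K} {p k l : ℤ}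
    (h1 : 1 ≤ p) (h2 : p ≤ n) (u : VV K ty n) :
    cf ty n k l (deltaE ty n q qh p u) =
      cE ty n qh p k * q ^ (-tExp ty n p l) * cf ty n (dn ty n p k) l u +
        cE ty n qh p l * cf ty n k (dn ty n p l) u := by
  have : cf ty n k l ∘ₗ deltaE ty n q qh p =
      (cE ty n qh p k * q ^ (-tExp ty n p l)) • cf ty n (dn ty n p k) l +
        cE ty n qh p l • cf ty n k (dn ty n p l) := by
    simp only [cf, deltaE, LinearMap.comp_add, LinearMap.comp_assoc, ← TensorProduct.map_comp,
      ev_comp_piE hn h1 h2, ev_comp_piTinv, LinearMap.comp_id, TensorProduct.map_smul_left,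
      TensorProduct.map_smul_right, LinearMap.comp_smul, smul_smul, mul_comm]
  simpa using congrArg (fun f => f u) this

theorem cf_comp_deltaT {ty : AffType} {n : ℕ} {q : K} (hq : q ≠ 0) {p k l : ℤ} (u : VV K ty n) :
    cf ty n k l (deltaT ty n q p u) = q ^ (tExp ty n p k + tExp ty n p l) * cf ty n k l u := by
  have : cf ty n k l ∘ₗ deltaT ty n q p = q ^ (tExp ty n p k + tExp ty n p l) • cf ty n k l := by
    simp only [cf, deltaT, LinearMap.comp_assoc, ← TensorProduct.map_comp,
      ev_comp_piT, TensorProduct.map_smul_left,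
      TensorProduct.map_smul_right, LinearMap.comp_smul, smul_smul, zpow_add₀ hq, mul_comm]
  simpa using congrArg (fun f => f u) this

/-- The dual of the previous recurrence: evaluating a functional on both sides gives the same
two-term shape with other nonzero coefficients. -/
theorem deltaF_tb {ty : AffType} {n : ℕ} (hn : ty.minRank ≤ n) {q qh : K} {p k l : ℤ} (h1 : 1 ≤ p)
    (h2 : p ≤ n) :
    deltaF ty n q qh p (tb ty n k l) =
      cF ty n qh p k • tb ty n (dn ty n p k) l +
        (q ^ tExp ty n p k * cF ty n qh p l) • tb ty n k (dn ty n p l) := by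
  simp only [deltaF, tb, LinearMap.add_apply, TensorProduct.map_tmul, piF_vb hn h1 h2, piT_vb,
    LinearMap.id_apply, TensorProduct.tmul_smul, TensorProduct.smul_tmul', smul_smul, mul_comm]

theorem deltaT_tb {ty : AffType} {n : ℕ} {q : K} (hq : q ≠ 0) {p k l : ℤ} :
    deltaT ty n q p (tb ty n k l) = q ^ (tExp ty n p k + tExp ty n p l) • tb ty n k l := by
  simp only [deltaT, tb, TensorProduct.map_tmul, piT_vb, TensorProduct.tmul_smul,
    TensorProduct.smul_tmul', smul_smul, zpow_add₀ hq, mul_comm]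

theorem deltaTinv_tb {ty : AffType} {n : ℕ} {q : K} (hq : q ≠ 0) {p k l : ℤ} :
    deltaTinv ty n q p (tb ty n k l) = q ^ (-(tExp ty n p k + tExp ty n p l)) • tb ty n k l := by
  simp only [deltaTinv, tb, TensorProduct.map_tmul, piTinv_vb, TensorProduct.tmul_smul,
    TensorProduct.smul_tmul', smul_smul, neg_add, zpow_add₀ hq, mul_comm]

end

end QWedge

/-! ### Weights and the order on indices. -/

namespace QWedge

section Weights

/-- The weight of `v_k`. -/
def wt (k : ℤ) : ℤ → ℤ := fun p => dlt k p - dlt k (-p)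

theorem tExp_eq_rootPairing {ty : AffType} {n : ℕ} {p k : ℤ} :
    tExp ty n p k = rootPairing ty n p (wt k) := by
  have e1 : -(p + 1) = -p - 1 := by ring
  have e2 : -((n : ℤ) - 1) = -n + 1 := by ring
  cases ty <;> simp only [tExp, rootPairing, wt, e1, e2] <;> split_ifs <;> ring

theorem rootPairing_add {ty : AffType} {n : ℕ} {p : ℤ} {f g : ℤ → ℤ} :
    rootPairing ty n p (fun k => f k + g k) = rootPairing ty n p f + rootPairing ty n p g := by
  cases ty <;> simp only [rootPairing] <;> split_ifs <;> ring

/-- The simple roots are linearly independent: the last one or two pairings determine the coordinate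
at n, and the differences then propagate downwards. -/
theorem rootPairing_injective {ty : AffType} {n : ℕ} (hn : ty.minRank ≤ n) {f g : ℤ → ℤ}
    (h : ∀ p : ℤ, 1 ≤ p → p ≤ n → rootPairing ty n p f = rootPairing ty n p g)
    {p : ℤ} (h1 : 1 ≤ p) (h2 : p ≤ n) : f p = g p := by
  have hn2 : 2 ≤ n := by cases ty <;> simp only [AffType.minRank] at hn <;> omega
  have step : ∀ p : ℤ, 1 ≤ p → p < n → f p - f (p + 1) = g p - g (p + 1) := fun p h1 h2 => by
    simpa [rootPairing, h2] using h p h1 h2.le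
  have last : f n = g n := by
    have hl := h n (by omega) le_rfl
    -- Needed for type D, where α_n only gives the sum of the last two coordinates; with their
    -- difference this determines twice the last one.
    have hs := step (n - 1) (by omega) (by omega)
    rw [sub_add_cancel] at hs
    cases ty <;> simp only [rootPairing, lt_irrefl, if_false] at hl <;> omega
  have main : ∀ j : ℕ, j < n → f (n - j) = g (n - j) := by
    intro j
    induction j with
    | zero => intro _; simpa using last
    | succ j ih =>
      intro hj
      have hs := step (n - (j + 1 : ℕ)) (by omega) (by omega)
      have e : (n : ℤ) - (j + 1 : ℕ) + 1 = n - j := by push_cast; ring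
      rw [e, ih (by omega)] at hs
      linarith
  have e : p = n - ((n - p).toNat : ℤ) := by omega
  rw [e]
  exact main _ (by omega)

/-- The weights of the v_k are 0 and ±ε_i, so a sum of two of them determines the pair up to order
unless the sum is zero. The sum with v_1 is zero exactly when m = -1. -/
theorem eq_of_wt_add_wt_eq {ty : AffType} {n : ℕ} {k l m : ℤ} (hn : 1 ≤ n)
    (hk : k ∈ J ty n) (hl : l ∈ J ty n) (hm : m ∈ J ty n)
    (h : ∀ p : ℤ, 1 ≤ p → p ≤ n → wt k p + wt l p = wt m p + wt 1 p) :
    (m = -1 ∧ l = -k) ∨ (m ≠ -1 ∧ (k = m ∧ l = 1 ∨ k = 1 ∧ l = m)) := by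
  simp only [mem_J] at hk hl hm
  have hneg : ∀ k p, wt k (-p) = -wt k p := fun k p => by simp only [wt, neg_neg]; ring
  have hall : ∀ p : ℤ, -n ≤ p → p ≤ n → wt k p + wt l p = wt m p + wt 1 p := by
    intro p h1 h2
    rcases lt_trichotomy p 0 with hp | rfl | hp
    · have := h (-p) (by omega) (by omega)
      simp only [hneg] at this
      omega
    · simp [wt]
    · exact h p (by omega) h2
  -- All four weights are supported on ± the four indices, so testing at 1, k, l and m is enough.
  have e1 := hall 1 (by omega) (by omega)
  have eK := hall k (by omega) (by omega)
  have eL := hall l (by omega) (by omega)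
  have eM := hall m (by omega) (by omega)
  clear h hall hneg hk hl hm hn
  simp only [wt, dlt] at *
  grind (splits := 40)

end Weights

/-- Lowering moves strictly to the right in ≺. This is the triangularity behind the extremal
arguments below. -/
theorem pos_lt_pos_dn {ty : AffType} {n : ℕ} (hn : ty.minRank ≤ n) {p k : ℤ} (h1 : 1 ≤ p)
    (h2 : p ≤ n) (hk : k ∈ J ty n) (hd : dn ty n p k ∈ J ty n) :
    pos n k < pos n (dn ty n p k) := by
  rw [mem_J] at hk hd
  unfold dn pos at *
  cases ty <;> simp only [AffType.minRank] at * <;> grind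

/-- Only v_1 is a highest weight vector of V: every other index is reached by a lowering. The last
clause, that only 2 requires starting from 1, rules out the spurious leading terms in
`Killed.classification`. -/
theorem exists_dn_eq {ty : AffType} {n : ℕ} (hn : ty.minRank ≤ n) {l : ℤ} (hl : l ∈ J ty n)
    (hl1 : l ≠ 1) : ∃ p m : ℤ, 1 ≤ p ∧ p ≤ n ∧ m ∈ J ty n ∧ dn ty n p m = l ∧ (l ≠ 2 → m ≠ 1) := by
  simp only [mem_J] at hl ⊢
  by_cases h : 1 < l
  · exact ⟨l - 1, l - 1, by omega, by omega, ⟨by omega, Or.inr (by omega)⟩, by simp [dn]; omega,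
      by omega⟩
  by_cases h' : -n < l ∧ l < 0
  · refine ⟨-l, l - 1, by omega, by omega, ⟨by omega, Or.inr (by omega)⟩, ?_, by omega⟩
    unfold dn; grind
  cases ty <;> simp only [AffType.minRank] at *
  · by_cases hl0 : l = 0
    · exact ⟨n, n, by omega, by omega, ⟨by omega, Or.inl trivial⟩, by simp [dn, hl0], by omega⟩
    · exact ⟨n, 0, by omega, by omega, ⟨by omega, Or.inl trivial⟩, by simp [dn]; grind, by omega⟩
  · exact ⟨n, n, by omega, by omega, ⟨by omega, Or.inr (by omega)⟩, by simp [dn]; grind, by omega⟩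
  · exact ⟨n, n - 1, by omega, by omega, ⟨by omega, Or.inr (by omega)⟩, by simp [dn]; grind,
      by omega⟩
  · exact ⟨n, n, by omega, by omega, ⟨by omega, Or.inr (by omega)⟩, by simp [dn]; grind, by omega⟩

/-! ### Killed coefficient functions, for vectors and functionals alike. -/

section Coefficients

variable {K : Type*} [Field K] {ty : AffType} {n : ℕ}

/-- The coefficient function `c` is supported on `J × J`. -/
def SuppJ (ty : AffType) (n : ℕ) (c : ℤ → ℤ → K) : Prop :=
  ∀ k l, c k l ≠ 0 → k ∈ J ty n ∧ l ∈ J ty n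

/-- The operator on coefficient functions induced by a lowering operator, twisted by `x`, `y`. -/
def raise (ty : AffType) (n : ℕ) (x y : ℤ → ℤ → ℤ → K) (p : ℤ) (c : ℤ → ℤ → K) : ℤ → ℤ → K :=
  fun k l => x p k l * c (dn ty n p k) l + y p k l * c k (dn ty n p l)

/-- The coefficient function `c` is annihilated by all raising operators. -/
def Killed (ty : AffType) (n : ℕ) (x y : ℤ → ℤ → ℤ → K) (c : ℤ → ℤ → K) : Prop :=
  ∀ p : ℤ, 1 ≤ p → p ≤ n → raise ty n x y p c = 0

/-- All indices in the support of `c` have the same weight. -/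
def Homogeneous (ty : AffType) (n : ℕ) (c : ℤ → ℤ → K) : Prop :=
  ∀ k l k' l', c k l ≠ 0 → c k' l' ≠ 0 → ∀ p : ℤ, 1 ≤ p → p ≤ n →
    tExp ty n p k + tExp ty n p l = tExp ty n p k' + tExp ty n p l'

variable {x y : ℤ → ℤ → ℤ → K} {c : ℤ → ℤ → K}

/-- Take the ≺-largest row k meeting the support. If l = `dn` p m, the p-th equation at (k, m)
relates c k l to an entry in the later row `dn` p k, which is zero; hence c k l = 0 for every l ≠ 1.
-/
theorem exists_leading (hn : ty.minRank ≤ n)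
    (hy : ∀ p k l, y p k l ≠ 0) (hs : SuppJ ty n c) (hc : Killed ty n x y c) (h0 : c ≠ 0) :
    ∃ k ∈ J ty n, c k 1 ≠ 0 ∧ (∀ l, l ≠ 1 → c k l = 0) := by
  classical
  have hne : ((J ty n).filter fun k => ∃ l, c k l ≠ 0).Nonempty := by
    by_contra h
    rw [Finset.not_nonempty_iff_eq_empty, Finset.filter_eq_empty_iff] at h
    refine h0 (funext₂ fun k l => by_contra fun hkl => h (hs k l hkl).1 ⟨l, hkl⟩)
  obtain ⟨k, hk, hmax⟩ := Finset.exists_max_image _ (pos n) hne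
  obtain ⟨hkJ, l₀, hl₀⟩ := Finset.mem_filter.1 hk
  have key : ∀ l, l ≠ 1 → c k l = 0 := by
    intro l hl
    by_contra hkl
    obtain ⟨p, m, h1, h2, hm, hd, -⟩ := exists_dn_eq hn (hs k l hkl).2 hl
    have := congrFun₂ (hc p h1 h2) k m
    simp only [raise, hd, Pi.zero_apply] at this
    have hz : c (dn ty n p k) m = 0 := by
      by_contra hz
      have hJ := (hs _ _ hz).1
      exact absurd (hmax _ (Finset.mem_filter.2 ⟨hJ, m, hz⟩))
        (not_le.2 (pos_lt_pos_dn hn h1 h2 hkJ hJ))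
    rw [hz, mul_zero, zero_add] at this
    exact (mul_ne_zero (hy _ _ _) hkl) this
  refine ⟨k, hkJ, ?_, key⟩
  have : l₀ = 1 := by_contra fun h => hl₀ (key l₀ h)
  exact this ▸ hl₀

theorem two_le_of_minRank_le (hn : ty.minRank ≤ n) : 2 ≤ n := by
  cases ty <;> simp only [AffType.minRank] at hn <;> omega

theorem Killed.classification (hn : ty.minRank ≤ n) (hx : ∀ p k l, x p k l ≠ 0)
    (hy : ∀ p k l, y p k l ≠ 0) (hs : SuppJ ty n c) (hc : Killed ty n x y c)
    (hh : Homogeneous ty n c) (h0 : c ≠ 0) :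
    (c 1 1 ≠ 0 ∧ ∀ k l, c k l ≠ 0 → k = 1 ∧ l = 1) ∨
    (c 2 1 ≠ 0 ∧ ∀ k l, c k l ≠ 0 → (k = 2 ∧ l = 1) ∨ (k = 1 ∧ l = 2)) ∨
    (c (-1) 1 ≠ 0 ∧ ∀ k l, c k l ≠ 0 → l = -k) := by
  have hn2 := two_le_of_minRank_le hn
  obtain ⟨m, hm, hm1, hml⟩ := exists_leading hn hy hs hc h0
  have hsup : ∀ k l, c k l ≠ 0 →
      (m = -1 ∧ l = -k) ∨ (m ≠ -1 ∧ (k = m ∧ l = 1 ∨ k = 1 ∧ l = m)) := by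
    intro k l hkl
    refine eq_of_wt_add_wt_eq (by omega) (hs k l hkl).1 (hs k l hkl).2 hm fun p h1 h2 => ?_
    refine rootPairing_injective hn (f := fun p => wt k p + wt l p)
      (g := fun p => wt m p + wt 1 p) (fun p h1 h2 => ?_) h1 h2
    rw [rootPairing_add, rootPairing_add]
    simpa only [tExp_eq_rootPairing] using hh k l m 1 hkl hm1 p h1 h2
  by_cases e1 : m = 1
  · subst e1
    exact Or.inl ⟨hm1, fun k l hkl => by have := hsup k l hkl; omega⟩
  by_cases e2 : m = 2
  · subst e2
    exact Or.inr (Or.inl ⟨hm1, fun k l hkl => by have := hsup k l hkl; omega⟩)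
  by_cases e3 : m = -1
  · subst e3
    exact Or.inr (Or.inr ⟨hm1, fun k l hkl => by have := hsup k l hkl; omega⟩)
  exfalso
  -- Read the p-th equation at (r, 1), where m = `dn` p r. Since m ≠ 2, the index r is not 1, so (r,
  -- `dn` p 1) lies outside the weight space and the equation forces c m 1 = 0.
  obtain ⟨p, r, h1, h2, hr, hd, hr1⟩ := exists_dn_eq hn hm e1
  have := congrFun₂ (hc p h1 h2) r 1
  simp only [raise, hd, Pi.zero_apply] at this
  have hrm : r ≠ m := by
    rintro rfl
    have := pos_lt_pos_dn hn h1 h2 hr (by rwa [hd])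
    rw [hd] at this
    exact lt_irrefl _ this
  have hz : c r (dn ty n p 1) = 0 := by
    by_contra hz
    have := hsup _ _ hz
    have := hr1 e2
    omega
  rw [hz, mul_zero, add_zero] at this
  exact mul_ne_zero (hx _ _ _) hm1 this

/-- In weight zero the leading entry can only be at (-1, 1). Subtracting the multiple that cancels
this entry leaves a killed function with no possible leading entry. -/
theorem Killed.eq_smul (hn : ty.minRank ≤ n)
    (hy : ∀ p k l, y p k l ≠ 0) {c' : ℤ → ℤ → K} (hs : SuppJ ty n c) (hs' : SuppJ ty n c')
    (hc : Killed ty n x y c) (hc' : Killed ty n x y c')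
    (hd : ∀ k l, c k l ≠ 0 → l = -k) (hd' : ∀ k l, c' k l ≠ 0 → l = -k) (h1 : c' (-1) 1 ≠ 0) :
    c = (c (-1) 1 / c' (-1) 1) • c' := by
  set r := c (-1) 1 / c' (-1) 1
  have hsub : ∀ k l, c k l - r * c' k l ≠ 0 → c k l ≠ 0 ∨ c' k l ≠ 0 := by
    intro k l h
    by_contra! h'
    exact h (by rw [h'.1, h'.2]; ring)
  have hk : Killed ty n x y (c - r • c') := by
    intro p h1 h2
    have e1 := hc p h1 h2
    have e2 := hc' p h1 h2
    funext k l
    have e1 := congrFun₂ e1 k l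
    have e2 := congrFun₂ e2 k l
    simp only [raise, Pi.zero_apply, Pi.sub_apply, Pi.smul_apply, smul_eq_mul] at *
    linear_combination e1 - r * e2
  have hsJ : SuppJ ty n (c - r • c') := fun k l h => (hsub k l h).elim (hs k l) (hs' k l)
  by_contra hne
  obtain ⟨k, -, hk1, -⟩ := exists_leading hn hy hsJ hk (sub_ne_zero.2 hne)
  have : k = -1 := by
    have := (hsub k 1 hk1).elim (hd k 1) (hd' k 1)
    omega
  subst this
  apply hk1
  simp only [Pi.sub_apply, Pi.smul_apply, smul_eq_mul, r]
  field_simp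
  ring

/-- A double extremal choice replaces the theory of weight modules. First minimize the bound m on
pos k + pos l over the support: raising lowers this bound, so it must give zero. Then minimize the
size of the support: if two weights occurred, the action of t_p minus one of its eigenvalues would
give a smaller support. -/
theorem exists_killed_homogeneous {q : K} (hn : ty.minRank ≤ n)
    (hq : ∀ a b : ℤ, q ^ a = q ^ b → a = b)
    (A : Submodule K (ℤ → ℤ → K)) (hs : ∀ c ∈ A, SuppJ ty n c)
    (hA : ∀ p : ℤ, 1 ≤ p → p ≤ n → ∀ c ∈ A, raise ty n x y p c ∈ A)
    (hT : ∀ p : ℤ, 1 ≤ p → p ≤ n → ∀ c ∈ A,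
      (fun k l => q ^ (tExp ty n p k + tExp ty n p l) * c k l) ∈ A) (h0 : A ≠ ⊥) :
    ∃ c ∈ A, c ≠ 0 ∧ Killed ty n x y c ∧ Homogeneous ty n c := by
  classical
  have hpos : ∀ k ∈ J ty n, 1 ≤ pos n k ∧ pos n k ≤ 2 * n + 2 := by
    intro k hk
    rw [mem_J] at hk
    unfold pos
    grind
  let S : ℕ → Set (ℤ → ℤ → K) := fun m =>
    {c | c ∈ A ∧ c ≠ 0 ∧ ∀ k l, c k l ≠ 0 → pos n k + pos n l ≤ m}
  have hS : ∃ m, (S m).Nonempty := by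
    obtain ⟨c, hc, hc0⟩ := Submodule.exists_mem_ne_zero_of_ne_bot h0
    refine ⟨4 * n + 4, c, hc, hc0, fun k l h => ?_⟩
    have := hpos k (hs c hc k l h).1
    have := hpos l (hs c hc k l h).2
    push_cast
    omega
  let m := Nat.find hS
  have hm : (S m).Nonempty := Nat.find_spec hS
  let f : (ℤ → ℤ → K) → ℕ := fun c => ((J ty n ×ˢ J ty n).filter fun a => c a.1 a.2 ≠ 0).card
  obtain ⟨c, ⟨hcA, hc0, hcm⟩, hmin⟩ := (InvImage.wf f Nat.lt_wfRel.wf).has_min (S m) hm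
  refine ⟨c, hcA, hc0, fun p h1 h2 => ?_, ?_⟩
  · by_contra hne
    have hlt : ∀ k l, raise ty n x y p c k l ≠ 0 → pos n k + pos n l < m := by
      intro k l h
      have hJ := hs _ (hA p h1 h2 c hcA) k l h
      have : c (dn ty n p k) l ≠ 0 ∨ c k (dn ty n p l) ≠ 0 := by
        by_contra! h'
        exact h (by simp [raise, h'.1, h'.2])
      rcases this with h' | h'
      · have := pos_lt_pos_dn hn h1 h2 hJ.1 (hs c hcA _ _ h').1
        have := hcm _ _ h'
        omega
      · have := pos_lt_pos_dn hn h1 h2 hJ.2 (hs c hcA _ _ h').2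
        have := hcm _ _ h'
        omega
    obtain ⟨k₀, l₀, hkl⟩ : ∃ k l, raise ty n x y p c k l ≠ 0 := by
      by_contra! h
      exact hne (funext₂ h)
    have hJ := hs _ (hA p h1 h2 c hcA) k₀ l₀ hkl
    have hm0 : 0 < m := by
      have := hlt k₀ l₀ hkl
      have := hpos k₀ hJ.1
      have := hpos l₀ hJ.2
      omega
    refine Nat.find_min hS (m := m - 1) (by omega) ⟨_, hA p h1 h2 c hcA, hne, fun k l h => ?_⟩
    have := hlt k l h
    omega
  · intro k l k' l' hkl hkl' p h1 h2
    by_contra hne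
    -- r is the t_p-eigenvalue at (k, l), so d vanishes at (k, l) but not at (k', l').
    set r := q ^ (tExp ty n p k + tExp ty n p l)
    set d : ℤ → ℤ → K := (fun k l => q ^ (tExp ty n p k + tExp ty n p l) * c k l) - r • c
    have hd : ∀ a b, d a b = (q ^ (tExp ty n p a + tExp ty n p b) - r) * c a b := fun a b => by
      simp only [d, Pi.sub_apply, Pi.smul_apply, smul_eq_mul]; ring
    have hdA : d ∈ A := A.sub_mem (hT p h1 h2 c hcA) (A.smul_mem _ hcA)
    have hdc : ∀ a b, d a b ≠ 0 → c a b ≠ 0 := fun a b h hc => h (by rw [hd, hc, mul_zero])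
    have hd0 : d ≠ 0 := by
      intro h
      have := congrFun₂ h k' l'
      rw [hd] at this
      rcases mul_eq_zero.1 this with h | h
      · exact hne (hq _ _ (sub_eq_zero.1 h)).symm
      · exact hkl' h
    refine hmin d ⟨hdA, hd0, fun a b h => hcm a b (hdc a b h)⟩ (Finset.card_lt_card ?_)
    rw [Finset.ssubset_iff_of_subset]
    · refine ⟨(k, l), Finset.mem_filter.2 ⟨Finset.mem_product.2 (hs c hcA k l hkl), hkl⟩, ?_⟩
      simp [hd, r]
    · intro a ha
      rw [Finset.mem_filter] at ha ⊢
      exact ⟨ha.1, hdc _ _ ha.2⟩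

end Coefficients

end QWedge

/-! ### Ř(z) on the tensor basis; the invariant vector and the invariant form. -/

namespace QWedge

noncomputable section

variable {K : Type*} [Field K] {ty : AffType} {n : ℕ} {q qh z : K}

theorem map_E_tb {i j i' j' k l : ℤ} (hk : k ∈ J ty n) (hl : l ∈ J ty n) :
    TensorProduct.map (E ty n i j) (E ty n i' j') (tb ty n k l : VV K ty n) =
      if k = j ∧ l = j' then tb ty n i i' else 0 := by
  rw [tb, TensorProduct.map_tmul, E_vb hk, E_vb hl]
  split_ifs <;> simp_all [tb]

theorem sum_sum_filter_ite {M : Type*} [AddCommMonoid M] {s : Finset ℤ} {P : ℤ → ℤ → Prop}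
    [∀ i, DecidablePred (P i)] {g : ℤ → ℤ → M} {k l : ℤ} (hk : k ∈ s) (hl : l ∈ s) :
    (∑ i ∈ s, ∑ j ∈ s with P i j, if k = i ∧ l = j then g i j else 0) =
      if P k l then g k l else 0 := by
  rw [Finset.sum_eq_single k, Finset.sum_filter, Finset.sum_eq_single l]
  · simp
  · intro j _ hj
    simp [hj.symm]
  · exact fun h => absurd hl h
  · intro i _ hi
    simp [hi.symm]
  · exact fun h => absurd hk h

theorem Rcheck_tb_anti {k : ℤ} (hk : k ∈ J ty n) :
    Rcheck ty n q qh z (tb ty n k (-k)) =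
      (∑ i ∈ J ty n, a ty n q qh z i k • tb ty n (-i) i : VV K ty n) := by
  have hk' := neg_mem_J.2 hk
  simp only [Rcheck, LinearMap.add_apply, LinearMap.smul_apply, LinearMap.sum_apply,
    map_E_tb hk hk']
  have s1 : (∑ i ∈ J ty n with i ≠ 0, if k = i ∧ -k = i then (tb ty n i i : VV K ty n) else 0) =
      0 := by
    refine Finset.sum_eq_zero fun i hi => if_neg ?_
    have := (Finset.mem_filter.1 hi).2
    omega
  have s2 : (∑ i ∈ J ty n, ∑ j ∈ J ty n with i ≠ j ∧ i ≠ -j,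
      if k = j ∧ -k = i then (tb ty n i j : VV K ty n) else 0) = 0 := by
    refine Finset.sum_eq_zero fun i _ => Finset.sum_eq_zero fun j hj => if_neg ?_
    have := (Finset.mem_filter.1 hj).2
    omega
  have s3 : (∑ i ∈ J ty n, ∑ j ∈ J ty n, a ty n q qh z i j •
      if k = j ∧ -k = -j then (tb ty n (-i) i : VV K ty n) else 0) =
      ∑ i ∈ J ty n, a ty n q qh z i k • tb ty n (-i) i := by
    refine Finset.sum_congr rfl fun i _ => ?_
    rw [Finset.sum_eq_single k]
    · simp
    · intro j _ hj
      simp [hj.symm]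
    · exact fun h => absurd hk h
  rw [s1, s2, s3, sum_sum_filter_ite hk hk', sum_sum_filter_ite hk hk']
  simp

theorem Rcheck_tb_of_ne {k l : ℤ} (hkl : l ≠ -k) :
    Rcheck ty n q qh z (tb ty n k l) =
      if k = l then ((1 - q ^ 2 * z) * (1 - xi ty n q * z)) • tb ty n k l
      else (q * (1 - z) * (1 - xi ty n q * z)) • tb ty n l k +
        ((1 - q ^ 2) * (1 - xi ty n q * z)) • ((if Prec n l k then tb ty n k l else 0) +
          z • if Prec n k l then tb ty n k l else 0) := by
  by_cases hk : k ∈ J ty n; swap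
  · simp [tb_eq_zero_left hk, tb_eq_zero_right hk]
  by_cases hl : l ∈ J ty n; swap
  · simp [tb_eq_zero_left hl, tb_eq_zero_right hl]
  simp only [Rcheck, LinearMap.add_apply, LinearMap.smul_apply, LinearMap.sum_apply,
    map_E_tb hk hl]
  have s1 : (∑ i ∈ J ty n with i ≠ 0, if k = i ∧ l = i then (tb ty n i i : VV K ty n) else 0) =
      if k = l then tb ty n k l else 0 := by
    rw [Finset.sum_filter, Finset.sum_eq_single k]
    · rcases eq_or_ne k l with rfl | h
      · rw [if_pos (by omega)]
        simp
      · simp [h, h.symm]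
    · intro i _ hi
      simp [hi.symm]
    · exact fun h => absurd hk h
  have s2 : (∑ i ∈ J ty n, ∑ j ∈ J ty n with i ≠ j ∧ i ≠ -j,
      if k = j ∧ l = i then (tb ty n i j : VV K ty n) else 0) =
      if k = l then 0 else tb ty n l k := by
    simp only [and_comm (a := k = _)]
    rw [sum_sum_filter_ite hl hk, ← ite_not]
    exact if_congr (by omega) rfl rfl
  have s3 : (∑ i ∈ J ty n, ∑ j ∈ J ty n, a ty n q qh z i j •
      if k = j ∧ l = -j then (tb ty n (-i) i : VV K ty n) else 0) = 0 := by
    refine Finset.sum_eq_zero fun i _ => Finset.sum_eq_zero fun j _ => ?_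
    rw [if_neg (by omega), smul_zero]
  have hkl' : k ≠ -l := by omega
  rw [s1, s2, s3, sum_sum_filter_ite hk hl, sum_sum_filter_ite hk hl]
  rcases eq_or_ne k l with rfl | h
  · simp [Prec]
  · simp [h, hkl']

/-- The coefficients of the invariant vector. -/
def cc (ty : AffType) (n : ℕ) (q qh : K) (i : ℤ) : K :=
  (eps ty qh i)⁻¹ * (-q) ^ (-bar ty n i)

/-- The partial sums of the invariant vector. -/
def invPartial (ty : AffType) (n : ℕ) (q qh : K) (k : ℤ) : VV K ty n :=
  ∑ i ∈ J ty n with Prec n i k, cc ty n q qh i • tb ty n (-i) i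

/-- The invariant vector. -/
def invVec (ty : AffType) (n : ℕ) (q qh : K) : VV K ty n :=
  ∑ i ∈ J ty n, cc ty n q qh i • tb ty n (-i) i

/-- The invariant form. -/
def invForm (ty : AffType) (n : ℕ) (q qh : K) : VV K ty n →ₗ[K] K :=
  ∑ j ∈ J ty n, (cc ty n q qh j)⁻¹ • cf ty n j (-j)

theorem invForm_tb {k l : ℤ} (hk : k ∈ J ty n) (hl : l ∈ J ty n) :
    invForm ty n q qh (tb ty n k l) = if l = -k then (cc ty n q qh k)⁻¹ else 0 := by
  simp only [invForm, LinearMap.sum_apply, LinearMap.smul_apply, cf_tb hk hl]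
  rw [Finset.sum_eq_single k]
  · by_cases h : l = -k
    · simp [h]
    · have : -k ≠ l := fun h' => h h'.symm
      simp [h, this]
  · intro j _ hj
    simp [hj]
  · exact fun h => absurd hk h

/-- The reason for the normalization of `cc`: the coefficients in a_{ij} factor as c_i c_j⁻¹, which
are the matrix entries of the rank one operator `contraction`. -/
theorem eps_mul_zpow (hq : q ≠ 0) (i j : ℤ) :
    eps ty qh j * (eps ty qh i)⁻¹ * (-q) ^ (bar ty n j - bar ty n i) =
      cc ty n q qh i * (cc ty n q qh j)⁻¹ := by
  rw [cc, cc, zpow_sub₀ (neg_ne_zero.2 hq), zpow_neg, zpow_neg, mul_inv, inv_inv, inv_inv]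
  ring

/-- The operator `Ř(0)`. -/
abbrev braid (ty : AffType) (n : ℕ) (q qh : K) : Module.End K (VV K ty n) := Rcheck ty n q qh 0

theorem braid_diag {k : ℤ} (hk : k ≠ 0) :
    braid ty n q qh (tb ty n k k) = tb ty n k k := by
  rw [braid, Rcheck_tb_of_ne (by omega)]
  simp

theorem braid_off {k l : ℤ} (h : l ≠ -k) (h' : k ≠ l) :
    braid ty n q qh (tb ty n k l) =
      q • tb ty n l k + if Prec n l k then (1 - q ^ 2) • tb ty n k l else 0 := by
  rw [braid, Rcheck_tb_of_ne h]
  simp [h']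

/-- At z = 0 the coefficients with i ≻ k vanish, and the remaining rank one part is the invariant
vector truncated to the indices before k. -/
theorem braid_anti (hq : q ≠ 0) {k l : ℤ} (hk : k ∈ J ty n) (h : l = -k) :
    braid ty n q qh (tb ty n k l) =
      (if k = 0 then q else q ^ 2) • tb ty n l k +
        (if Prec n l k then (1 - q ^ 2) • tb ty n k l else 0) -
        ((1 - q ^ 2) * (cc ty n q qh k)⁻¹) • invPartial ty n q qh k := by
  subst h
  have key : ∀ i ∈ J ty n, a ty n q qh 0 i k • (tb ty n (-i) i : VV K ty n) =
      (if i = k then (if k = 0 then q else q ^ 2) • tb ty n (-k) k else 0) +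
      (if i = -k then (if Prec n (-k) k then (1 - q ^ 2) • tb ty n k (-k) else 0) else 0) -
      ((1 - q ^ 2) * (cc ty n q qh k)⁻¹) •
        (if Prec n i k then cc ty n q qh i • tb ty n (-i) i else 0) := by
    intro i _
    rcases eq_or_ne i k with rfl | hik
    · have h1 : ¬ Prec n i i := lt_irrefl _
      have h2 : i = -i → ¬ Prec n (-i) i := fun h => h ▸ h1
      by_cases h0 : i = 0
      · subst h0
        simp [a, h1]
        ring_nf
      · have : i ≠ -i := by omega
        simp [a, h1, h0, this]
    · by_cases hP : Prec n i k
      · simp only [a, hik, hP, if_true, if_false, eps_mul_zpow hq]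
        rcases eq_or_ne i (-k) with rfl | h3
        · simp only [if_true, hP, neg_neg]
          module
        · simp only [h3, if_false]
          module
      · simp only [a, hik, hP, if_false]
        rcases eq_or_ne i (-k) with rfl | h3
        · simp [hP]
        · simp [h3]
  rw [braid, Rcheck_tb_anti hk, Finset.sum_congr rfl key, Finset.sum_sub_distrib,
    Finset.sum_add_distrib, Finset.sum_ite_eq' _ k, Finset.sum_ite_eq' _ (-k), ← Finset.smul_sum,
    ← Finset.sum_filter, if_pos hk, if_pos (neg_mem_J.2 hk), invPartial]

theorem map_invPartial_eq (D : Module.End K (VV K ty n)) (R : Finset ℤ) (hR : R ⊆ J ty n)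
    (hD : ∀ i ∈ J ty n, i ∉ R → D (tb ty n (-i) i) = 0) (k : ℤ) :
    D (invPartial ty n q qh k) =
      ∑ i ∈ R, if Prec n i k then cc ty n q qh i • D (tb ty n (-i) i) else 0 := by
  rw [invPartial, map_sum, Finset.sum_filter]
  simp only [map_smul]
  refine (Finset.sum_subset hR fun i hi hiR => ?_).symm
  rw [hD i hi hiR]
  simp

theorem map_invVec_eq (D : Module.End K (VV K ty n)) (R : Finset ℤ) (hR : R ⊆ J ty n)
    (hD : ∀ i ∈ J ty n, i ∉ R → D (tb ty n (-i) i) = 0) :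
    D (invVec ty n q qh) = ∑ i ∈ R, cc ty n q qh i • D (tb ty n (-i) i) := by
  rw [invVec, map_sum]
  simp only [map_smul]
  refine (Finset.sum_subset hR fun i hi hiR => ?_).symm
  rw [hD i hi hiR]
  simp

theorem deltaE_tb (p k l : ℤ) :
    deltaE ty n q qh p (tb ty n k l) =
      q ^ (-tExp ty n p l) • (piE ty n qh p (vb ty n k) ⊗ₜ[K] vb ty n l) +
        vb ty n k ⊗ₜ[K] piE ty n qh p (vb ty n l) := by
  simp [deltaE, tb, TensorProduct.map_tmul, piTinv_vb, TensorProduct.tmul_smul]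

theorem eps_ne_zero (h2 : ty = .A2even → two qh ≠ 0) {i : ℤ} (hi : i ∈ J ty n) :
    eps ty qh i ≠ 0 := by
  rw [mem_J] at hi
  cases ty <;> simp only [eps, reduceCtorEq, false_or] at hi ⊢ <;> (try split_ifs) <;>
    first | exact one_ne_zero | exact neg_ne_zero.2 one_ne_zero | exact h2 rfl | omega

theorem cc_ne_zero (hq : q ≠ 0) (h2 : ty = .A2even → two qh ≠ 0) {i : ℤ} (hi : i ∈ J ty n) :
    cc ty n q qh i ≠ 0 :=
  mul_ne_zero (inv_ne_zero (eps_ne_zero h2 hi)) (zpow_ne_zero _ (neg_ne_zero.2 hq))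

/-- The ratio -q⁻¹ of neighbours is what makes the two contributions to Δ(e_p)w cancel for p < n. -/
theorem cc_succ (hq : q ≠ 0) {i : ℤ} (h : 0 < i ∨ i + 1 < 0) :
    cc ty n q qh (i + 1) = -q⁻¹ * cc ty n q qh i := by
  have e1 : eps ty qh (i + 1) = eps ty qh i := by
    cases ty <;> simp only [eps] <;> split_ifs <;> first | rfl | omega
  have e2 : -bar ty n (i + 1) = -bar ty n i + (-1) := by
    unfold bar; split_ifs <;> omega
  rw [cc, cc, e1, e2, zpow_add₀ (neg_ne_zero.2 hq), zpow_neg_one, inv_neg]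
  ring

end

end QWedge

/-! ### The generators e_p with p < n. -/

namespace QWedge

noncomputable section

variable {K : Type*} [Field K] {ty : AffType} {n : ℕ} {q qh z : K}

theorem deltaE_tb_of_lt {p k l : ℤ} (h1 : 1 ≤ p) (h2 : p < n) :
    deltaE ty n q qh p (tb ty n k l) =
      ((if k = p + 1 then q ^ (-tExp ty n p l) • tb ty n p l else 0) +
        if k = -p then q ^ (-tExp ty n p l) • tb ty n (-p - 1) l else 0) +
      ((if l = p + 1 then tb ty n k p else 0) + if l = -p then tb ty n k (-p - 1) else 0) := by
  have key : ∀ k, piE ty n qh p (vb ty n k : V K ty n) =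
      (if k = p + 1 then vb ty n p else 0) + if k = -p then vb ty n (-p - 1) else 0 := by
    intro k
    by_cases hk : k ∈ J ty n
    · simp [piE, h2, E_vb hk]
    · have := mem_J.not.1 hk
      rw [vb_eq_zero hk, if_neg (by omega), if_neg (by omega)]
      simp
  rw [deltaE_tb, key, key, TensorProduct.add_tmul, TensorProduct.tmul_add]
  simp only [tb, smul_add, TensorProduct.ite_tmul, TensorProduct.tmul_ite, smul_ite, smul_zero]

theorem tExp_of_lt_pos {p k : ℤ} (h1 : 1 ≤ p) (h2 : p < n) (h : k = p ∨ k = -p - 1) :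
    tExp ty n p k = 1 := by
  simp only [tExp, h2, if_true, dlt]
  grind

theorem tExp_of_lt_neg {p k : ℤ} (h1 : 1 ≤ p) (h2 : p < n) (h : k = p + 1 ∨ k = -p) :
    tExp ty n p k = -1 := by
  simp only [tExp, h2, if_true, dlt]
  grind

theorem tExp_of_lt_zero {p k : ℤ} (h2 : p < n)
    (h : k ≠ p ∧ k ≠ -p - 1 ∧ k ≠ p + 1 ∧ k ≠ -p) : tExp ty n p k = 0 := by
  simp only [tExp, h2, if_true, dlt]
  grind

/-- Terms cancel in the pairs {p, p + 1} and {-p - 1, -p}. A truncation at k leaves something only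
if it separates a pair, which the differences of conditionals record. -/
theorem deltaE_invPartial_of_lt (hq : q ≠ 0) {p k : ℤ} (h1 : 1 ≤ p) (h2 : p < n) :
    deltaE ty n q qh p (invPartial ty n q qh k) =
      (if Prec n p k then (cc ty n q qh p * q⁻¹) • tb ty n (-p - 1) p else 0) -
      (if Prec n (p + 1) k then (cc ty n q qh p * q⁻¹) • tb ty n (-p - 1) p else 0) +
      ((if Prec n (-p - 1) k then (cc ty n q qh (-p - 1) * q⁻¹) • tb ty n p (-p - 1) else 0) -
      (if Prec n (-p) k then (cc ty n q qh (-p - 1) * q⁻¹) • tb ty n p (-p - 1) else 0)) := by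
  have c1 : cc ty n q qh (p + 1) = -q⁻¹ * cc ty n q qh p := cc_succ hq (by omega)
  have c2 : cc ty n q qh (-p) = -q⁻¹ * cc ty n q qh (-p - 1) := by
    have := cc_succ (ty := ty) (n := n) (qh := qh) hq (i := -p - 1) (by omega)
    simpa using this
  rw [map_invPartial_eq _ {p, p + 1, -p - 1, -p}]
  · rw [Finset.sum_insert, Finset.sum_insert, Finset.sum_insert, Finset.sum_singleton]
    · simp (disch := omega) only [deltaE_tb_of_lt h1 h2, tExp_of_lt_pos h1 h2, if_pos, if_neg, c1, c2]
      have e1 : -(p + 1) = -p - 1 := by ring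
      simp only [e1, neg_neg]
      simp only [zpow_neg, zpow_one]
      split_ifs <;> module
    all_goals simp only [Finset.mem_insert, Finset.mem_singleton]; omega
  · intro i hi
    simp only [Finset.mem_insert, Finset.mem_singleton] at hi
    exact mem_J_of_ne (by omega) (by omega) (by omega)
  · intro i _ hi
    simp only [Finset.mem_insert, Finset.mem_singleton] at hi
    simp (disch := omega) only [deltaE_tb_of_lt h1 h2, if_neg, add_zero]

theorem deltaE_invVec_of_lt (hq : q ≠ 0) {p : ℤ} (h1 : 1 ≤ p) (h2 : p < n) :
    deltaE ty n q qh p (invVec ty n q qh) = 0 := by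
  have c1 : cc ty n q qh (p + 1) = -q⁻¹ * cc ty n q qh p := cc_succ hq (by omega)
  have c2 : cc ty n q qh (-p) = -q⁻¹ * cc ty n q qh (-p - 1) := by
    have := cc_succ (ty := ty) (n := n) (qh := qh) hq (i := -p - 1) (by omega)
    simpa using this
  rw [map_invVec_eq _ {p, p + 1, -p - 1, -p}]
  · rw [Finset.sum_insert, Finset.sum_insert, Finset.sum_insert, Finset.sum_singleton]
    · simp (disch := omega) only [deltaE_tb_of_lt h1 h2, tExp_of_lt_pos h1 h2, if_pos, if_neg, c1, c2]
      have e1 : -(p + 1) = -p - 1 := by ring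
      simp only [e1, neg_neg, zpow_neg, zpow_one, if_true]
      module
    all_goals simp only [Finset.mem_insert, Finset.mem_singleton]; omega
  · intro i hi
    simp only [Finset.mem_insert, Finset.mem_singleton] at hi
    exact mem_J_of_ne (by omega) (by omega) (by omega)
  · intro i _ hi
    simp only [Finset.mem_insert, Finset.mem_singleton] at hi
    simp (disch := omega) only [deltaE_tb_of_lt h1 h2, if_neg, add_zero]

theorem invForm_deltaE_of_lt (hq : q ≠ 0) (htwo : ty = .A2even → two qh ≠ 0) {p : ℤ}
    (h1 : 1 ≤ p) (h2 : p < n) : invForm ty n q qh ∘ₗ deltaE ty n q qh p = 0 := by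
  have c1 : cc ty n q qh (p + 1) = -q⁻¹ * cc ty n q qh p := cc_succ hq (by omega)
  have c2 : cc ty n q qh (-p) = -q⁻¹ * cc ty n q qh (-p - 1) := by
    have := cc_succ (ty := ty) (n := n) (qh := qh) hq (i := -p - 1) (by omega)
    simpa using this
  have m1 : p ∈ J ty n := mem_J_of_ne (by omega) (by omega) (by omega)
  have m3 : -p - 1 ∈ J ty n := mem_J_of_ne (by omega) (by omega) (by omega)
  have z1 := cc_ne_zero hq htwo m1
  have z3 := cc_ne_zero hq htwo m3
  refine VV_hom_ext fun k hk l hl => ?_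
  have hc : ∀ k, k = p + 1 ∨ k = -p ∨ (k ≠ p + 1 ∧ k ≠ -p) := by intro k; omega
  simp only [LinearMap.comp_apply, deltaE_tb_of_lt h1 h2, LinearMap.zero_apply]
  rcases hc k with rfl | rfl | hk' <;> rcases hc l with rfl | rfl | hl'
  all_goals
    simp (disch := first | assumption | omega) only [if_neg, if_true, map_add, map_zero, map_smul,
      invForm_tb, tExp_of_lt_neg h1 h2, add_zero, zero_add, smul_zero, c1, c2, if_pos]
  all_goals (simp only [neg_neg, zpow_one, smul_eq_mul]; field_simp; ring)

/-- For consecutive indices k ≺ k' the truncation gains one term. This expresses all truncations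
inside a block through a single one. -/
theorem invPartial_eq_add {k k' : ℤ} (hk : k ∈ J ty n)
    (h : ∀ i ∈ J ty n, Prec n i k' ↔ (Prec n i k ∨ i = k)) :
    invPartial ty n q qh k' = invPartial ty n q qh k + cc ty n q qh k • tb ty n (-k) k := by
  have : (J ty n).filter (fun i => Prec n i k') =
      insert k ((J ty n).filter fun i => Prec n i k) := by
    ext i
    by_cases hik : i = k
    · subst hik
      simp [hk, h i hk]
    · simp only [Finset.mem_filter, Finset.mem_insert, hik, false_or]
      exact and_congr_right fun hi => by simp [h i hi, hik]
  rw [invPartial, this, Finset.sum_insert, add_comm, invPartial]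
  intro hmem
  exact lt_irrefl _ (Finset.mem_filter.1 hmem).2

/-- R contains the indices on which e_p or t_p acts nontrivially. Two indices joined by e_p compare
in the same way with every index outside R, so with exactly one tensor factor in R the operator T
treats them alike. With both factors outside R the two sides vanish, given that e_p kills the
truncations there. Only the finite check on R × R remains. -/
theorem braid_comp_deltaE_of_block (hq : q ≠ 0) {p : ℤ} (R : Finset ℤ)
    (hneg : ∀ k ∈ R, -k ∈ R)
    (hE : ∀ k ∈ R, ∃ c : K, ∃ m ∈ R, piE ty n qh p (vb ty n k) = c • vb ty n m ∧
      ∀ i ∈ J ty n, i ∉ R → (Prec n i k ↔ Prec n i m) ∧ (Prec n k i ↔ Prec n m i))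
    (h0 : ∀ k ∈ J ty n, k ∉ R → piE ty n qh p (vb ty n k : V K ty n) = 0 ∧ tExp ty n p k = 0)
    (hX : ∀ k ∈ J ty n, k ∉ R → deltaE ty n q qh p (invPartial ty n q qh k) = 0)
    (hR : ∀ k ∈ R, ∀ l ∈ R, braid ty n q qh (deltaE ty n q qh p (tb ty n k l)) =
      deltaE ty n q qh p (braid ty n q qh (tb ty n k l))) :
    braid ty n q qh ∘ₗ deltaE ty n q qh p = deltaE ty n q qh p ∘ₗ braid ty n q qh := by
  have hneg' : ∀ k, k ∉ R → -k ∉ R := fun k hk h => hk (by simpa using hneg _ h)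
  have d00 : ∀ k ∈ J ty n, k ∉ R → ∀ l ∈ J ty n, l ∉ R →
      deltaE ty n q qh p (tb ty n k l) = 0 := by
    intro k hk hkR l hl hlR
    simp [deltaE_tb, (h0 k hk hkR).1, (h0 l hl hlR).1]
  refine VV_hom_ext fun k hk l hl => ?_
  simp only [LinearMap.comp_apply]
  by_cases hkR : k ∈ R <;> by_cases hlR : l ∈ R
  · exact hR k hkR l hlR
  · obtain ⟨c, m, hm, hc, hP⟩ := hE k hkR
    obtain ⟨hl0, hlt⟩ := h0 l hl hlR
    have hlk : ∀ k ∈ R, l ≠ -k ∧ k ≠ l :=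
      fun k hk => ⟨fun h => hlR (h ▸ hneg k hk), fun h => hlR (h ▸ hk)⟩
    have e1 : deltaE ty n q qh p (tb ty n k l) = c • tb ty n m l := by
      rw [deltaE_tb, hl0, hlt, hc]
      simp [tb, TensorProduct.smul_tmul']
    have e2 : deltaE ty n q qh p (tb ty n l k) = c • tb ty n l m := by
      rw [deltaE_tb, hl0, hc, TensorProduct.tmul_smul, tb]
      simp
    have e3 : Prec n l k ↔ Prec n l m := (hP l hl hlR).1
    rw [e1, map_smul, braid_off (hlk m hm).1 (hlk m hm).2, braid_off (hlk k hkR).1 (hlk k hkR).2,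
      map_add, map_smul, e2]
    by_cases h : Prec n l m
    · rw [if_pos h, if_pos (e3.2 h), map_smul, e1]
      module
    · rw [if_neg h, if_neg (e3.not.2 h), map_zero]
      module
  · obtain ⟨c, m, hm, hc, hP⟩ := hE l hlR
    obtain ⟨hk0, hkt⟩ := h0 k hk hkR
    have hlk : ∀ l ∈ R, l ≠ -k ∧ k ≠ l :=
      fun l hl => ⟨fun h => hneg' k hkR (h ▸ hl), fun h => hkR (h ▸ hl)⟩
    have e1 : deltaE ty n q qh p (tb ty n k l) = c • tb ty n k m := by
      rw [deltaE_tb, hk0, hc, TensorProduct.tmul_smul, tb]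
      simp
    have e2 : deltaE ty n q qh p (tb ty n l k) = c • tb ty n m k := by
      rw [deltaE_tb, hk0, hkt, hc]
      simp [tb, TensorProduct.smul_tmul']
    have e3 : Prec n l k ↔ Prec n m k := (hP k hk hkR).2
    rw [e1, map_smul, braid_off (hlk m hm).1 (hlk m hm).2, braid_off (hlk l hlR).1 (hlk l hlR).2,
      map_add, map_smul, e2]
    by_cases h : Prec n m k
    · rw [if_pos h, if_pos (e3.2 h), map_smul, e1]
      module
    · rw [if_neg h, if_neg (e3.not.2 h), map_zero]
      module
  · rw [d00 k hk hkR l hl hlR, map_zero]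
    by_cases hlk : l = -k
    · have d1 : deltaE ty n q qh p (tb ty n l k) = 0 := d00 l hl hlR k hk hkR
      rw [braid_anti hq hk hlk, map_sub, map_add, map_smul, map_smul, d1, hX k hk hkR]
      split_ifs <;> simp [d00 k hk hkR l hl hlR]
    · by_cases hkl : k = l
      · subst hkl
        rw [braid_diag (by omega), d00 k hk hkR k hk hkR]
      · rw [braid_off hlk hkl, map_add, map_smul, d00 l hl hlR k hk hkR]
        split_ifs <;> simp [d00 k hk hkR l hl hlR]

theorem braid_comp_deltaE_of_lt (hq : q ≠ 0) (htwo : ty = .A2even → two qh ≠ 0) {p : ℤ}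
    (h1 : 1 ≤ p) (h2 : p < n) :
    braid ty n q qh ∘ₗ deltaE ty n q qh p = deltaE ty n q qh p ∘ₗ braid ty n q qh := by
  have c1 : cc ty n q qh (p + 1) = -q⁻¹ * cc ty n q qh p := cc_succ hq (by omega)
  have c2 : cc ty n q qh (-p) = -q⁻¹ * cc ty n q qh (-p - 1) := by
    have := cc_succ (ty := ty) (n := n) (qh := qh) hq (i := -p - 1) (by omega)
    simpa using this
  have m1 : p ∈ J ty n := mem_J_of_ne (by omega) (by omega) (by omega)
  have m2 : p + 1 ∈ J ty n := mem_J_of_ne (by omega) (by omega) (by omega)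
  have m3 : -p - 1 ∈ J ty n := mem_J_of_ne (by omega) (by omega) (by omega)
  have m4 : -p ∈ J ty n := mem_J_of_ne (by omega) (by omega) (by omega)
  have z1 := cc_ne_zero hq htwo m1
  have z3 := cc_ne_zero hq htwo m3
  have e2 : -(-p - 1) = p + 1 := by ring
  have o12 : Prec n p (p + 1) := by unfold Prec pos; grind
  have o13 : Prec n p (-p - 1) := by unfold Prec pos; grind
  have o14 : Prec n p (-p) := by unfold Prec pos; grind
  have o23 : Prec n (p + 1) (-p - 1) := by unfold Prec pos; grind
  have o24 : Prec n (p + 1) (-p) := by unfold Prec pos; grind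
  have o34 : Prec n (-p - 1) (-p) := by unfold Prec pos; grind
  have orr : ∀ k, ¬ Prec n k k := fun k => lt_irrefl _
  have oas : ∀ {k l}, Prec n k l → ¬ Prec n l k := fun h => lt_asymm h
  have p1 : ∀ i ∈ J ty n, Prec n i (p + 1) ↔ (Prec n i p ∨ i = p) := fun i hi => by
    rw [mem_J] at hi
    unfold Prec pos
    grind
  have p2 : ∀ i ∈ J ty n, Prec n i (-p) ↔ (Prec n i (-p - 1) ∨ i = -p - 1) := fun i hi => by
    rw [mem_J] at hi
    unfold Prec pos
    grind
  have p3 : ∀ i ∈ J ty n, i ∉ ({p, p + 1, -p - 1, -p} : Finset ℤ) →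
      ((Prec n i (p + 1) ↔ Prec n i p) ∧ (Prec n (p + 1) i ↔ Prec n p i)) ∧
      ((Prec n i (-p) ↔ Prec n i (-p - 1)) ∧ (Prec n (-p) i ↔ Prec n (-p - 1) i)) := by
    intro i hi hiR
    simp only [Finset.mem_insert, Finset.mem_singleton, mem_J] at hi hiR
    unfold Prec pos
    grind
  have i1 : invPartial ty n q qh (p + 1) =
      invPartial ty n q qh p + cc ty n q qh p • tb ty n (-p) p := invPartial_eq_add m1 p1
  have i2 : invPartial ty n q qh (-p) =
      invPartial ty n q qh (-p - 1) + cc ty n q qh (-p - 1) • tb ty n (p + 1) (-p - 1) := by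
    have := invPartial_eq_add (q := q) (qh := qh) m3 p2
    rwa [e2] at this
  refine braid_comp_deltaE_of_block hq {p, p + 1, -p - 1, -p} ?_ ?_ ?_ ?_ ?_
  · intro k hk
    simp only [Finset.mem_insert, Finset.mem_singleton] at hk ⊢
    omega
  · intro k hk
    have hkJ : k ∈ J ty n := by
      simp only [Finset.mem_insert, Finset.mem_singleton] at hk
      rcases hk with rfl | rfl | rfl | rfl <;> assumption
    simp only [Finset.mem_insert, Finset.mem_singleton, piE, h2, if_true, LinearMap.add_apply,
      E_vb hkJ] at hk ⊢
    rcases hk with rfl | rfl | rfl | rfl <;> simp (disch := omega) only [if_neg, if_true]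
    · exact ⟨0, k, by simp, by simp, by simp⟩
    · exact ⟨1, p, by simp, by simp, fun i hi hiR => by simpa using (p3 i hi (by simpa using hiR)).1⟩
    · exact ⟨0, -p - 1, by simp, by simp, by simp⟩
    · exact ⟨1, -p - 1, by simp, by simp, fun i hi hiR => by
        simpa using (p3 i hi (by simpa using hiR)).2⟩
  · intro k hk hkR
    simp only [Finset.mem_insert, Finset.mem_singleton] at hkR
    refine ⟨?_, tExp_of_lt_zero h2 (by omega)⟩
    simp only [piE, h2, if_true, LinearMap.add_apply, E_vb hk]
    rw [if_neg (by omega), if_neg (by omega), add_zero]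
  · intro k hk hkR
    obtain ⟨⟨-, h⟩, -, h'⟩ := p3 k hk hkR
    rw [deltaE_invPartial_of_lt hq h1 h2]
    simp [h, h']
  · intro k hk l hl
    simp only [Finset.mem_insert, Finset.mem_singleton] at hk hl
    -- The sixteen products of the block. After all `cc` and `invPartial` are reduced to those at p
    -- and -p - 1, each is an identity of rational functions in q.
    rcases hk with rfl | rfl | rfl | rfl <;> rcases hl with rfl | rfl | rfl | rfl
    all_goals
      simp (disch := first | assumption | omega) only [braid_diag, braid_off, braid_anti hq,
        deltaE_tb_of_lt h1 h2, deltaE_invPartial_of_lt hq h1 h2, tExp_of_lt_pos h1 h2,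
        tExp_of_lt_neg h1 h2, if_neg, map_add, map_sub, map_smul,
        map_zero, o12, o13, o14, o23, o24, o34, orr, oas o12, oas o13, oas o14, oas o23, oas o24,
        oas o34, if_true, if_false, neg_neg, c1, c2, zpow_neg, zpow_one,
        add_zero, zero_add, smul_zero, i1, i2]
    all_goals (match_scalars <;> field_simp <;> ring)

end

end QWedge

/-! ### The last generator e_n, separately for types C, B and D. -/

namespace QWedge

noncomputable section

variable {K : Type*} [Field K] {ty : AffType} {n : ℕ} {q qh z : K}

theorem deltaE_invPartial_eq_zero {p : ℤ} (R : Finset ℤ) (hR : R ⊆ J ty n)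
    (hD : ∀ i ∈ J ty n, i ∉ R → deltaE ty n q qh p (tb ty n (-i) i) = 0) {k : ℤ}
    (hk : ∀ i ∈ R, ¬ Prec n i k) : deltaE ty n q qh p (invPartial ty n q qh k) = 0 := by
  rw [map_invPartial_eq _ R hR hD]
  exact Finset.sum_eq_zero fun i hi => if_neg (hk i hi)

/-- A truncation that sees either all of the block or none of it has the image of the full invariant
vector or of zero, and e_p kills both. -/
theorem deltaE_invPartial_of_contiguous {p : ℤ} (R : Finset ℤ) (hR : R ⊆ J ty n)
    (hD : ∀ i ∈ J ty n, i ∉ R → deltaE ty n q qh p (tb ty n (-i) i) = 0)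
    (hv : deltaE ty n q qh p (invVec ty n q qh) = 0) {k : ℤ}
    (hk : ∀ i ∈ R, ∀ j ∈ R, Prec n i k → Prec n j k) :
    deltaE ty n q qh p (invPartial ty n q qh k) = 0 := by
  by_cases hex : ∃ i ∈ R, Prec n i k
  · obtain ⟨i, hi, hik⟩ := hex
    rw [← hv, map_invVec_eq _ R hR hD, map_invPartial_eq _ R hR hD]
    exact Finset.sum_congr rfl fun j hj => if_pos (hk i hi j hj hik)
  · push Not at hex
    exact deltaE_invPartial_eq_zero R hR hD hex

section TypeC

theorem deltaE_last_tb_typeC (hty : ty = .A2odd ∨ ty = .C1) (hn : 1 ≤ n) {k l : ℤ} :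
    deltaE ty n q qh n (tb ty n k l) =
      (if k = -n then q ^ (-tExp ty n n l) • tb ty n n l else 0) +
        if l = -n then tb ty n k n else 0 := by
  have key : ∀ k, piE ty n qh n (vb ty n k : V K ty n) = if k = -n then vb ty n n else 0 := by
    intro k
    by_cases hk : k ∈ J ty n
    · rcases hty with rfl | rfl <;> simp [piE, E_vb hk]
    · have := mem_J.not.1 hk
      rw [vb_eq_zero hk, if_neg (by omega), map_zero]
  rw [deltaE_tb, key, key]
  simp only [tb, TensorProduct.ite_tmul, TensorProduct.tmul_ite, smul_ite, smul_zero]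

theorem tExp_last_typeC (hty : ty = .A2odd ∨ ty = .C1) {k : ℤ} :
    tExp ty n n k = 2 * dlt k n - 2 * dlt k (-n) := by
  rcases hty with rfl | rfl <;> simp [tExp]

/-- For N = 2n + 2 the value of `bar` jumps by 2 between n and -n, giving (-q)⁻², and ε changes
sign. This matches t_n acting on v_n by q². -/
theorem cc_neg_last_typeC (hty : ty = .A2odd ∨ ty = .C1) (hq : q ≠ 0) (hn : 1 ≤ n) :
    cc ty n q qh (-n) = -(q⁻¹ * q⁻¹) * cc ty n q qh n := by
  have e1 : eps ty qh n = 1 := by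
    rcases hty with rfl | rfl <;> simp only [eps] <;> rw [if_pos (by omega)]
  have e2 : eps ty qh (-n) = -1 := by
    rcases hty with rfl | rfl <;> simp only [eps] <;> rw [if_neg (by omega), if_neg (by omega)]
  have e3 : -bar ty n (-n) = -bar ty n n + (-1) + (-1) := by
    rcases hty with rfl | rfl <;> simp only [bar, bigN] <;> split_ifs <;> omega
  have hq' := neg_ne_zero.2 hq
  rw [cc, cc, e1, e2, e3, zpow_add₀ hq', zpow_add₀ hq', zpow_neg_one, inv_neg, inv_neg]
  ring

theorem deltaE_last_commute_typeC (hty : ty = .A2odd ∨ ty = .C1) (hq : q ≠ 0) (hn : 1 ≤ n) :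
    deltaE ty n q qh n (invVec ty n q qh) = 0 ∧
    invForm ty n q qh ∘ₗ deltaE ty n q qh n = 0 ∧
    braid ty n q qh ∘ₗ deltaE ty n q qh n = deltaE ty n q qh n ∘ₗ braid ty n q qh := by
  have m1 : (n : ℤ) ∈ J ty n := mem_J_of_ne (by omega) (by omega) (by omega)
  have m2 : -(n : ℤ) ∈ J ty n := mem_J_of_ne (by omega) (by omega) (by omega)
  have hne : ty ≠ .A2even := by rcases hty with rfl | rfl <;> decide
  have z1 := cc_ne_zero (q := q) (qh := qh) hq (fun h => absurd h hne) m1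
  have c2 := cc_neg_last_typeC (qh := qh) hty hq hn
  have hJ0 : ∀ i ∈ J ty n, i ≠ 0 := fun i hi => ((mem_J.1 hi).2.resolve_left hne)
  have o12 : Prec n n (-n) := by unfold Prec pos; grind
  have orr : ∀ k, ¬ Prec n k k := fun k => lt_irrefl _
  have o21 : ¬ Prec n (-n) n := lt_asymm o12
  have p2 : ∀ i ∈ J ty n, Prec n i (-n) ↔ (Prec n i n ∨ i = n) := fun i hi => by
    have := hJ0 i hi
    rw [mem_J] at hi
    unfold Prec pos
    grind
  have p3 : ∀ i ∈ J ty n, i ∉ ({(n : ℤ), -(n : ℤ)} : Finset ℤ) →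
      (Prec n i (-n) ↔ Prec n i n) ∧ (Prec n (-n) i ↔ Prec n n i) := by
    intro i hi hiR
    have := hJ0 i hi
    simp only [Finset.mem_insert, Finset.mem_singleton, mem_J] at hi hiR
    unfold Prec pos
    grind
  have t1 : tExp ty n n n = 2 := by rw [tExp_last_typeC hty, dlt, dlt]; grind
  have t2 : tExp ty n n (-n) = -2 := by rw [tExp_last_typeC hty, dlt, dlt]; grind
  have i2 : invPartial ty n q qh (-n) = invPartial ty n q qh n + cc ty n q qh n • tb ty n (-n) n :=
    invPartial_eq_add m1 p2
  have hR : ({(n : ℤ), -(n : ℤ)} : Finset ℤ) ⊆ J ty n := by simp [Finset.insert_subset_iff, m1, m2]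
  have hD : ∀ i ∈ J ty n, i ∉ ({(n : ℤ), -(n : ℤ)} : Finset ℤ) →
      deltaE ty n q qh n (tb ty n (-i) i) = 0 := by
    intro i _ hi
    simp only [Finset.mem_insert, Finset.mem_singleton] at hi
    simp (disch := omega) only [deltaE_last_tb_typeC hty hn, if_neg, add_zero]
  have hX : deltaE ty n q qh n (invPartial ty n q qh n) = 0 :=
    deltaE_invPartial_eq_zero _ hR hD (by simp [orr, o21])
  have hv : deltaE ty n q qh n (invVec ty n q qh) = 0 := by
    rw [map_invVec_eq _ _ hR hD, Finset.sum_insert (by simp; omega), Finset.sum_singleton]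
    simp (disch := omega) only [deltaE_last_tb_typeC hty hn, if_neg, if_true, t1, c2, neg_neg,
      add_zero, zero_add]
    match_scalars
    field_simp
    ring
  have hF : invForm ty n q qh ∘ₗ deltaE ty n q qh n = 0 := by
    refine VV_hom_ext fun k hk l hl => ?_
    have hc : ∀ k : ℤ, k = -n ∨ k ≠ -n := fun k => eq_or_ne _ _
    simp only [LinearMap.comp_apply, deltaE_last_tb_typeC hty hn, LinearMap.zero_apply]
    rcases hc k with rfl | hk' <;> rcases hc l with rfl | hl'
    all_goals
      simp (disch := first | assumption | omega) only [if_neg, if_true, map_add, map_zero,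
        map_smul, invForm_tb, add_zero, zero_add, smul_zero, if_pos, t2, c2]
    all_goals (simp only [neg_neg, zpow_ofNat, smul_eq_mul]; field_simp; ring)
  refine ⟨hv, hF, braid_comp_deltaE_of_block hq {(n : ℤ), -(n : ℤ)} ?_ ?_ ?_ ?_ ?_⟩
  · intro k hk
    simp only [Finset.mem_insert, Finset.mem_singleton] at hk ⊢
    omega
  · have hE : ∀ k ∈ J ty n, piE ty n qh n (vb ty n k : V K ty n) =
        if k = -n then vb ty n n else 0 := by
      intro k hk
      rcases hty with rfl | rfl <;> simp [piE, E_vb hk]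
    intro k hk
    rw [hE k (hR hk)]
    simp only [Finset.mem_insert, Finset.mem_singleton] at hk
    rcases hk with rfl | rfl
    · exact ⟨0, n, by simp, by rw [if_neg (by omega), zero_smul], by simp⟩
    · exact ⟨1, n, by simp, by simp, fun i hi hiR => p3 i hi hiR⟩
  · intro k hk hkR
    simp only [Finset.mem_insert, Finset.mem_singleton] at hkR
    refine ⟨?_, ?_⟩
    · rcases hty with rfl | rfl <;> simp [piE, E_vb hk] <;> omega
    · rw [tExp_last_typeC hty, dlt, dlt, if_neg (by omega), if_neg (by omega)]; rfl
  · intro k hk hkR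
    refine deltaE_invPartial_of_contiguous _ hR hD hv ?_
    have := (p3 k hk hkR).2
    simp [this]
  · intro k hk l hl
    simp only [Finset.mem_insert, Finset.mem_singleton] at hk hl
    rcases hk with rfl | rfl <;> rcases hl with rfl | rfl
    all_goals
      simp (disch := first | assumption | omega) only [braid_diag, braid_anti hq,
        deltaE_last_tb_typeC hty hn, t1, t2, if_neg, map_add, map_sub, map_smul,
        map_zero, o12, o21, if_true, if_false, neg_neg, c2,
        add_zero, zero_add, smul_zero, i2, hX]
    all_goals (match_scalars <;> field_simp <;> ring)

end TypeC

section TypeB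

theorem deltaE_last_tb_typeB (hn : 1 ≤ n) {k l : ℤ} :
    deltaE .A2even n q qh n (tb .A2even n k l) =
      ((if k = 0 then (q ^ (-tExp .A2even n n l) * two qh) • tb .A2even n n l else 0) +
        if k = -n then q ^ (-tExp .A2even n n l) • tb .A2even n 0 l else 0) +
      ((if l = 0 then two qh • tb .A2even n k n else 0) +
        if l = -n then tb .A2even n k 0 else 0) := by
  have key : ∀ k, piE .A2even n qh n (vb .A2even n k : V K .A2even n) =
      (if k = 0 then two qh • vb .A2even n n else 0) + if k = -n then vb .A2even n 0 else 0 := by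
    intro k
    by_cases hk : k ∈ J .A2even n
    · simp [piE, E_vb hk]
    · have : ¬(-(n : ℤ) ≤ k ∧ k ≤ n) := fun h => hk (mem_J.2 ⟨h, Or.inl rfl⟩)
      rw [vb_eq_zero hk, if_neg (by omega), if_neg (by omega), map_zero, add_zero]
  rw [deltaE_tb, key, key]
  simp only [tb, TensorProduct.ite_tmul, TensorProduct.tmul_ite, smul_ite, smul_zero,
    TensorProduct.add_tmul, TensorProduct.tmul_add, smul_add, TensorProduct.tmul_smul,
    ← TensorProduct.smul_tmul', smul_smul]

theorem deltaE_last_commute_typeB (hq : q ≠ 0) (htwo : two qh ≠ 0) (hn : 1 ≤ n) :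
    deltaE .A2even n q qh n (invVec .A2even n q qh) = 0 ∧
    invForm .A2even n q qh ∘ₗ deltaE .A2even n q qh n = 0 ∧
    braid .A2even n q qh ∘ₗ deltaE .A2even n q qh n =
      deltaE .A2even n q qh n ∘ₗ braid .A2even n q qh := by
  have m1 : (n : ℤ) ∈ J .A2even n := mem_J_of_ne (by omega) (by omega) (by omega)
  have m2 : -(n : ℤ) ∈ J .A2even n := mem_J_of_ne (by omega) (by omega) (by omega)
  have m0 : (0 : ℤ) ∈ J .A2even n := mem_J.2 ⟨by omega, Or.inl rfl⟩
  have z1 := cc_ne_zero (q := q) (qh := qh) hq (fun _ => htwo) m1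
  have hq' := neg_ne_zero.2 hq
  -- Here n, 0, -n form one block. `bar` takes the same value at 0 and -n, so the coefficients there
  -- differ only through ε.
  have c1 : cc .A2even n q qh 0 = -((two qh)⁻¹ * q⁻¹) * cc .A2even n q qh n := by
    have e1 : eps .A2even qh n = 1 := by simp only [eps]; rw [if_pos (by omega)]
    have e2 : eps .A2even qh 0 = two qh := by simp [eps]
    have e3 : -bar .A2even n 0 = -bar .A2even n n + (-1) := by
      simp only [bar]; split_ifs <;> omega
    rw [cc, cc, e1, e2, e3, zpow_add₀ hq', zpow_neg_one, inv_neg]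
    ring
  have c2 : cc .A2even n q qh (-n) = q⁻¹ * cc .A2even n q qh n := by
    have e1 : eps .A2even qh n = 1 := by simp only [eps]; rw [if_pos (by omega)]
    have e2 : eps .A2even qh (-n) = -1 := by
      simp only [eps]; rw [if_neg (by omega), if_neg (by omega)]
    have e3 : -bar .A2even n (-n) = -bar .A2even n n + (-1) := by
      simp only [bar, bigN]; split_ifs <;> omega
    rw [cc, cc, e1, e2, e3, zpow_add₀ hq', zpow_neg_one, inv_neg]
    ring
  have o12 : Prec n n 0 := by unfold Prec pos; grind
  have o13 : Prec n n (-n) := by unfold Prec pos; grind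
  have o23 : Prec n 0 (-n) := by unfold Prec pos; grind
  have orr : ∀ k, ¬ Prec n k k := fun k => lt_irrefl _
  have o21 : ¬ Prec n 0 n := lt_asymm o12
  have o31 : ¬ Prec n (-n) n := lt_asymm o13
  have o32 : ¬ Prec n (-n) 0 := lt_asymm o23
  have p1 : ∀ i ∈ J .A2even n, Prec n i 0 ↔ (Prec n i n ∨ i = n) := fun i hi => by
    rw [mem_J] at hi
    unfold Prec pos
    grind
  have p2 : ∀ i ∈ J .A2even n, Prec n i (-n) ↔ (Prec n i 0 ∨ i = 0) := fun i hi => by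
    rw [mem_J] at hi
    unfold Prec pos
    grind
  have p3 : ∀ i ∈ J .A2even n, i ∉ ({(n : ℤ), 0, -(n : ℤ)} : Finset ℤ) →
      ((Prec n i 0 ↔ Prec n i n) ∧ (Prec n 0 i ↔ Prec n n i)) ∧
      ((Prec n i (-n) ↔ Prec n i 0) ∧ (Prec n (-n) i ↔ Prec n 0 i)) := by
    intro i hi hiR
    simp only [Finset.mem_insert, Finset.mem_singleton, mem_J] at hi hiR
    unfold Prec pos
    grind
  have ht : ∀ k, tExp .A2even n n k = dlt k n - dlt k (-n) := fun k => by simp [tExp]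
  have t1 : tExp .A2even n n n = 1 := by rw [ht, dlt, dlt]; grind
  have t0 : tExp .A2even n n 0 = 0 := by rw [ht, dlt, dlt]; grind
  have t2 : tExp .A2even n n (-n) = -1 := by rw [ht, dlt, dlt]; grind
  have i1 : invPartial .A2even n q qh 0 =
      invPartial .A2even n q qh n + cc .A2even n q qh n • tb .A2even n (-n) n :=
    invPartial_eq_add m1 p1
  have i2 : invPartial .A2even n q qh (-n) =
      invPartial .A2even n q qh 0 + cc .A2even n q qh 0 • tb .A2even n 0 0 := by
    have := invPartial_eq_add (q := q) (qh := qh) m0 p2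
    rwa [neg_zero] at this
  have hR : ({(n : ℤ), 0, -(n : ℤ)} : Finset ℤ) ⊆ J .A2even n := by
    simp [Finset.insert_subset_iff, m0, m1, m2]
  have hD : ∀ i ∈ J .A2even n, i ∉ ({(n : ℤ), 0, -(n : ℤ)} : Finset ℤ) →
      deltaE .A2even n q qh n (tb .A2even n (-i) i) = 0 := by
    intro i _ hi
    simp only [Finset.mem_insert, Finset.mem_singleton] at hi
    simp (disch := omega) only [deltaE_last_tb_typeB hn, if_neg, add_zero]
  have hX : deltaE .A2even n q qh n (invPartial .A2even n q qh n) = 0 :=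
    deltaE_invPartial_eq_zero _ hR hD (by simp [orr, o21, o31])
  have hv : deltaE .A2even n q qh n (invVec .A2even n q qh) = 0 := by
    rw [map_invVec_eq _ _ hR hD, Finset.sum_insert (by simp; omega),
      Finset.sum_insert (by simp; omega), Finset.sum_singleton]
    simp (disch := omega) only [deltaE_last_tb_typeB hn, if_neg, if_true, t0, t1, c1, c2, neg_neg,
      add_zero, zero_add, neg_zero]
    match_scalars <;> field_simp <;> ring
  have hF : invForm .A2even n q qh ∘ₗ deltaE .A2even n q qh n = 0 := by
    refine VV_hom_ext fun k hk l hl => ?_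
    have hc : ∀ k : ℤ, k = 0 ∨ k = -n ∨ (k ≠ 0 ∧ k ≠ -n) := by intro k; omega
    simp only [LinearMap.comp_apply, deltaE_last_tb_typeB hn, LinearMap.zero_apply]
    rcases hc k with rfl | rfl | hk' <;> rcases hc l with rfl | rfl | hl'
    all_goals
      simp (disch := first | assumption | omega) only [if_neg, if_true, map_add, map_zero,
        map_smul, invForm_tb, add_zero, zero_add, smul_zero, if_pos, t0, t2, c1, c2]
    all_goals (simp only [neg_neg, neg_zero, zpow_ofNat, smul_eq_mul]; field_simp; ring)
  refine ⟨hv, hF, braid_comp_deltaE_of_block hq {(n : ℤ), 0, -(n : ℤ)} ?_ ?_ ?_ ?_ ?_⟩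
  · intro k hk
    simp only [Finset.mem_insert, Finset.mem_singleton] at hk ⊢
    omega
  · intro k hk
    have hkJ := hR hk
    simp only [piE, lt_irrefl, if_false, LinearMap.add_apply, LinearMap.smul_apply, E_vb hkJ]
    simp only [Finset.mem_insert, Finset.mem_singleton] at hk
    rcases hk with rfl | rfl | rfl
    · exact ⟨0, n, by simp, by rw [if_neg (by omega), if_neg (by omega)]; simp, by simp⟩
    · exact ⟨two qh, n, by simp, by simp; omega, fun i hi hiR => (p3 i hi hiR).1⟩
    · exact ⟨1, 0, by simp, by simp; omega, fun i hi hiR => (p3 i hi hiR).2⟩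
  · intro k hk hkR
    simp only [Finset.mem_insert, Finset.mem_singleton] at hkR
    refine ⟨?_, ?_⟩
    · simp only [piE, lt_irrefl, if_false, LinearMap.add_apply, LinearMap.smul_apply, E_vb hk]
      rw [if_neg (by omega), if_neg (by omega), smul_zero, add_zero]
    · rw [ht, dlt, dlt, if_neg (by omega), if_neg (by omega)]; rfl
  · intro k hk hkR
    refine deltaE_invPartial_of_contiguous _ hR hD hv ?_
    have := p3 k hk hkR
    simp [this.1.2, this.2.2]
  · intro k hk l hl
    simp only [Finset.mem_insert, Finset.mem_singleton] at hk hl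
    rcases hk with rfl | rfl | rfl <;> rcases hl with rfl | rfl | rfl
    all_goals
      simp (disch := first | assumption | omega) only [braid_diag, braid_off, braid_anti hq,
        deltaE_last_tb_typeB hn, t0, t1, t2, if_neg, map_add, map_sub, map_smul,
        map_zero, o12, o13, o23, o21, o31, o32, orr, if_true, if_false, neg_neg, c1, c2,
        add_zero, zero_add, smul_zero, i1, i2, hX, neg_zero]
    all_goals (match_scalars <;> field_simp <;> ring)

end TypeB

section TypeD

theorem deltaE_last_tb_typeD (hn : 2 ≤ n) {k l : ℤ} :
    deltaE .A2oddDagger n q qh n (tb .A2oddDagger n k l) =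
      ((if k = -n then
          q ^ (-tExp .A2oddDagger n n l) • tb .A2oddDagger n (n - 1) l else 0) +
        if k = -n + 1 then q ^ (-tExp .A2oddDagger n n l) • tb .A2oddDagger n n l else 0) +
      ((if l = -n then tb .A2oddDagger n k (n - 1) else 0) +
        if l = -n + 1 then tb .A2oddDagger n k n else 0) := by
  have key : ∀ k, piE .A2oddDagger n qh n (vb .A2oddDagger n k : V K .A2oddDagger n) =
      (if k = -n then vb .A2oddDagger n (n - 1) else 0) +
        if k = -n + 1 then vb .A2oddDagger n n else 0 := by
    intro k
    by_cases hk : k ∈ J .A2oddDagger n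
    · simp [piE, E_vb hk]
    · have := mem_J.not.1 hk
      rw [vb_eq_zero hk, if_neg (by omega), if_neg (by omega), map_zero, add_zero]
  rw [deltaE_tb, key, key]
  simp only [tb, TensorProduct.ite_tmul, TensorProduct.tmul_ite, smul_ite, smul_zero,
    TensorProduct.add_tmul, TensorProduct.tmul_add, smul_add]

theorem deltaE_last_commute_typeD (hq : q ≠ 0) (hn : 2 ≤ n) :
    deltaE .A2oddDagger n q qh n (invVec .A2oddDagger n q qh) = 0 ∧
    invForm .A2oddDagger n q qh ∘ₗ deltaE .A2oddDagger n q qh n = 0 ∧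
    braid .A2oddDagger n q qh ∘ₗ deltaE .A2oddDagger n q qh n =
      deltaE .A2oddDagger n q qh n ∘ₗ braid .A2oddDagger n q qh := by
  have m1 : (n : ℤ) - 1 ∈ J .A2oddDagger n := mem_J_of_ne (by omega) (by omega) (by omega)
  have m2 : (n : ℤ) ∈ J .A2oddDagger n := mem_J_of_ne (by omega) (by omega) (by omega)
  have m3 : -(n : ℤ) ∈ J .A2oddDagger n := mem_J_of_ne (by omega) (by omega) (by omega)
  have m4 : -(n : ℤ) + 1 ∈ J .A2oddDagger n := mem_J_of_ne (by omega) (by omega) (by omega)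
  have z1 := cc_ne_zero (q := q) (qh := qh) hq (fun h => by simp at h) m1
  have hq' := neg_ne_zero.2 hq
  have e1 : -((n : ℤ) - 1) = -n + 1 := by ring
  have e2 : -(-(n : ℤ) + 1) = n - 1 := by ring
  have c2 : cc .A2oddDagger n q qh n = -q⁻¹ * cc .A2oddDagger n q qh (n - 1) := by
    have := cc_succ (ty := .A2oddDagger) (n := n) (qh := qh) hq (i := n - 1) (by omega)
    simpa using this
  -- With N = 2n the indices n and -n have equal `bar`, reflecting the symmetry of the two end nodes
  -- of D_n.
  have c3 : cc .A2oddDagger n q qh (-n) = -q⁻¹ * cc .A2oddDagger n q qh (n - 1) := by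
    have e : -bar .A2oddDagger n (-n) = -bar .A2oddDagger n n := by
      simp only [bar, bigN]; split_ifs <;> omega
    rw [← c2, cc, cc, e]
    rfl
  have c4 : cc .A2oddDagger n q qh (-n + 1) =
      (q⁻¹ * q⁻¹) * cc .A2oddDagger n q qh (n - 1) := by
    rw [cc_succ hq (by omega), c3]
    ring
  have o12 : Prec n (n - 1) n := by unfold Prec pos; grind
  have o13 : Prec n (n - 1) (-n) := by unfold Prec pos; grind
  have o14 : Prec n (n - 1) (-n + 1) := by unfold Prec pos; grind
  have o23 : Prec n n (-n) := by unfold Prec pos; grind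
  have o24 : Prec n n (-n + 1) := by unfold Prec pos; grind
  have o34 : Prec n (-n) (-n + 1) := by unfold Prec pos; grind
  have orr : ∀ k, ¬ Prec n k k := fun k => lt_irrefl _
  have oas : ∀ {k l}, Prec n k l → ¬ Prec n l k := fun h => lt_asymm h
  have p1 : ∀ i ∈ J .A2oddDagger n, Prec n i n ↔ (Prec n i (n - 1) ∨ i = n - 1) := fun i hi => by
    rw [mem_J] at hi
    unfold Prec pos
    grind
  have p2 : ∀ i ∈ J .A2oddDagger n, Prec n i (-n) ↔ (Prec n i n ∨ i = n) := fun i hi => by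
    rw [mem_J] at hi
    unfold Prec pos
    grind
  have p3 : ∀ i ∈ J .A2oddDagger n, Prec n i (-n + 1) ↔ (Prec n i (-n) ∨ i = -n) := fun i hi => by
    rw [mem_J] at hi
    unfold Prec pos
    grind
  have p4 : ∀ i ∈ J .A2oddDagger n,
      i ∉ ({(n : ℤ) - 1, (n : ℤ), -(n : ℤ), -(n : ℤ) + 1} : Finset ℤ) →
      (Prec n i (n - 1) ↔ Prec n i (-n)) ∧ (Prec n (n - 1) i ↔ Prec n (-n) i) ∧
      (Prec n i n ↔ Prec n i (-n)) ∧ (Prec n n i ↔ Prec n (-n) i) ∧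
      (Prec n i (-n + 1) ↔ Prec n i (-n)) ∧ (Prec n (-n + 1) i ↔ Prec n (-n) i) := by
    intro i hi hiR
    simp only [Finset.mem_insert, Finset.mem_singleton, mem_J] at hi hiR
    unfold Prec pos
    grind
  have ht : ∀ k, tExp .A2oddDagger n n k =
      dlt k (n - 1) + dlt k n - dlt k (-n) - dlt k (-n + 1) := fun k => by simp [tExp]
  have t1 : tExp .A2oddDagger n n (n - 1) = 1 := by rw [ht, dlt, dlt, dlt, dlt]; grind
  have t2 : tExp .A2oddDagger n n n = 1 := by rw [ht, dlt, dlt, dlt, dlt]; grind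
  have t3 : tExp .A2oddDagger n n (-n) = -1 := by rw [ht, dlt, dlt, dlt, dlt]; grind
  have t4 : tExp .A2oddDagger n n (-n + 1) = -1 := by rw [ht, dlt, dlt, dlt, dlt]; grind
  have i1 : invPartial .A2oddDagger n q qh n = invPartial .A2oddDagger n q qh (n - 1) +
      cc .A2oddDagger n q qh (n - 1) • tb .A2oddDagger n (-n + 1) (n - 1) := by
    have := invPartial_eq_add (q := q) (qh := qh) m1 p1
    rwa [e1] at this
  have i2 : invPartial .A2oddDagger n q qh (-n) = invPartial .A2oddDagger n q qh n +
      cc .A2oddDagger n q qh n • tb .A2oddDagger n (-n) n :=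
    invPartial_eq_add m2 p2
  have i3 : invPartial .A2oddDagger n q qh (-n + 1) = invPartial .A2oddDagger n q qh (-n) +
      cc .A2oddDagger n q qh (-n) • tb .A2oddDagger n n (-n) := by
    have := invPartial_eq_add (q := q) (qh := qh) m3 p3
    rwa [neg_neg] at this
  have hR : ({(n : ℤ) - 1, (n : ℤ), -(n : ℤ), -(n : ℤ) + 1} : Finset ℤ) ⊆ J .A2oddDagger n := by
    simp [Finset.insert_subset_iff, m1, m2, m3, m4]
  have hD : ∀ i ∈ J .A2oddDagger n,
      i ∉ ({(n : ℤ) - 1, (n : ℤ), -(n : ℤ), -(n : ℤ) + 1} : Finset ℤ) →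
      deltaE .A2oddDagger n q qh n (tb .A2oddDagger n (-i) i) = 0 := by
    intro i _ hi
    simp only [Finset.mem_insert, Finset.mem_singleton] at hi
    simp (disch := omega) only [deltaE_last_tb_typeD hn, if_neg, add_zero]
  have hX : deltaE .A2oddDagger n q qh n (invPartial .A2oddDagger n q qh (n - 1)) = 0 :=
    deltaE_invPartial_eq_zero _ hR hD (by simp [orr, oas o12, oas o13, oas o14])
  have hv : deltaE .A2oddDagger n q qh n (invVec .A2oddDagger n q qh) = 0 := by
    rw [map_invVec_eq _ _ hR hD, Finset.sum_insert (by simp; omega),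
      Finset.sum_insert (by simp; omega), Finset.sum_insert (by simp), Finset.sum_singleton]
    simp (disch := omega) only [deltaE_last_tb_typeD hn, if_neg, if_true, t1, t2, c2, c3, c4,
      neg_neg, add_zero, zero_add, e1, e2]
    match_scalars <;> field_simp <;> ring
  have hF : invForm .A2oddDagger n q qh ∘ₗ deltaE .A2oddDagger n q qh n = 0 := by
    refine VV_hom_ext fun k hk l hl => ?_
    have hc : ∀ k : ℤ, k = -n ∨ k = -n + 1 ∨ (k ≠ -n ∧ k ≠ -n + 1) := by intro k; omega
    simp only [LinearMap.comp_apply, deltaE_last_tb_typeD hn, LinearMap.zero_apply]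
    rcases hc k with rfl | rfl | hk' <;> rcases hc l with rfl | rfl | hl'
    all_goals
      simp (disch := first | assumption | omega) only [if_neg, if_true, map_add, map_zero,
        map_smul, invForm_tb, add_zero, zero_add, smul_zero, if_pos, t3, t4, c2, c3, c4]
    all_goals (simp only [neg_neg, zpow_ofNat, smul_eq_mul]; field_simp; ring)
  refine ⟨hv, hF, braid_comp_deltaE_of_block hq
    {(n : ℤ) - 1, (n : ℤ), -(n : ℤ), -(n : ℤ) + 1} ?_ ?_ ?_ ?_ ?_⟩
  · intro k hk
    simp only [Finset.mem_insert, Finset.mem_singleton] at hk ⊢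
    omega
  · intro k hk
    have hkJ := hR hk
    simp only [piE, lt_irrefl, if_false, LinearMap.add_apply, E_vb hkJ]
    simp only [Finset.mem_insert, Finset.mem_singleton] at hk
    rcases hk with rfl | rfl | rfl | rfl <;> simp (disch := omega) only [if_neg, if_true]
    · exact ⟨0, n - 1, by simp, by simp, by simp⟩
    · exact ⟨0, n, by simp, by simp, by simp⟩
    · refine ⟨1, n - 1, by simp, by simp, fun i hi hiR => ?_⟩
      have := p4 i hi hiR
      simp [this]
    · refine ⟨1, n, by simp, by simp, fun i hi hiR => ?_⟩
      have := p4 i hi hiR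
      simp [this]
  · intro k hk hkR
    simp only [Finset.mem_insert, Finset.mem_singleton] at hkR
    refine ⟨?_, ?_⟩
    · simp only [piE, lt_irrefl, if_false, LinearMap.add_apply, E_vb hk]
      rw [if_neg (by omega), if_neg (by omega), add_zero]
    · rw [ht, dlt, dlt, dlt, dlt, if_neg (by omega), if_neg (by omega), if_neg (by omega),
        if_neg (by omega)]
      rfl
  · intro k hk hkR
    refine deltaE_invPartial_of_contiguous _ hR hD hv ?_
    have := p4 k hk hkR
    simp [this]
  · intro k hk l hl
    simp only [Finset.mem_insert, Finset.mem_singleton] at hk hl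
    rcases hk with rfl | rfl | rfl | rfl <;> rcases hl with rfl | rfl | rfl | rfl
    all_goals
      simp (disch := first | assumption | omega) only [braid_diag, braid_off, braid_anti hq,
        deltaE_last_tb_typeD hn, t1, t2, t3, t4, if_neg, map_add, map_sub, map_smul,
        map_zero, o12, o13, o14, o23, o24, o34, oas o12, oas o13, oas o14, oas o23, oas o24,
        oas o34, if_true, if_false, neg_neg, c2, c3, c4,
        add_zero, zero_add, smul_zero, i1, i2, i3, hX]
    all_goals (match_scalars <;> field_simp <;> ring)

end TypeD

end

end QWedge

/-! ### The symmetry exchanging e and f, the commutant of U_q, and the formula for Ř(z). -/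

namespace QWedge

noncomputable section

variable {K : Type*} [Field K] {ty : AffType} {n : ℕ} {q qh z : K}

theorem deltaE_commute (hn : ty.minRank ≤ n) (hq : q ≠ 0) (htwo : ty = .A2even → two qh ≠ 0)
    {p : ℤ} (h1 : 1 ≤ p) (h2 : p ≤ n) :
    deltaE ty n q qh p (invVec ty n q qh) = 0 ∧
    invForm ty n q qh ∘ₗ deltaE ty n q qh p = 0 ∧
    braid ty n q qh ∘ₗ deltaE ty n q qh p = deltaE ty n q qh p ∘ₗ braid ty n q qh := by
  have hn2 := two_le_of_minRank_le hn
  rcases h2.lt_or_eq with h | rfl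
  · exact ⟨deltaE_invVec_of_lt hq h1 h, invForm_deltaE_of_lt hq htwo h1 h,
      braid_comp_deltaE_of_lt hq htwo h1 h⟩
  · cases ty
    · exact deltaE_last_commute_typeB hq (htwo rfl) (by omega)
    · exact deltaE_last_commute_typeC (Or.inl rfl) hq (by omega)
    · exact deltaE_last_commute_typeD hq hn2
    · exact deltaE_last_commute_typeC (Or.inr rfl) hq (by omega)

/-- The linear map `v_k ↦ v_{-k}`. -/
def negV (ty : AffType) (n : ℕ) : Module.End K (V K ty n) :=
  LinearMap.funLeft K K fun j : J ty n => ⟨-(j : ℤ), neg_mem_J.2 j.2⟩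

theorem negV_vb {k : ℤ} : negV ty n (vb ty n k : V K ty n) = vb ty n (-k) := by
  funext j
  simp only [negV, LinearMap.funLeft_apply, vb]
  exact if_congr (by omega) rfl rfl

/-- The linear map `v_k ⊗ v_l ↦ v_{-l} ⊗ v_{-k}`. -/
def flip (ty : AffType) (n : ℕ) : Module.End K (VV K ty n) :=
  (TensorProduct.comm K (V K ty n) (V K ty n)).toLinearMap ∘ₗ
    TensorProduct.map (negV ty n) (negV ty n)

theorem flip_tmul (u v : V K ty n) :
    flip ty n (u ⊗ₜ[K] v) = negV ty n v ⊗ₜ[K] negV ty n u := by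
  simp [flip]

theorem flip_tb {k l : ℤ} : flip ty n (tb ty n k l : VV K ty n) = tb ty n (-l) (-k) := by
  rw [tb, flip_tmul, negV_vb, negV_vb, tb]

theorem flip_comp_flip : flip ty n ∘ₗ flip ty n = (LinearMap.id : Module.End K (VV K ty n)) :=
  VV_hom_ext fun k _ l _ => by simp [flip_tb]

theorem tExp_neg {p k : ℤ} : tExp ty n p (-k) = -tExp ty n p k := by
  cases ty <;> simp only [tExp, dlt] <;> grind

theorem negV_comp_E {i j : ℤ} :
    negV ty n ∘ₗ E ty n i j = (E ty n (-i) (-j) ∘ₗ negV ty n : Module.End K (V K ty n)) := by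
  refine V_hom_ext fun k hk => ?_
  simp only [LinearMap.comp_apply, E_vb hk, negV_vb, E_vb (neg_mem_J.2 hk), neg_inj]
  split_ifs <;> simp [negV_vb]

/-- Negating indices reverses ≺, hence turns lowering into raising. The factor [2]_n sits at f_n v_0
and at e_n v_0, so it is respected. -/
theorem negV_comp_piF {p : ℤ} :
    negV ty n ∘ₗ piF ty n qh p = piE ty n qh p ∘ₗ negV ty n := by
  have e1 : -(-p - 1) = p + 1 := by ring
  have e2 : -(p + 1) = -p - 1 := by ring
  have e3 : -((n : ℤ) - 1) = -n + 1 := by ring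
  have e4 : -(-(n : ℤ) + 1) = n - 1 := by ring
  by_cases h : p < n
  · simp only [piF, piE, h, if_true, LinearMap.comp_add, LinearMap.add_comp, negV_comp_E, e1, e2,
      neg_neg]
    exact add_comm _ _
  · cases ty <;> simp only [piF, piE, h, if_false, LinearMap.comp_add, LinearMap.add_comp,
      LinearMap.comp_smul, LinearMap.smul_comp, negV_comp_E, e3, e4, neg_neg, neg_zero] <;>
      exact add_comm _ _

/-- Negation inverts t_p, and the exchange of factors moves it to the other side, which is exactly
the difference between Δ(f_p) = f ⊗ 1 + t ⊗ f and Δ(e_p) = e ⊗ t⁻¹ + 1 ⊗ e. -/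
theorem flip_comp_deltaF {p : ℤ} :
    flip ty n ∘ₗ deltaF ty n q qh p = deltaE ty n q qh p ∘ₗ flip ty n := by
  refine VV_hom_ext fun k _ l _ => ?_
  have h : ∀ v, negV ty n (piF ty n qh p v) = piE ty n qh p (negV ty n v) := fun v =>
    congrArg (fun f => f v) negV_comp_piF
  rw [LinearMap.comp_apply, LinearMap.comp_apply, flip_tb, deltaE_tb]
  simp only [deltaF, tb, LinearMap.add_apply,
    TensorProduct.map_tmul, map_add, flip_tmul, h, negV_vb, LinearMap.id_apply, piT_vb, map_smul,
    TensorProduct.tmul_smul, tExp_neg, neg_neg]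
  exact add_comm _ _

theorem deltaF_comp_flip {p : ℤ} :
    deltaF ty n q qh p ∘ₗ flip ty n = flip ty n ∘ₗ deltaE ty n q qh p := by
  calc deltaF ty n q qh p ∘ₗ flip ty n
      = (flip ty n ∘ₗ flip ty n) ∘ₗ deltaF ty n q qh p ∘ₗ flip ty n := by
        rw [flip_comp_flip, LinearMap.id_comp]
    _ = flip ty n ∘ₗ (flip ty n ∘ₗ deltaF ty n q qh p) ∘ₗ flip ty n := rfl
    _ = flip ty n ∘ₗ deltaE ty n q qh p ∘ₗ flip ty n ∘ₗ flip ty n := by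
        rw [flip_comp_deltaF]; rfl
    _ = flip ty n ∘ₗ deltaE ty n q qh p := by rw [flip_comp_flip, LinearMap.comp_id]

theorem flip_invVec : flip ty n (invVec ty n q qh) = invVec ty n q qh := by
  simp [invVec, flip_tb]

theorem flip_invPartial {k : ℤ} :
    flip ty n (invPartial ty n q qh k) = invPartial ty n q qh k := by
  simp [invPartial, flip_tb]

theorem invForm_comp_flip : invForm ty n q qh ∘ₗ flip ty n = invForm ty n q qh := by
  refine VV_hom_ext fun k hk l hl => ?_
  rw [LinearMap.comp_apply, flip_tb, invForm_tb (neg_mem_J.2 hl) (neg_mem_J.2 hk),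
    invForm_tb hk hl]
  by_cases h : l = -k
  · simp [h]
  · rw [if_neg h, if_neg (by omega)]

theorem prec_neg {k l : ℤ} (hk : k ∈ J ty n) (hl : l ∈ J ty n) :
    Prec n (-k) (-l) ↔ Prec n l k := by
  rw [mem_J] at hk hl
  unfold Prec pos
  grind

theorem flip_comp_braid (hq : q ≠ 0) :
    flip ty n ∘ₗ braid ty n q qh = braid ty n q qh ∘ₗ flip ty n := by
  refine VV_hom_ext fun k hk l hl => ?_
  simp only [LinearMap.comp_apply, flip_tb]
  by_cases hlk : l = -k
  · subst hlk
    simp only [braid_anti hq hk rfl, neg_neg, map_sub, map_add, map_smul, flip_invPartial, flip_tb]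
    split_ifs <;> simp [flip_tb]
  · by_cases hkl : k = l
    · subst hkl
      rw [braid_diag (by omega), braid_diag (by omega), flip_tb]
    · rw [braid_off hlk hkl, braid_off (by omega) (by omega), map_add, map_smul, flip_tb]
      simp only [prec_neg hk hl]
      split_ifs <;> simp [flip_tb]

theorem deltaF_commute (hn : ty.minRank ≤ n) (hq : q ≠ 0) (htwo : ty = .A2even → two qh ≠ 0)
    {p : ℤ} (h1 : 1 ≤ p) (h2 : p ≤ n) :
    deltaF ty n q qh p (invVec ty n q qh) = 0 ∧
    invForm ty n q qh ∘ₗ deltaF ty n q qh p = 0 ∧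
    braid ty n q qh ∘ₗ deltaF ty n q qh p = deltaF ty n q qh p ∘ₗ braid ty n q qh := by
  obtain ⟨hv, hF, hb⟩ := deltaE_commute hn hq htwo h1 h2
  refine ⟨?_, ?_, ?_⟩
  · rw [← flip_invVec, ← LinearMap.comp_apply, deltaF_comp_flip, LinearMap.comp_apply, hv, map_zero]
  · rw [← invForm_comp_flip, LinearMap.comp_assoc, flip_comp_deltaF, ← LinearMap.comp_assoc, hF,
      LinearMap.zero_comp]
  · calc braid ty n q qh ∘ₗ deltaF ty n q qh p
        = (flip ty n ∘ₗ flip ty n) ∘ₗ braid ty n q qh ∘ₗ deltaF ty n q qh p := by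
          rw [flip_comp_flip, LinearMap.id_comp]
      _ = flip ty n ∘ₗ (flip ty n ∘ₗ braid ty n q qh) ∘ₗ deltaF ty n q qh p := rfl
      _ = flip ty n ∘ₗ braid ty n q qh ∘ₗ (flip ty n ∘ₗ deltaF ty n q qh p) := by
          rw [flip_comp_braid hq]; rfl
      _ = flip ty n ∘ₗ (braid ty n q qh ∘ₗ deltaE ty n q qh p) ∘ₗ flip ty n := by
          rw [flip_comp_deltaF]; rfl
      _ = (flip ty n ∘ₗ deltaE ty n q qh p) ∘ₗ (braid ty n q qh ∘ₗ flip ty n) := by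
          rw [hb]; rfl
      _ = deltaF ty n q qh p ∘ₗ (flip ty n ∘ₗ flip ty n) ∘ₗ braid ty n q qh := by
          rw [← deltaF_comp_flip, ← flip_comp_braid hq]; rfl
      _ = deltaF ty n q qh p ∘ₗ braid ty n q qh := by rw [flip_comp_flip, LinearMap.id_comp]

/-- T preserves weights: it mixes v_k ⊗ v_l only with v_l ⊗ v_k, or with the vectors v_{-i} ⊗ v_i
when l = -k. -/
theorem diagonal_commute (hq : q ≠ 0) {D : Module.End K (VV K ty n)} {g : ℤ → ℤ → K}
    (hD : ∀ k l, D (tb ty n k l) = g k l • tb ty n k l) (hg : ∀ k l, g k l = g l k)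
    (hg1 : ∀ k, g k (-k) = 1) :
    D (invVec ty n q qh) = invVec ty n q qh ∧
    invForm ty n q qh ∘ₗ D = invForm ty n q qh ∧
    braid ty n q qh ∘ₗ D = D ∘ₗ braid ty n q qh := by
  have hg2 : ∀ k, g (-k) k = 1 := fun k => by rw [hg, hg1]
  refine ⟨?_, ?_, ?_⟩
  · simp [invVec, hD, hg2]
  · refine VV_hom_ext fun k hk l hl => ?_
    rw [LinearMap.comp_apply, hD, map_smul, invForm_tb hk hl]
    split_ifs with h
    · rw [h, hg1, one_smul]
    · simp
  · refine VV_hom_ext fun k hk l hl => ?_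
    simp only [LinearMap.comp_apply, hD, map_smul]
    by_cases hlk : l = -k
    · subst hlk
      have : D (invPartial ty n q qh k) = invPartial ty n q qh k := by simp [invPartial, hD, hg2]
      simp only [braid_anti hq hk rfl, map_sub, map_add, map_smul, this, hD, hg2, hg1, one_smul]
      split_ifs <;> simp [hD, hg1]
    · by_cases hkl : k = l
      · subst hkl
        rw [braid_diag (by omega), hD]
      · rw [braid_off hlk hkl, map_add, map_smul, hD, hg l k]
        split_ifs <;> simp [hD, smul_smul, mul_comm]

theorem deltaT_commute (hq : q ≠ 0) {p : ℤ} :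
    deltaT ty n q p (invVec ty n q qh) = invVec ty n q qh ∧
    invForm ty n q qh ∘ₗ deltaT ty n q p = invForm ty n q qh ∧
    braid ty n q qh ∘ₗ deltaT ty n q p = deltaT ty n q p ∘ₗ braid ty n q qh :=
  diagonal_commute hq (fun _ _ => deltaT_tb hq) (fun _ _ => by rw [add_comm])
    fun k => by simp [tExp_neg]

theorem deltaTinv_commute (hq : q ≠ 0) {p : ℤ} :
    deltaTinv ty n q p (invVec ty n q qh) = invVec ty n q qh ∧
    invForm ty n q qh ∘ₗ deltaTinv ty n q p = invForm ty n q qh ∧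
    braid ty n q qh ∘ₗ deltaTinv ty n q p = deltaTinv ty n q p ∘ₗ braid ty n q qh :=
  diagonal_commute hq (fun _ _ => deltaTinv_tb hq) (fun _ _ => by rw [add_comm (tExp ty n p _)])
    fun k => by simp [tExp_neg]

/-- The contraction onto the invariant vector. -/
def contraction (ty : AffType) (n : ℕ) (q qh : K) : Module.End K (VV K ty n) :=
  (invForm ty n q qh).smulRight (invVec ty n q qh)

theorem commute_of_mem_Uq {D : Module.End K (VV K ty n)}
    (hE : ∀ p : ℤ, 1 ≤ p → p ≤ n → D ∘ₗ deltaE ty n q qh p = deltaE ty n q qh p ∘ₗ D)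
    (hF : ∀ p : ℤ, 1 ≤ p → p ≤ n → D ∘ₗ deltaF ty n q qh p = deltaF ty n q qh p ∘ₗ D)
    (hT : ∀ p : ℤ, D ∘ₗ deltaT ty n q p = deltaT ty n q p ∘ₗ D)
    (hT' : ∀ p : ℤ, D ∘ₗ deltaTinv ty n q p = deltaTinv ty n q p ∘ₗ D)
    {x : Module.End K (VV K ty n)} (hx : x ∈ Uq ty n q qh) (u : VV K ty n) :
    D (x u) = x (D u) := by
  have : Uq ty n q qh ≤ Subalgebra.centralizer K {D} := by
    refine Algebra.adjoin_le ?_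
    rintro y ⟨p, h1, h2, rfl | rfl | rfl | rfl⟩ <;>
      rw [SetLike.mem_coe, Subalgebra.mem_centralizer_iff] <;> rintro _ rfl
    · exact hE p h1 h2
    · exact hF p h1 h2
    · exact hT p
    · exact hT' p
  have := Subalgebra.mem_centralizer_iff K |>.1 (this hx) D rfl
  exact congrArg (fun f => f u) this

theorem braid_apply_of_mem_Uq (hn : ty.minRank ≤ n) (hq : q ≠ 0)
    (htwo : ty = .A2even → two qh ≠ 0) {x : Module.End K (VV K ty n)} (hx : x ∈ Uq ty n q qh)
    (u : VV K ty n) : braid ty n q qh (x u) = x (braid ty n q qh u) :=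
  commute_of_mem_Uq (fun _ h1 h2 => (deltaE_commute hn hq htwo h1 h2).2.2)
    (fun _ h1 h2 => (deltaF_commute hn hq htwo h1 h2).2.2) (fun _ => (deltaT_commute hq).2.2)
    (fun _ => (deltaTinv_commute hq).2.2) hx u

theorem contraction_apply_of_mem_Uq (hn : ty.minRank ≤ n) (hq : q ≠ 0)
    (htwo : ty = .A2even → two qh ≠ 0) {x : Module.End K (VV K ty n)} (hx : x ∈ Uq ty n q qh)
    (u : VV K ty n) : contraction ty n q qh (x u) = x (contraction ty n q qh u) := by
  -- The scalar c is the counit of the generator: 0 for e_p and f_p, 1 for t_p and its inverse.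
  have key : ∀ {D : Module.End K (VV K ty n)} {c : K}, D (invVec ty n q qh) = c • invVec ty n q qh →
      invForm ty n q qh ∘ₗ D = c • invForm ty n q qh →
      contraction ty n q qh ∘ₗ D = D ∘ₗ contraction ty n q qh := by
    intro D c h1 h2
    refine LinearMap.ext fun u => ?_
    have h2' := congrArg (fun f => f u) h2
    simp only [LinearMap.comp_apply, LinearMap.smul_apply] at h2'
    simp only [LinearMap.comp_apply, contraction, LinearMap.smulRight_apply, h2', map_smul, h1,
      smul_smul, smul_eq_mul, mul_comm]
  refine commute_of_mem_Uq (fun p h1 h2 => ?_) (fun p h1 h2 => ?_) (fun p => ?_) (fun p => ?_) hx u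
  · obtain ⟨h, h', -⟩ := deltaE_commute (q := q) (qh := qh) hn hq htwo h1 h2
    exact key (c := 0) (by rw [h, zero_smul]) (by rw [h', zero_smul])
  · obtain ⟨h, h', -⟩ := deltaF_commute (q := q) (qh := qh) hn hq htwo h1 h2
    exact key (c := 0) (by rw [h, zero_smul]) (by rw [h', zero_smul])
  · obtain ⟨h, h', -⟩ := deltaT_commute (ty := ty) (n := n) (qh := qh) hq (p := p)
    exact key (c := 1) (by rw [h, one_smul]) (by rw [h', one_smul])
  · obtain ⟨h, h', -⟩ := deltaTinv_commute (ty := ty) (n := n) (qh := qh) hq (p := p)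
    exact key (c := 1) (by rw [h, one_smul]) (by rw [h', one_smul])

/-- The Baxterization. Since ξ and z enter only through explicit scalars, it reduces every question
about Ř(z) to Ř(0) and the contraction. -/
theorem Rcheck_eq (hq : q ≠ 0) (htwo : ty = .A2even → two qh ≠ 0) :
    Rcheck ty n q qh z =
      (1 - xi ty n q * z) • ((1 - z) • braid ty n q qh + (z * (1 - q ^ 2)) • LinearMap.id) -
        (z * (1 - z) * (1 - q ^ 2) * xi ty n q) • contraction ty n q qh := by
  refine VV_hom_ext fun k hk l hl => ?_
  simp only [LinearMap.sub_apply, LinearMap.smul_apply, LinearMap.add_apply, LinearMap.id_apply,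
    contraction, LinearMap.smulRight_apply, invForm_tb hk hl]
  by_cases hlk : l = -k
  · subst hlk
    -- Writing the identity term as a sum over the same vectors v_{-i} ⊗ v_i lets both sides be
    -- compared coefficient by coefficient.
    have hid : (tb ty n k (-k) : VV K ty n) =
        ∑ i ∈ J ty n, (if i = -k then (1 : K) else 0) • tb ty n (-i) i := by
      simp only [ite_smul, one_smul, zero_smul]
      rw [Finset.sum_ite_eq' _ (-k), if_pos (neg_mem_J.2 hk), neg_neg]
    rw [braid, Rcheck_tb_anti hk, Rcheck_tb_anti hk, if_pos rfl]
    conv_rhs => rw [hid, invVec]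
    simp only [smul_add, Finset.smul_sum]
    rw [← Finset.sum_add_distrib, ← Finset.sum_sub_distrib]
    refine Finset.sum_congr rfl fun i _ => ?_
    simp only [smul_smul, ← add_smul, ← sub_smul]
    congr 1
    have hz := cc_ne_zero (q := q) (qh := qh) hq htwo hk
    rcases eq_or_ne i k with rfl | hik
    · have e : (cc ty n q qh i)⁻¹ * cc ty n q qh i = 1 := inv_mul_cancel₀ hz
      by_cases h0 : i = 0
      · simp only [a, if_true, h0, neg_zero] at e ⊢
        linear_combination (z * (1 - z) * (1 - q ^ 2) * xi ty n q) * e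
      · have h0' : i ≠ -i := by omega
        simp only [a, if_true, h0, h0', if_false]
        linear_combination (z * (1 - z) * (1 - q ^ 2) * xi ty n q) * e
    · by_cases hP : Prec n i k
      · simp only [a, hik, hP, if_true, if_false, eps_mul_zpow hq]
        split_ifs <;> ring
      · simp only [a, hik, hP, if_false]
        have := eps_mul_zpow (ty := ty) (n := n) (qh := qh) hq i k
        split_ifs <;> linear_combination ((1 - q ^ 2) * z * xi ty n q * (z - 1)) * this
  · rw [braid, Rcheck_tb_of_ne hlk, Rcheck_tb_of_ne hlk, if_neg hlk]
    by_cases hkl : k = l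
    · simp only [hkl, if_true]
      module
    · have : Prec n l k ∨ Prec n k l := by
        have hk := mem_J.1 hk
        have hl := mem_J.1 hl
        unfold Prec pos
        grind
      rcases this with h | h
      · have h' : ¬ Prec n k l := lt_asymm h
        simp only [hkl, if_false, h, h', if_true]
        module
      · have h' : ¬ Prec n l k := lt_asymm h
        simp only [hkl, if_false, h, h', if_true]
        module

end

end QWedge

/-! ### Nonvanishing from transcendence, the norm of the invariant vector, and the eigenvalues. -/

namespace QWedge

noncomputable section

variable {K : Type*} [Field K] {ty : AffType} {n : ℕ} {q qh z : K}

theorem pow_ne_algebraMap [CharZero K] (hq : Transcendental ℚ q) {m : ℕ} (hm : 0 < m) (r : ℚ) :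
    q ^ m ≠ algebraMap ℚ K r := by
  intro h
  exact hq (IsAlgebraic.of_pow hm (h ▸ isAlgebraic_algebraMap r))

theorem pow_ne_one_of_transcendental [CharZero K] (hq : Transcendental ℚ q) {m : ℕ} (hm : 0 < m) :
    q ^ m ≠ 1 := by simpa using pow_ne_algebraMap hq hm 1

theorem pow_ne_neg_one_of_transcendental [CharZero K] (hq : Transcendental ℚ q) {m : ℕ}
    (hm : 0 < m) : q ^ m ≠ -1 := by simpa using pow_ne_algebraMap hq hm (-1)

theorem ne_zero_of_transcendental [CharZero K] (hq : Transcendental ℚ q) : q ≠ 0 := by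
  rintro rfl
  exact hq isAlgebraic_zero

theorem zpow_injective_of_transcendental [CharZero K] (hq : Transcendental ℚ q) {a b : ℤ}
    (h : q ^ a = q ^ b) : a = b := by
  have h0 := ne_zero_of_transcendental hq
  have key : ∀ {a b : ℤ}, q ^ a = q ^ b → ¬ a < b := by
    intro a b h hlt
    have e : q ^ (b - a).toNat = 1 := by
      rw [← zpow_natCast, Int.toNat_of_nonneg (by omega), zpow_sub₀ h0, h,
        div_self (zpow_ne_zero _ h0)]
    exact pow_ne_one_of_transcendental hq (by omega) e
  exact le_antisymm (not_lt.1 (key h.symm)) (not_lt.1 (key h))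

theorem two_ne_zero_of_transcendental [CharZero K] (hq : Transcendental ℚ q) (h : qh ^ 2 = q) :
    two qh ≠ 0 := by
  intro h2
  have h0 := ne_zero_of_transcendental hq
  have hqh : qh ≠ 0 := by
    rintro rfl
    exact h0 (by rw [← h]; ring)
  have : q ^ 1 = -1 := by
    rw [two] at h2
    field_simp at h2
    rw [pow_one, ← h]
    linear_combination h2
  exact pow_ne_neg_one_of_transcendental hq one_pos this

theorem one_add_xi_ne_zero [CharZero K] (hq : Transcendental ℚ q) (hn : 1 ≤ n) :
    1 + xi ty n q ≠ 0 := by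
  intro h
  cases ty <;> simp only [xi] at h
  · exact pow_ne_one_of_transcendental hq (m := 2 * n + 1) (by omega) (by linear_combination -h)
  · exact pow_ne_one_of_transcendental hq (m := 2 * n) (by omega) (by linear_combination -h)
  · exact pow_ne_one_of_transcendental hq (m := 2 * n) (by omega) (by linear_combination -h)
  · exact pow_ne_neg_one_of_transcendental hq (m := 2 * n + 2) (by omega) (by linear_combination h)

theorem sq_sub_xi_ne_zero [CharZero K] (hq : Transcendental ℚ q) (hn : 2 ≤ n) :
    q ^ 2 - xi ty n q ≠ 0 := by
  intro h
  have h0 : q ^ 2 ≠ 0 := pow_ne_zero 2 (ne_zero_of_transcendental hq)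
  -- The substitution makes q² a visible factor of ξ, so that it can be cancelled and a positive
  -- power of q remains.
  obtain ⟨m, rfl⟩ : ∃ m, n = m + 2 := ⟨n - 2, by omega⟩
  cases ty <;> simp only [xi] at h
  · exact pow_ne_neg_one_of_transcendental hq (m := 2 * m + 3) (by omega)
      (mul_left_cancel₀ h0 (by linear_combination h))
  · exact pow_ne_neg_one_of_transcendental hq (m := 2 * m + 2) (by omega)
      (mul_left_cancel₀ h0 (by linear_combination h))
  · exact pow_ne_neg_one_of_transcendental hq (m := 2 * m + 2) (by omega)
      (mul_left_cancel₀ h0 (by linear_combination h))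
  · exact pow_ne_one_of_transcendental hq (m := 2 * m + 4) (by omega)
      (mul_left_cancel₀ h0 (by linear_combination -h))

theorem one_sub_sq_mul_xi_ne_zero [CharZero K] (hq : Transcendental ℚ q) :
    1 - q ^ 2 * xi .A2odd n q ≠ 0 := by
  intro h
  simp only [xi] at h
  exact pow_ne_neg_one_of_transcendental hq (m := 2 * n + 2) (by omega) (by linear_combination h)

theorem sum_Icc_neg {M : Type*} [AddCommMonoid M] (g : ℤ → M) (n : ℕ) :
    ∑ i ∈ Finset.Icc (-(n : ℤ)) n, g i =
      g 0 + ∑ j ∈ Finset.range n, (g (j + 1) + g (-(j + 1))) := by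
  induction n with
  | zero => simp
  | succ n ih =>
    have : Finset.Icc (-((n + 1 : ℕ) : ℤ)) (n + 1 : ℕ) =
        insert ((n : ℤ) + 1) (insert (-((n : ℤ) + 1)) (Finset.Icc (-(n : ℤ)) n)) := by
      ext i
      simp only [Finset.mem_insert, Finset.mem_Icc]
      omega
    rw [this, Finset.sum_insert, Finset.sum_insert, ih, Finset.sum_range_succ]
    · abel
    · simp
    · simp only [Finset.mem_insert, Finset.mem_Icc]
      omega

/-- Two geometric series of ratios x⁻² and x², telescoped together by 1 - x². With x = -q and N =
`bigN` they are the contributions of positive and negative indices to `invNorm`. -/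
theorem geom_sum_symm {x : K} (hx : x ≠ 0) (N : ℤ) (m : ℕ) :
    (1 - x ^ 2) * ∑ j ∈ Finset.range m,
      (x ^ (N - 2 * ((j : ℤ) + 1)) + x ^ (2 * ((j : ℤ) + 1) - N)) =
      x ^ (N - 2 * m) - x ^ N + x ^ (2 - N) - x ^ (2 * m + 2 - N) := by
  induction m with
  | zero => simp
  | succ m ih =>
    rw [Finset.sum_range_succ, mul_add, ih]
    have e1 : x ^ (N - 2 * (m : ℤ)) = x ^ 2 * x ^ (N - 2 * ((m : ℤ) + 1)) := by
      rw [← zpow_natCast, ← zpow_add₀ hx]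
      congr 1
      push_cast
      ring
    have e2 : x ^ (2 * ((m : ℤ) + 1) + 2 - N) = x ^ 2 * x ^ (2 * ((m : ℤ) + 1) - N) := by
      rw [← zpow_natCast, ← zpow_add₀ hx]
      congr 1
      push_cast
      ring
    have e3 : 2 * (m : ℤ) + 2 - N = 2 * ((m : ℤ) + 1) - N := by ring
    push_cast
    rw [e1, e2, e3]
    ring

/-- The sign `ε_j ε_{-j}`. -/
def sgn (ty : AffType) : ℤ := if ty = .A2oddDagger then 1 else -1

theorem cc_mul_inv_of_pos (hq : q ≠ 0) {i : ℤ} (hi : 0 < i) :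
    cc ty n q qh i * (cc ty n q qh (-i))⁻¹ = sgn ty * (-q) ^ (bigN ty n - 2 * i) ∧
    cc ty n q qh (-i) * (cc ty n q qh i)⁻¹ = sgn ty * (-q) ^ (2 * i - bigN ty n) := by
  have hq' := neg_ne_zero.2 hq
  have b1 : bar ty n i = i := by simp [bar, hi]
  have b2 : bar ty n (-i) = bigN ty n - i := by
    unfold bar
    rw [if_neg (by omega), if_neg (by omega)]
    ring
  have e1 : eps ty qh i = 1 := by
    cases ty <;> simp [eps, hi]
  have e2 : eps ty qh (-i) = sgn ty := by
    cases ty <;> simp only [eps, sgn, reduceCtorEq, if_true, if_false] <;>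
      first | (rw [if_neg (by omega), if_neg (by omega)]; simp) | simp
  have e3 : ((sgn ty : ℤ) : K)⁻¹ = sgn ty := by
    cases ty <;> simp [sgn]
  constructor
  · rw [← eps_mul_zpow hq, b1, b2, e1, e2, inv_one, mul_one]
    congr 2
    ring
  · rw [← eps_mul_zpow hq, b1, b2, e1, e2, one_mul, e3]
    congr 2
    ring

/-- The value of the invariant form on the invariant vector. -/
def invNorm (ty : AffType) (n : ℕ) (q qh : K) : K :=
  ∑ i ∈ J ty n, cc ty n q qh i * (cc ty n q qh (-i))⁻¹

theorem invForm_invVec : invForm ty n q qh (invVec ty n q qh) = invNorm ty n q qh := by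
  rw [invVec, map_sum]
  refine Finset.sum_congr rfl fun i hi => ?_
  rw [map_smul, invForm_tb (neg_mem_J.2 hi) hi, neg_neg, if_pos rfl, smul_eq_mul]

theorem one_sub_sq_mul_invNorm (hq : q ≠ 0) (htwo : ty = .A2even → two qh ≠ 0) :
    (1 - q ^ 2) * invNorm ty n q qh = (if ty = .A2even then 1 - q ^ 2 else 0) +
      sgn ty * ((-q) ^ (bigN ty n - 2 * n) - (-q) ^ bigN ty n + (-q) ^ (2 - bigN ty n) -
        (-q) ^ (2 * n + 2 - bigN ty n)) := by
  have hg := geom_sum_symm (neg_ne_zero.2 hq) (bigN ty n) n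
  rw [neg_sq] at hg
  rw [invNorm, J, Finset.sum_filter, sum_Icc_neg, ← hg, mul_add]
  congr 1
  · split_ifs with h1 h2 h2
    · have : cc ty n q qh 0 ≠ 0 := cc_ne_zero hq htwo (mem_J.2 ⟨by omega, h1⟩)
      rw [neg_zero, mul_inv_cancel₀ this, mul_one]
    · simp [h2] at h1
    · simp [h2] at h1
    · simp
  · rw [mul_left_comm, Finset.mul_sum _ _ ((sgn ty : ℤ) : K)]
    congr 1
    refine Finset.sum_congr rfl fun j _ => ?_
    have hj : (0 : ℤ) < j + 1 := by omega
    obtain ⟨h1, h2⟩ := cc_mul_inv_of_pos (ty := ty) (n := n) (qh := qh) hq hj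
    rw [if_pos (Or.inr (by omega)), if_pos (Or.inr (by omega)), neg_neg, h1, h2]
    ring

theorem neg_zpow_two_mul :
    (-q) ^ (2 * (n : ℤ)) = (q ^ n) ^ 2 ∧ (-q) ^ (-(2 * (n : ℤ))) = ((q ^ n) ^ 2)⁻¹ := by
  have : (-q) ^ (2 * (n : ℤ)) = (q ^ n) ^ 2 := by
    rw [zpow_mul, zpow_ofNat, neg_sq, zpow_natCast, ← pow_mul, ← pow_mul, mul_comm]
  exact ⟨this, by rw [zpow_neg, this]⟩

/-- Both come from the closed form of `invNorm`. The first is the T-eigenvalue of the invariant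
vector as read from the coefficient of v_{-1} ⊗ v_1 in `braid_invVec`. The second factors the norm:
this shows that it is nonzero, and it is what makes the eigenvalue of Ř(z) split into linear
factors. It is here that the value of ξ matters. -/
theorem invNorm_identities (hq : q ≠ 0) (htwo : ty = .A2even → two qh ≠ 0) :
    cc ty n q qh (-1) * (cc ty n q qh 1)⁻¹ + (1 - q ^ 2) * (1 - invNorm ty n q qh) =
      eigenvalue ty n q 0 2 ∧
    (if ty = .A2odd then
      (1 - q ^ 2) * xi ty n q * invNorm ty n q qh = (1 + xi ty n q) * (1 - q ^ 2 * xi ty n q)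
    else -(1 - q ^ 2) * xi ty n q * invNorm ty n q qh = (q ^ 2 - xi ty n q) * (1 + xi ty n q)) := by
  have hδ := one_sub_sq_mul_invNorm (n := n) hq htwo
  have hκ := (cc_mul_inv_of_pos (ty := ty) (n := n) (qh := qh) hq one_pos).2
  obtain ⟨h1, h2⟩ := neg_zpow_two_mul (q := q) (n := n)
  have hq' := neg_ne_zero.2 hq
  have hz : q ^ n ≠ 0 := pow_ne_zero _ hq
  have hx1 : q ^ (2 * n) = (q ^ n) ^ 2 := by rw [← pow_mul, mul_comm]
  rw [hκ]
  cases ty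
  · have e1 : (-q) ^ (bigN .A2even n - 2 * n) = -q := by
      simp [bigN]
    have e2 : (-q) ^ bigN .A2even n = (q ^ n) ^ 2 * (-q) := by
      rw [bigN, zpow_add₀ hq', h1, zpow_one]
    have e3 : (-q) ^ (2 - bigN .A2even n) = ((q ^ n) ^ 2)⁻¹ * (-q) := by
      rw [bigN, show (2 : ℤ) - (2 * n + 1) = -(2 * n) + 1 by ring, zpow_add₀ hq', h2, zpow_one]
    have e4 : (-q) ^ (2 * n + 2 - bigN .A2even n) = -q := by
      rw [bigN, show (2 : ℤ) * n + 2 - (2 * n + 1) = 1 by ring, zpow_one]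
    have e5 : (-q) ^ (2 * 1 - bigN .A2even n) = ((q ^ n) ^ 2)⁻¹ * (-q) := by rw [mul_one, e3]
    rw [e1, e2, e3, e4] at hδ
    simp only [if_true, sgn, reduceCtorEq, if_false, Int.cast_neg, Int.cast_one] at hδ ⊢
    rw [e5]
    simp only [eigenvalue, xi, pow_succ q (2 * n), hx1]
    constructor
    · linear_combination -hδ
    · field_simp at hδ
      linear_combination q * hδ
  · have e1 : (-q) ^ (bigN .A2odd n - 2 * n) = q ^ 2 := by
      rw [bigN, add_sub_cancel_left, zpow_ofNat, neg_sq]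
    have e2 : (-q) ^ bigN .A2odd n = (q ^ n) ^ 2 * q ^ 2 := by
      rw [bigN, zpow_add₀ hq', h1, zpow_ofNat, neg_sq]
    have e3 : (-q) ^ (2 - bigN .A2odd n) = ((q ^ n) ^ 2)⁻¹ := by
      rw [bigN, show (2 : ℤ) - (2 * n + 2) = -(2 * n) by ring, h2]
    have e4 : (-q) ^ (2 * n + 2 - bigN .A2odd n) = 1 := by
      rw [bigN, sub_self, zpow_zero]
    have e5 : (-q) ^ (2 * 1 - bigN .A2odd n) = ((q ^ n) ^ 2)⁻¹ := by rw [mul_one, e3]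
    rw [e1, e2, e3, e4] at hδ
    simp only [if_true, sgn, reduceCtorEq, if_false, Int.cast_neg, Int.cast_one] at hδ ⊢
    rw [e5]
    simp only [eigenvalue, xi, hx1]
    constructor
    · linear_combination -hδ
    · field_simp at hδ
      linear_combination -hδ
  · have e1 : (-q) ^ (bigN .A2oddDagger n - 2 * n) = 1 := by
      rw [bigN, sub_self, zpow_zero]
    have e2 : (-q) ^ bigN .A2oddDagger n = (q ^ n) ^ 2 := by
      rw [bigN, h1]
    have e3 : (-q) ^ (2 - bigN .A2oddDagger n) = q ^ 2 * ((q ^ n) ^ 2)⁻¹ := by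
      rw [bigN, sub_eq_add_neg, zpow_add₀ hq', h2, zpow_ofNat, neg_sq]
    have e4 : (-q) ^ (2 * n + 2 - bigN .A2oddDagger n) = q ^ 2 := by
      rw [bigN, add_sub_cancel_left, zpow_ofNat, neg_sq]
    have e5 : (-q) ^ (2 * 1 - bigN .A2oddDagger n) = q ^ 2 * ((q ^ n) ^ 2)⁻¹ := by
      rw [mul_one, e3]
    rw [e1, e2, e3, e4] at hδ
    simp only [if_true, sgn, reduceCtorEq, if_false, Int.cast_one] at hδ ⊢
    rw [e5]
    simp only [eigenvalue, xi, hx1]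
    constructor
    · linear_combination -hδ
    · field_simp at hδ
      linear_combination hδ
  · have e1 : (-q) ^ (bigN .C1 n - 2 * n) = q ^ 2 := by
      rw [bigN, add_sub_cancel_left, zpow_ofNat, neg_sq]
    have e2 : (-q) ^ bigN .C1 n = (q ^ n) ^ 2 * q ^ 2 := by
      rw [bigN, zpow_add₀ hq', h1, zpow_ofNat, neg_sq]
    have e3 : (-q) ^ (2 - bigN .C1 n) = ((q ^ n) ^ 2)⁻¹ := by
      rw [bigN, show (2 : ℤ) - (2 * n + 2) = -(2 * n) by ring, h2]
    have e4 : (-q) ^ (2 * n + 2 - bigN .C1 n) = 1 := by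
      rw [bigN, sub_self, zpow_zero]
    have e5 : (-q) ^ (2 * 1 - bigN .C1 n) = ((q ^ n) ^ 2)⁻¹ := by rw [mul_one, e3]
    rw [e1, e2, e3, e4] at hδ
    simp only [sgn, reduceCtorEq, if_false, Int.cast_neg, Int.cast_one] at hδ ⊢
    rw [e5]
    simp only [eigenvalue, xi, pow_add q (2 * n), hx1]
    constructor
    · linear_combination -hδ
    · field_simp at hδ
      linear_combination -q ^ 2 * hδ

theorem invNorm_ne_zero [CharZero K] (hq : Transcendental ℚ q)
    (htwo : ty = .A2even → two qh ≠ 0) (hn : 2 ≤ n) : invNorm ty n q qh ≠ 0 := by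
  intro h
  have := (invNorm_identities (n := n) (ne_zero_of_transcendental hq) htwo).2
  have h1 := one_add_xi_ne_zero (ty := ty) (n := n) hq (by omega)
  rw [h] at this
  split_ifs at this with hty
  · subst hty
    exact mul_ne_zero h1 (one_sub_sq_mul_xi_ne_zero hq) (by rw [← this, mul_zero])
  · exact mul_ne_zero (sq_sub_xi_ne_zero hq hn) h1 (by rw [← this, mul_zero])

/-- Both sides are quadratic in z and agree at z = 0 and z = 1, so their difference is a multiple of
z(1 - z). Its vanishing is the second identity for the norm. -/
theorem eigenvalue_eq (hq : q ≠ 0) (htwo : ty = .A2even → two qh ≠ 0) :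
    (1 - xi ty n q * z) * ((1 - z) * eigenvalue ty n q 0 2 + z * (1 - q ^ 2)) -
      z * (1 - z) * (1 - q ^ 2) * xi ty n q * invNorm ty n q qh = eigenvalue ty n q z 2 := by
  have := (invNorm_identities (n := n) hq htwo).2
  cases ty <;> simp only [eigenvalue, reduceCtorEq, if_true, if_false] at this ⊢
  · linear_combination z * (1 - z) * this
  · linear_combination -z * (1 - z) * this
  · linear_combination z * (1 - z) * this
  · linear_combination z * (1 - z) * this

/-- At z = 0 the eigenvalues are 1, -q² and either -ξ or, for `A2odd`, q²ξ. Their separation is what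
lets T distinguish the components. -/
theorem eigenvalue_zero_injective [CharZero K] (hq : Transcendental ℚ q) (hn : 2 ≤ n) :
    Function.Injective (eigenvalue ty n q 0) := by
  have h01 : eigenvalue ty n q 0 0 ≠ eigenvalue ty n q 0 1 := by
    intro h
    simp only [eigenvalue] at h
    exact pow_ne_neg_one_of_transcendental hq two_pos (by linear_combination h)
  have h1 := one_add_xi_ne_zero (ty := ty) (n := n) hq (by omega)
  have h2 := sq_sub_xi_ne_zero (ty := ty) hq hn
  have h3 := one_sub_sq_mul_xi_ne_zero (n := n) hq
  have hq2 : q ^ 2 ≠ 0 := pow_ne_zero 2 (ne_zero_of_transcendental hq)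
  have h02 : eigenvalue ty n q 0 0 ≠ eigenvalue ty n q 0 2 := by
    intro h
    cases ty <;> simp only [eigenvalue] at h
    · exact h1 (by linear_combination h)
    · exact h3 (by linear_combination h)
    · exact h1 (by linear_combination h)
    · exact h1 (by linear_combination h)
  have h12 : eigenvalue ty n q 0 1 ≠ eigenvalue ty n q 0 2 := by
    intro h
    cases ty <;> simp only [eigenvalue] at h
    · exact h2 (by linear_combination -h)
    · exact mul_ne_zero hq2 h1 (by linear_combination -h)
    · exact h2 (by linear_combination -h)
    · exact h2 (by linear_combination -h)
  intro i j hij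
  fin_cases i <;> fin_cases j <;> first | rfl | exact absurd hij ‹_› | exact absurd hij.symm ‹_›

/-! ### The invariant vector as an eigenvector of Ř(0). -/

theorem cf_invVec {k l : ℤ} :
    cf ty n k l (invVec ty n q qh) = if l = -k ∧ l ∈ J ty n then cc ty n q qh l else 0 := by
  rw [invVec, map_sum]
  split_ifs with h
  · obtain ⟨rfl, hl⟩ := h
    rw [Finset.sum_eq_single (-k)]
    · rw [map_smul, cf_tb (neg_mem_J.2 hl) hl, if_pos ⟨by ring, rfl⟩, smul_eq_mul, mul_one]
    · intro i hi hne
      rw [map_smul, cf_tb (neg_mem_J.2 hi) hi, if_neg (fun h => hne h.2.symm), smul_zero]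
    · exact fun h => absurd hl h
  · refine Finset.sum_eq_zero fun i hi => ?_
    rw [map_smul, cf_tb (neg_mem_J.2 hi) hi, if_neg, smul_zero]
    rintro ⟨rfl, rfl⟩
    exact h ⟨by ring, hi⟩

theorem suppJ_cf (u : VV K ty n) : SuppJ ty n fun k l => cf ty n k l u := by
  intro k l h
  constructor <;> by_contra hJ
  · exact h (by simp [cf_eq_zero_left hJ])
  · exact h (by simp [cf_eq_zero_right hJ])

theorem killed_cf (hn : ty.minRank ≤ n) {u : VV K ty n}
    (hu : ∀ p : ℤ, 1 ≤ p → p ≤ n → deltaE ty n q qh p u = 0) :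
    Killed ty n (fun p k l => cE ty n qh p k * q ^ (-tExp ty n p l)) (fun p _ l => cE ty n qh p l)
      fun k l => cf ty n k l u := by
  intro p h1 h2
  funext k l
  have := cf_comp_deltaE (q := q) (qh := qh) (k := k) (l := l) hn h1 h2 u
  rw [hu p h1 h2, map_zero] at this
  exact this.symm

theorem cE_ne_zero (htwo : ty = .A2even → two qh ≠ 0) (p k : ℤ) : cE ty n qh p k ≠ 0 := by
  unfold cE
  split_ifs with h
  · exact htwo h.1
  · exact one_ne_zero

theorem cF_ne_zero (htwo : ty = .A2even → two qh ≠ 0) (p k : ℤ) : cF ty n qh p k ≠ 0 := by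
  unfold cF
  split_ifs with h
  · exact htwo h.1
  · exact one_ne_zero

theorem one_mem_J (hn : 1 ≤ n) : (1 : ℤ) ∈ J ty n := mem_J_of_ne (by omega) (by omega) (by omega)

theorem prec_one_neg (hn : 1 ≤ n) {k : ℤ} (hk : k ∈ J ty n) (h : k ≠ -1) : Prec n 1 (-k) := by
  rw [mem_J] at hk
  unfold Prec pos
  grind

/-- T maps the invariant vector to a zero-weight vector killed by all e_p, hence to a multiple of it
by `Killed.eq_smul`. The factor is found from the single coefficient of v_{-1} ⊗ v_1. -/
theorem braid_invVec (hn : ty.minRank ≤ n) (hq : q ≠ 0) (htwo : ty = .A2even → two qh ≠ 0) :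
    braid ty n q qh (invVec ty n q qh) = eigenvalue ty n q 0 2 • invVec ty n q qh := by
  have hn2 := two_le_of_minRank_le hn
  have hone : (1 : ℤ) ∈ J ty n := one_mem_J (by omega)
  have hc1 : cc ty n q qh 1 ≠ 0 := cc_ne_zero hq htwo hone
  have hsum : braid ty n q qh (invVec ty n q qh) =
      ∑ k ∈ J ty n, cc ty n q qh k • ∑ i ∈ J ty n, a ty n q qh 0 i (-k) • tb ty n (-i) i := by
    rw [invVec, map_sum]
    refine Finset.sum_congr rfl fun k hk => ?_
    have := Rcheck_tb_anti (q := q) (qh := qh) (z := 0) (neg_mem_J.2 hk)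
    rw [neg_neg] at this
    rw [map_smul, this]
  have hd : ∀ k l, cf ty n k l (braid ty n q qh (invVec ty n q qh)) ≠ 0 → l = -k := by
    intro k l h
    by_contra hlk
    apply h
    rw [hsum]
    simp only [map_sum, map_smul]
    refine Finset.sum_eq_zero fun j _ => ?_
    rw [Finset.sum_eq_zero, smul_zero]
    intro i hi
    rw [cf_tb (neg_mem_J.2 hi) hi, if_neg (by omega), smul_zero]
  have hv : ∀ p : ℤ, 1 ≤ p → p ≤ n → deltaE ty n q qh p (invVec ty n q qh) = 0 :=
    fun p h1 h2 => (deltaE_commute hn hq htwo h1 h2).1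
  have hbv : ∀ p : ℤ, 1 ≤ p → p ≤ n →
      deltaE ty n q qh p (braid ty n q qh (invVec ty n q qh)) = 0 := by
    intro p h1 h2
    rw [← LinearMap.comp_apply, ← (deltaE_commute hn hq htwo h1 h2).2.2, LinearMap.comp_apply,
      hv p h1 h2, map_zero]
  have hv1 : cf ty n (-1) 1 (invVec ty n q qh) = cc ty n q qh 1 := by
    rw [cf_invVec, if_pos ⟨by norm_num, hone⟩]
  have key := Killed.eq_smul hn (fun p _ l => cE_ne_zero htwo p l) (suppJ_cf _) (suppJ_cf _)
    (killed_cf hn hbv) (killed_cf hn hv) hd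
    (fun k l h => by_contra fun h' => h (cf_invVec.trans (if_neg fun h => h' h.1)))
    (hv1.trans_ne hc1)
  have hcoef : cf ty n (-1) 1 (braid ty n q qh (invVec ty n q qh)) =
      eigenvalue ty n q 0 2 * cc ty n q qh 1 := by
    have h1 : cf ty n (-1) 1 (braid ty n q qh (invVec ty n q qh)) =
        ∑ k ∈ J ty n, cc ty n q qh k * a ty n q qh 0 1 (-k) := by
      rw [hsum]
      simp only [map_sum, map_smul]
      refine Finset.sum_congr rfl fun k _ => ?_
      rw [Finset.sum_eq_single 1]
      · rw [cf_tb (neg_mem_J.2 hone) hone, if_pos ⟨rfl, rfl⟩, smul_eq_mul, smul_eq_mul, mul_one]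
      · intro i hi hne
        rw [cf_tb (neg_mem_J.2 hi) hi, if_neg (fun h => hne h.2.symm), smul_zero]
      · exact fun h => absurd hone h
    -- The generic term for 1 ≺ -k sums to the norm. The two corrections are the diagonal
    -- coefficient at k = -1 and the Kronecker delta in a_{1,-1} at k = 1.
    have h2 : ∀ k ∈ J ty n, cc ty n q qh k * a ty n q qh 0 1 (-k) =
        -((1 - q ^ 2) * cc ty n q qh 1) * (cc ty n q qh k * (cc ty n q qh (-k))⁻¹) +
        ((if k = -1 then cc ty n q qh (-1) else 0) +
          if k = 1 then (1 - q ^ 2) * cc ty n q qh 1 else 0) := by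
      intro k hk
      rcases eq_or_ne k (-1) with rfl | hk1
      · rw [if_pos rfl, if_neg (by omega), neg_neg, a, if_pos rfl, if_neg one_ne_zero]
        field_simp
        ring
      · rw [a, if_neg (by omega), if_pos (prec_one_neg (by omega) hk hk1), eps_mul_zpow hq, if_neg hk1]
        by_cases h : k = 1
        · subst h
          simp only [neg_neg, if_true]
          ring
        · rw [if_neg (by omega), if_neg h]
          ring
    rw [h1, Finset.sum_congr rfl h2, Finset.sum_add_distrib, Finset.sum_add_distrib,
      Finset.sum_ite_eq' _ (-1 : ℤ), Finset.sum_ite_eq' _ (1 : ℤ), if_pos (neg_mem_J.2 hone),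
      if_pos hone, ← Finset.mul_sum, ← invNorm]
    have := (invNorm_identities (n := n) hq htwo).1
    rw [← this]
    field_simp
    ring
  refine VV_ext fun k l => ?_
  have := congrFun₂ key k l
  simp only [Pi.smul_apply, smul_eq_mul, hcoef, hv1] at this
  rw [this, map_smul, smul_eq_mul, mul_div_cancel_right₀ _ hc1]

end

end QWedge

/-! ### The three highest weight vectors and irreducibility of the components. -/

namespace QWedge

noncomputable section

variable {K : Type*} [Field K] {ty : AffType} {n : ℕ} {q qh z : K}

theorem two_mem_J (hn : 2 ≤ n) : (2 : ℤ) ∈ J ty n := mem_J_of_ne (by omega) (by omega) (by omega)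

theorem dn_ne_one (hn : 2 ≤ n) {p k : ℤ} (h1 : 1 ≤ p) : dn ty n p k ≠ 1 := by
  unfold dn
  cases ty <;> grind

theorem dn_eq_two (hn : 2 ≤ n) {p k : ℤ} (h1 : 1 ≤ p) : dn ty n p k = 2 ↔ p = 1 ∧ k = 1 := by
  unfold dn
  cases ty <;> grind

theorem cE_one_one (hn : 2 ≤ n) : cE ty n qh 1 1 = 1 := by
  rw [cE, if_neg (by omega)]

theorem cF_one_one (hn : 2 ≤ n) : cF ty n qh 1 1 = 1 := by
  rw [cF, if_neg (by omega)]

theorem tExp_one_one (hn : 2 ≤ n) : tExp ty n 1 1 = 1 := by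
  have : (1 : ℤ) < n := by omega
  simp [tExp, this, dlt]

variable (ty n q qh) in
/-- The highest weight vectors of the three components. -/
def hwVec : Fin 3 → VV K ty n :=
  ![tb ty n 1 1, tb ty n 1 2 - q • tb ty n 2 1, invVec ty n q qh]

theorem deltaE_hwVec (hn : ty.minRank ≤ n) (hq : q ≠ 0) (htwo : ty = .A2even → two qh ≠ 0)
    {p : ℤ} (h1 : 1 ≤ p) (h2 : p ≤ n) (j : Fin 3) :
    deltaE ty n q qh p (hwVec ty n q qh j) = 0 := by
  have hn2 := two_le_of_minRank_le hn
  have hone := one_mem_J (ty := ty) (n := n) (by omega)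
  have htwo' := two_mem_J (ty := ty) hn2
  fin_cases j
  · refine VV_ext fun k l => ?_
    rw [cf_comp_deltaE hn h1 h2]
    simp [hwVec, cf_tb hone hone, dn_ne_one hn2 h1]
  · refine VV_ext fun k l => ?_
    rw [cf_comp_deltaE hn h1 h2]
    simp only [hwVec, Fin.mk_one, Matrix.cons_val, map_sub, map_smul, cf_tb hone htwo',
      cf_tb htwo' hone, dn_ne_one hn2 h1, dn_eq_two hn2 h1, false_and, and_false, if_false,
      zero_sub, map_zero, smul_eq_mul]
    by_cases h : p = 1 ∧ k = 1 ∧ l = 1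
    · obtain ⟨rfl, rfl, rfl⟩ := h
      simp [tExp_one_one hn2, cE_one_one hn2, hq]
    · rw [if_neg (by tauto), if_neg (by tauto)]
      ring
  · exact (deltaE_commute hn hq htwo h1 h2).1

theorem rootPairing_congr (hn : 2 ≤ n) {f g : ℤ → ℤ} (h : ∀ j : ℤ, 1 ≤ j → f j = g j) {p : ℤ}
    (h1 : 1 ≤ p) : rootPairing ty n p f = rootPairing ty n p g := by
  have e1 := h p h1
  have e2 := h (p + 1) (by omega)
  have e3 := h n (by omega)
  have e4 := h (n - 1) (by omega)
  cases ty <;> simp only [rootPairing, e1, e2, e3, e4]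

theorem deltaT_hwVec (hn : 2 ≤ n) (hq : q ≠ 0) {p : ℤ} (h1 : 1 ≤ p) (j : Fin 3) :
    deltaT ty n q p (hwVec ty n q qh j) =
      q ^ rootPairing ty n p (weight j) • hwVec ty n q qh j := by
  fin_cases j
  · have : rootPairing ty n p (weight 0) = tExp ty n p 1 + tExp ty n p 1 := by
      rw [tExp_eq_rootPairing, ← rootPairing_add]
      refine rootPairing_congr hn (fun i hi => ?_) h1
      simp only [weight, wt, dlt]
      split_ifs <;> omega
    simp only [hwVec, Fin.zero_eta, Matrix.cons_val, deltaT_tb hq, this]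
  · have : rootPairing ty n p (weight 1) = tExp ty n p 1 + tExp ty n p 2 := by
      rw [tExp_eq_rootPairing, tExp_eq_rootPairing, ← rootPairing_add]
      refine rootPairing_congr hn (fun i hi => ?_) h1
      simp only [weight, wt, dlt]
      split_ifs <;> omega
    simp only [hwVec, Fin.mk_one, Matrix.cons_val, map_sub, map_smul, deltaT_tb hq, this]
    rw [add_comm (tExp ty n p 2)]
    module
  · have : rootPairing ty n p (weight 2) = 0 := by
      cases ty <;> simp [rootPairing, weight]
    simp only [hwVec, Fin.reduceFinMk, Matrix.cons_val, this, zpow_zero, one_smul]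
    exact (deltaT_commute hq (p := p)).1

theorem isHighestWeight_hwVec (hn : ty.minRank ≤ n) (hq : q ≠ 0)
    (htwo : ty = .A2even → two qh ≠ 0) (j : Fin 3) :
    IsHighestWeight ty n q qh (weight j) (hwVec ty n q qh j) := fun _ h1 h2 =>
  ⟨deltaE_hwVec hn hq htwo h1 h2 j, deltaT_hwVec (two_le_of_minRank_le hn) hq h1 j⟩

theorem hwVec_ne_zero (hn : 2 ≤ n) (hq : q ≠ 0) (htwo : ty = .A2even → two qh ≠ 0) (j : Fin 3) :
    hwVec ty n q qh j ≠ 0 := by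
  have hone := one_mem_J (ty := ty) (n := n) (by omega)
  have htwo' := two_mem_J (ty := ty) hn
  fin_cases j
  · intro h
    have := congrArg (cf ty n 1 1) h
    simp [hwVec, cf_tb hone hone] at this
  · intro h
    have := congrArg (cf ty n 1 2) h
    simp [hwVec, cf_tb hone htwo', cf_tb htwo' hone] at this
  · intro h
    have := congrArg (cf ty n (-1) 1) h
    simp only [hwVec, Fin.reduceFinMk, Matrix.cons_val, map_zero, cf_invVec] at this
    rw [if_pos ⟨by norm_num, hone⟩] at this
    exact cc_ne_zero hq htwo hone this

/-- No weight is prescribed: a homogeneous vector killed by all e_p already lies on one of three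
lines. This is what the irreducibility argument needs. -/
theorem exists_eq_smul_hwVec (hn : ty.minRank ≤ n) (hq : q ≠ 0)
    (htwo : ty = .A2even → two qh ≠ 0) {u : VV K ty n}
    (hu : ∀ p : ℤ, 1 ≤ p → p ≤ n → deltaE ty n q qh p u = 0)
    (hh : Homogeneous ty n fun k l => cf ty n k l u) (h0 : u ≠ 0) :
    ∃ (j : Fin 3) (r : K), u = r • hwVec ty n q qh j := by
  have hn2 := two_le_of_minRank_le hn
  have hone := one_mem_J (ty := ty) (n := n) (by omega)
  have htwo' := two_mem_J (ty := ty) hn2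
  have hk := killed_cf hn hu
  have hc0 : (fun k l => cf ty n k l u) ≠ 0 := fun h => h0 (VV_ext fun k l => by
    rw [map_zero]
    exact congrFun₂ h k l)
  rcases hk.classification hn (fun p k l => mul_ne_zero (cE_ne_zero htwo p k) (zpow_ne_zero _ hq))
    (fun p _ l => cE_ne_zero htwo p l) (suppJ_cf u) hh hc0 with ⟨-, h⟩ | ⟨-, h⟩ | ⟨-, h⟩
  · refine ⟨0, cf ty n 1 1 u, VV_ext fun k l => ?_⟩
    simp only [hwVec, Matrix.cons_val, map_smul, cf_tb hone hone]
    by_cases hkl : k = 1 ∧ l = 1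
    · simp [hkl]
    · rw [if_neg hkl, smul_zero]
      exact by_contra fun h' => hkl (h k l h')
  · refine ⟨1, cf ty n 1 2 u, VV_ext fun k l => ?_⟩
    -- The equation of e_1 at (1, 1) reads q⁻¹ c(2, 1) + c(1, 2) = 0, which is the origin of the
    -- coefficient -q.
    have h21 := congrFun₂ (hk 1 le_rfl (by omega)) 1 1
    have hdn : dn ty n 1 1 = 2 := (dn_eq_two hn2 le_rfl).2 ⟨rfl, rfl⟩
    simp only [raise, hdn, cE_one_one hn2, tExp_one_one hn2, Pi.zero_apply] at h21
    simp only [hwVec, Matrix.cons_val, map_smul, map_sub, cf_tb hone htwo', cf_tb htwo' hone,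
      smul_eq_mul]
    by_cases h1 : k = 1 ∧ l = 2
    · obtain ⟨rfl, rfl⟩ := h1
      simp
    by_cases h2 : k = 2 ∧ l = 1
    · obtain ⟨rfl, rfl⟩ := h2
      simp
      field_simp at h21
      linear_combination h21
    · rw [if_neg h1, if_neg h2]
      simp only [mul_zero, sub_zero]
      exact by_contra fun h' => (h k l h').elim h2 h1
  · have hv1 : cf ty n (-1) 1 (invVec ty n q qh) = cc ty n q qh 1 := by
      rw [cf_invVec, if_pos ⟨by norm_num, hone⟩]
    have key := Killed.eq_smul hn (fun p _ l => cE_ne_zero htwo p l) (suppJ_cf _) (suppJ_cf _)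
      hk (killed_cf hn fun p h1 h2 => (deltaE_commute hn hq htwo h1 h2).1) h
      (fun k l h => by_contra fun h' => h (cf_invVec.trans (if_neg fun h => h' h.1)))
      (hv1.trans_ne (cc_ne_zero hq htwo hone))
    exact ⟨2, _, VV_ext fun k l => by
      rw [map_smul]
      exact congrFun₂ key k l⟩

theorem IsHighestWeight.homogeneous [CharZero K] (hq : Transcendental ℚ q) {w : ℤ → ℤ}
    {u : VV K ty n} (hu : IsHighestWeight ty n q qh w u) :
    Homogeneous ty n fun k l => cf ty n k l u := by
  have key : ∀ k l, cf ty n k l u ≠ 0 → ∀ p : ℤ, 1 ≤ p → p ≤ n →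
      tExp ty n p k + tExp ty n p l = rootPairing ty n p w := by
    intro k l h p h1 h2
    have := congrArg (cf ty n k l) (hu p h1 h2).2
    rw [cf_comp_deltaT (ne_zero_of_transcendental hq), map_smul, smul_eq_mul] at this
    exact zpow_injective_of_transcendental hq (mul_right_cancel₀ h this)
  exact fun k l k' l' h h' p h1 h2 => (key k l h p h1 h2).trans (key k' l' h' p h1 h2).symm

theorem isHighestWeight_weight_iff [CharZero K] (hn : ty.minRank ≤ n) (hq : Transcendental ℚ q)
    (htwo : ty = .A2even → two qh ≠ 0) {j : Fin 3} {u : VV K ty n} :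
    IsHighestWeight ty n q qh (weight j) u ↔ ∃ r : K, u = r • hwVec ty n q qh j := by
  have hq0 := ne_zero_of_transcendental hq
  have hn2 := two_le_of_minRank_le hn
  constructor
  · intro hu
    by_cases h0 : u = 0
    · exact ⟨0, by rw [h0, zero_smul]⟩
    obtain ⟨i, r, hr⟩ := exists_eq_smul_hwVec hn hq0 htwo (fun p h1 h2 => (hu p h1 h2).1)
      (hu.homogeneous hq) h0
    -- The ε_1-coordinates of the three weights are 2, 1 and 0, so this coordinate alone separates
    -- them.
    have hw : weight i 1 = weight j 1 := by
      refine rootPairing_injective hn (fun p h1 h2 => ?_) le_rfl (by omega : (1 : ℤ) ≤ n)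
      have := (hu p h1 h2).2
      rw [hr, map_smul, deltaT_hwVec hn2 hq0 h1, smul_comm, ← hr] at this
      exact zpow_injective_of_transcendental hq (smul_left_injective K h0 this)
    have : i = j := by fin_cases i <;> fin_cases j <;> simp_all [weight, dlt]
    exact ⟨r, this ▸ hr⟩
  · rintro ⟨r, rfl⟩ p h1 h2
    rw [map_smul, map_smul, deltaE_hwVec hn hq0 htwo h1 h2, deltaT_hwVec hn2 hq0 h1, smul_zero,
      smul_comm]
    exact ⟨rfl, rfl⟩

/-- Each highest weight space is a line, so a component is cyclic; an operator commuting with U_q is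
then determined on it by its value at the generator. -/
theorem component_eq_span [CharZero K] (hn : ty.minRank ≤ n) (hq : Transcendental ℚ q)
    (htwo : ty = .A2even → two qh ≠ 0) (j : Fin 3) :
    component ty n q qh j = Submodule.span (Uq ty n q qh) {hwVec ty n q qh j} := by
  refine le_antisymm (Submodule.span_le.2 fun u hu => ?_) (Submodule.span_mono ?_)
  · obtain ⟨r, rfl⟩ := (isHighestWeight_weight_iff hn hq htwo).1 hu
    exact Submodule.smul_of_tower_mem _ r (Submodule.mem_span_singleton_self _)
  · rintro _ rfl
    exact isHighestWeight_hwVec hn (ne_zero_of_transcendental hq) htwo j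

theorem Rcheck_hwVec (hn : ty.minRank ≤ n) (hq : q ≠ 0) (htwo : ty = .A2even → two qh ≠ 0)
    (j : Fin 3) :
    Rcheck ty n q qh z (hwVec ty n q qh j) = eigenvalue ty n q z j • hwVec ty n q qh j := by
  have hn2 := two_le_of_minRank_le hn
  have hone := one_mem_J (ty := ty) (n := n) (by omega)
  have htwo' := two_mem_J (ty := ty) hn2
  fin_cases j
  · simp only [hwVec, Fin.zero_eta, Matrix.cons_val, eigenvalue]
    rw [Rcheck_tb_of_ne (by norm_num), if_pos rfl]
  · have h12 : Prec n 1 2 := by unfold Prec pos; norm_num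
    have h21 : ¬ Prec n 2 1 := lt_asymm h12
    simp only [hwVec, Fin.mk_one, Matrix.cons_val, eigenvalue, map_sub, map_smul]
    have hne : (1 : ℤ) ≠ 2 := by norm_num
    rw [Rcheck_tb_of_ne (by norm_num), Rcheck_tb_of_ne (by norm_num)]
    simp only [hne, hne.symm, h12, h21, if_true, if_false]
    module
  · simp only [hwVec, Fin.reduceFinMk, Matrix.cons_val]
    rw [Rcheck_eq hq htwo, ← eigenvalue_eq hq htwo]
    simp only [LinearMap.sub_apply, LinearMap.smul_apply, LinearMap.add_apply, LinearMap.id_apply,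
      contraction, LinearMap.smulRight_apply, invForm_invVec, braid_invVec hn hq htwo]
    module

theorem Rcheck_apply_of_mem_Uq (hn : ty.minRank ≤ n) (hq : q ≠ 0)
    (htwo : ty = .A2even → two qh ≠ 0) {x : Module.End K (VV K ty n)} (hx : x ∈ Uq ty n q qh)
    (u : VV K ty n) : Rcheck ty n q qh z (x u) = x (Rcheck ty n q qh z u) := by
  rw [Rcheck_eq hq htwo]
  simp only [LinearMap.sub_apply, LinearMap.smul_apply, LinearMap.add_apply, LinearMap.id_apply,
    braid_apply_of_mem_Uq hn hq htwo hx, contraction_apply_of_mem_Uq hn hq htwo hx, map_sub,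
    map_smul, map_add]

theorem Rcheck_apply_of_mem_component [CharZero K] (hn : ty.minRank ≤ n)
    (hq : Transcendental ℚ q) (htwo : ty = .A2even → two qh ≠ 0) {j : Fin 3} {u : VV K ty n}
    (hu : u ∈ component ty n q qh j) :
    Rcheck ty n q qh z u = eigenvalue ty n q z j • u := by
  rw [component_eq_span hn hq htwo, Submodule.mem_span_singleton] at hu
  obtain ⟨x, rfl⟩ := hu
  have hq0 := ne_zero_of_transcendental hq
  change Rcheck ty n q qh z (x.1 _) = _ • x.1 _
  rw [Rcheck_apply_of_mem_Uq hn hq0 htwo x.2, Rcheck_hwVec hn hq0 htwo, map_smul]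

/-- A nonzero submodule W contains a multiple of some `hwVec` i. If W lies in component j, then T
acts on that vector by both the i-th and the j-th eigenvalue, so i = j and W contains the generator.
-/
theorem isIrreducible_component [CharZero K] (hn : ty.minRank ≤ n) (hq : Transcendental ℚ q)
    (htwo : ty = .A2even → two qh ≠ 0) (j : Fin 3) :
    IsIrreducible ty n q qh (component ty n q qh j) := by
  have hq0 := ne_zero_of_transcendental hq
  have hn2 := two_le_of_minRank_le hn
  have hmem : hwVec ty n q qh j ∈ component ty n q qh j := by
    rw [component_eq_span hn hq htwo]
    exact Submodule.mem_span_singleton_self _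
  refine ⟨fun h => hwVec_ne_zero hn2 hq0 htwo j ((Submodule.mem_bot _).1 (h ▸ hmem)), ?_⟩
  intro W hW
  by_contra hW0
  refine hW.not_ge ?_
  let coords : VV K ty n →ₗ[K] ℤ → ℤ → K := LinearMap.pi fun k => LinearMap.pi fun l => cf ty n k l
  have hmemU : ∀ x : Uq ty n q qh, ∀ u ∈ W, x.1 u ∈ W := fun x u hu => W.smul_mem x hu
  obtain ⟨c, hcA, hc0, hck, hch⟩ := exists_killed_homogeneous
    (x := fun p k l => cE ty n qh p k * q ^ (-tExp ty n p l)) (y := fun p _ l => cE ty n qh p l)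
    hn (fun a b => zpow_injective_of_transcendental hq)
    ((W.restrictScalars K).map coords) (by
      rintro _ ⟨u, -, rfl⟩
      exact suppJ_cf u) (by
      rintro p h1 h2 _ ⟨u, hu, rfl⟩
      refine ⟨deltaE ty n q qh p u,
        hmemU ⟨_, Algebra.subset_adjoin ⟨p, h1, h2, Or.inl rfl⟩⟩ u hu, ?_⟩
      exact funext₂ fun k l => cf_comp_deltaE hn h1 h2 u) (by
      rintro p h1 h2 _ ⟨u, hu, rfl⟩
      refine ⟨deltaT ty n q p u,
        hmemU ⟨_, Algebra.subset_adjoin ⟨p, h1, h2, Or.inr (Or.inr (Or.inl rfl))⟩⟩ u hu, ?_⟩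
      exact funext₂ fun k l => cf_comp_deltaT hq0 u) (by
      obtain ⟨u, hu, hu0⟩ := Submodule.exists_mem_ne_zero_of_ne_bot hW0
      intro h
      refine hu0 (VV_ext fun k l => ?_)
      have : coords u = 0 := (Submodule.mem_bot K).1 (h ▸ Submodule.mem_map_of_mem hu)
      rw [map_zero]
      exact congrFun₂ this k l)
  obtain ⟨u, hu, rfl⟩ := hcA
  have hu : u ∈ W := hu
  have hu0 : u ≠ 0 := by
    rintro rfl
    exact hc0 (map_zero _)
  have hkill : ∀ p : ℤ, 1 ≤ p → p ≤ n → deltaE ty n q qh p u = 0 := by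
    intro p h1 h2
    refine VV_ext fun k l => ?_
    rw [cf_comp_deltaE hn h1 h2, map_zero]
    exact congrFun₂ (hck p h1 h2) k l
  obtain ⟨i, r, hr⟩ := exists_eq_smul_hwVec hn hq0 htwo hkill hch hu0
  have hr0 : r ≠ 0 := by
    rintro rfl
    exact hu0 (by rw [hr, zero_smul])
  have hij : i = j := by
    refine eigenvalue_zero_injective (ty := ty) hq hn2 (smul_left_injective K hu0 ?_)
    have h1 := Rcheck_apply_of_mem_component (z := 0) hn hq htwo (hW.le hu)
    simp only
    rw [← h1, hr, map_smul, Rcheck_hwVec hn hq0 htwo, smul_comm]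
  subst hij
  rw [component_eq_span hn hq htwo, Submodule.span_singleton_le_iff_mem]
  have : hwVec ty n q qh i = r⁻¹ • u := by rw [hr, smul_smul, inv_mul_cancel₀ hr0, one_smul]
  rw [this]
  exact Submodule.smul_of_tower_mem W _ hu

end

end QWedge

/-! ### The components span; projections and the spectral decomposition. -/

namespace QWedge

noncomputable section

variable {K : Type*} [Field K] {ty : AffType} {n : ℕ} {q qh z : K}

/-- Otherwise the annihilator of the sum is nonzero and stable under the transposed f_p and t_p. The
values of its functionals on the tensor basis satisfy the same recurrences as coordinates of
vectors, so the classification yields an extremal functional, and this one pairs nontrivially with a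
highest weight vector. -/
theorem iSup_component [CharZero K] (hn : ty.minRank ≤ n) (hq : Transcendental ℚ q)
    (htwo : ty = .A2even → two qh ≠ 0) :
    ⨆ j, (component ty n q qh j).restrictScalars K = ⊤ := by
  have hq0 := ne_zero_of_transcendental hq
  have hn2 := two_le_of_minRank_le hn
  have hone := one_mem_J (ty := ty) (n := n) (by omega)
  have htwo' := two_mem_J (ty := ty) hn2
  set S : Submodule K (VV K ty n) := ⨆ j, (component ty n q qh j).restrictScalars K
  have hmem : ∀ j, hwVec ty n q qh j ∈ S := by
    intro j
    refine (le_iSup (fun j => (component ty n q qh j).restrictScalars K) j) ?_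
    rw [Submodule.restrictScalars_mem, component_eq_span hn hq htwo]
    exact Submodule.mem_span_singleton_self _
  have hinv : ∀ x ∈ Uq ty n q qh, ∀ u ∈ S, x u ∈ S := by
    intro x hx
    change S ≤ S.comap x
    refine iSup_le fun j u hu => ?_
    exact (le_iSup (fun j => (component ty n q qh j).restrictScalars K) j)
      ((component ty n q qh j).smul_mem (⟨x, hx⟩ : Uq ty n q qh) hu)
  by_contra hS
  let coords : Module.Dual K (VV K ty n) →ₗ[K] ℤ → ℤ → K :=
    LinearMap.pi fun k => LinearMap.pi fun l => LinearMap.applyₗ (tb ty n k l)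
  have hcoords : ∀ φ k l, coords φ k l = φ (tb ty n k l) := fun φ k l => rfl
  have hsupp : ∀ φ, SuppJ ty n (coords φ) := by
    intro φ k l h
    rw [hcoords] at h
    constructor <;> by_contra hJ
    · exact h (by rw [tb_eq_zero_left hJ, map_zero])
    · exact h (by rw [tb_eq_zero_right hJ, map_zero])
  have hF : ∀ φ : Module.Dual K (VV K ty n), ∀ p : ℤ, 1 ≤ p → p ≤ n →
      raise ty n (fun p k _ => cF ty n qh p k) (fun p k l => q ^ tExp ty n p k * cF ty n qh p l) p
        (coords φ) = coords (φ ∘ₗ deltaF ty n q qh p) := by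
    intro φ p h1 h2
    funext k l
    rw [hcoords, LinearMap.comp_apply, deltaF_tb hn h1 h2, map_add, map_smul, map_smul]
    rfl
  obtain ⟨c, hcA, hc0, hck, hch⟩ := exists_killed_homogeneous
    (x := fun p k _ => cF ty n qh p k) (y := fun p k l => q ^ tExp ty n p k * cF ty n qh p l)
    hn (fun a b => zpow_injective_of_transcendental hq)
    (S.dualAnnihilator.map coords) (by
      rintro _ ⟨φ, -, rfl⟩
      exact hsupp φ) (by
      rintro p h1 h2 _ ⟨φ, hφ, rfl⟩
      refine ⟨φ ∘ₗ deltaF ty n q qh p, ?_, (hF φ p h1 h2).symm⟩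
      rw [SetLike.mem_coe, Submodule.mem_dualAnnihilator] at hφ ⊢
      exact fun u hu => hφ _
        (hinv _ (Algebra.subset_adjoin ⟨p, h1, h2, Or.inr (Or.inl rfl)⟩) u hu)) (by
      rintro p h1 h2 _ ⟨φ, hφ, rfl⟩
      refine ⟨φ ∘ₗ deltaT ty n q p, ?_, funext₂ fun k l => ?_⟩
      · rw [SetLike.mem_coe, Submodule.mem_dualAnnihilator] at hφ ⊢
        exact fun u hu => hφ _
          (hinv _ (Algebra.subset_adjoin ⟨p, h1, h2, Or.inr (Or.inr (Or.inl rfl))⟩) u hu)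
      · rw [hcoords, LinearMap.comp_apply, deltaT_tb hq0, map_smul]
        rfl) (by
      intro h
      refine hS (Submodule.dualAnnihilator_eq_bot_iff.1 ((Submodule.eq_bot_iff _).2 ?_))
      intro φ hφ
      have : coords φ = 0 := (Submodule.mem_bot K).1 (h ▸ Submodule.mem_map_of_mem hφ)
      exact VV_hom_ext fun k _ l _ => congrFun₂ this k l)
  obtain ⟨φ, hφ, rfl⟩ := hcA
  rw [SetLike.mem_coe, Submodule.mem_dualAnnihilator] at hφ
  have hv : ∀ j, φ (hwVec ty n q qh j) = 0 := fun j => hφ _ (hmem j)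
  have hy : ∀ p k l, q ^ tExp ty n p k * cF ty n qh p l ≠ 0 :=
    fun p k l => mul_ne_zero (zpow_ne_zero _ hq0) (cF_ne_zero htwo p l)
  rcases hck.classification hn (fun p k _ => cF_ne_zero htwo p k) hy (hsupp φ) hch hc0 with
    ⟨h, -⟩ | ⟨h, -⟩ | ⟨h, hd⟩
  · exact h (hv 0)
  · have h21 := congrFun₂ (hck 1 le_rfl (by omega)) 1 1
    have hdn : dn ty n 1 1 = 2 := (dn_eq_two hn2 le_rfl).2 ⟨rfl, rfl⟩
    simp only [raise, hdn, cF_one_one hn2, tExp_one_one hn2, Pi.zero_apply, hcoords, zpow_one] at h21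
    have h1 := hv 1
    simp only [hwVec, Matrix.cons_val, map_sub, map_smul, smul_eq_mul] at h1
    rw [hcoords] at h
    -- The killed functional satisfies φ(v_2 ⊗ v_1) = -q φ(v_1 ⊗ v_2), while vanishing on the
    -- highest weight vector gives φ(v_1 ⊗ v_2) = q φ(v_2 ⊗ v_1).
    have hq2 : 1 + q ^ 2 ≠ 0 := fun h => pow_ne_neg_one_of_transcendental hq two_pos
      (by linear_combination h)
    exact mul_ne_zero hq2 h (by linear_combination h21 - q * h1)
  · have hform : ∀ k l, coords (invForm ty n q qh) k l ≠ 0 → l = -k := by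
      intro k l h
      have hJ := hsupp _ k l h
      by_contra h'
      exact h ((invForm_tb hJ.1 hJ.2).trans (if_neg h'))
    have hform1 : coords (invForm ty n q qh) (-1) 1 ≠ 0 := by
      rw [hcoords, invForm_tb (neg_mem_J.2 hone) hone, if_pos (by norm_num)]
      exact inv_ne_zero (cc_ne_zero hq0 htwo (neg_mem_J.2 hone))
    -- In weight zero the killed functional must be a multiple of the invariant form, whose value on
    -- the invariant vector is `invNorm`.
    have key := Killed.eq_smul hn hy (hsupp _) (hsupp _) hck
      (fun p h1 h2 => by rw [hF _ p h1 h2, (deltaF_commute hn hq0 htwo h1 h2).2.1, map_zero])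
      hd hform hform1
    rw [← map_smul] at key
    have hr : φ = (coords φ (-1) 1 / coords (invForm ty n q qh) (-1) 1) • invForm ty n q qh :=
      VV_hom_ext fun k _ l _ => congrFun₂ key k l
    have h2 := hv 2
    rw [hr] at h2
    simp only [hwVec, Matrix.cons_val, LinearMap.smul_apply, invForm_invVec] at h2
    exact smul_ne_zero (div_ne_zero h hform1) (invNorm_ne_zero hq htwo hn2) h2

theorem End_ext_of_component [CharZero K] (hn : ty.minRank ≤ n) (hq : Transcendental ℚ q)
    (htwo : ty = .A2even → two qh ≠ 0) {f g : Module.End K (VV K ty n)}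
    (h : ∀ j, ∀ u ∈ component ty n q qh j, f u = g u) : f = g := by
  have : ⊤ ≤ LinearMap.eqLocus f g := by
    rw [← iSup_component hn hq htwo]
    exact iSup_le fun j u hu => h j u hu
  exact LinearMap.ext fun u => this trivial

variable (ty n q qh) in
/-- The projection onto a component, as a polynomial in the braiding. -/
def proj (j : Fin 3) : Module.End K (VV K ty n) :=
  Polynomial.aeval (braid ty n q qh) (Lagrange.basis Finset.univ (eigenvalue ty n q 0) j)

/-- On a component T is a scalar, so a polynomial in T acts by its value there, and the Lagrange
basis takes the values 0 and 1. Directness of the sum thus needs no separate argument. -/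
theorem proj_apply_of_mem_component [CharZero K] (hn : ty.minRank ≤ n) (hq : Transcendental ℚ q)
    (htwo : ty = .A2even → two qh ≠ 0) {i j : Fin 3} {u : VV K ty n}
    (hu : u ∈ component ty n q qh j) : proj ty n q qh i u = if i = j then u else 0 := by
  by_cases h0 : u = 0
  · simp [h0]
  have hev : Module.End.HasEigenvector (braid ty n q qh) (eigenvalue ty n q 0 j) u :=
    ⟨Module.End.mem_eigenspace_iff.2 (Rcheck_apply_of_mem_component hn hq htwo hu), h0⟩
  rw [proj, Module.End.aeval_apply_of_hasEigenvector hev]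
  split_ifs with hij
  · subst hij
    rw [Lagrange.eval_basis_self
      (eigenvalue_zero_injective hq (two_le_of_minRank_le hn)).injOn (Finset.mem_univ _), one_smul]
  · rw [Lagrange.eval_basis_of_ne hij (Finset.mem_univ _), zero_smul]

theorem proj_mem_component [CharZero K] (hn : ty.minRank ≤ n) (hq : Transcendental ℚ q)
    (htwo : ty = .A2even → two qh ≠ 0) (i : Fin 3) (u : VV K ty n) :
    proj ty n q qh i u ∈ component ty n q qh i := by
  have : ⊤ ≤ ((component ty n q qh i).restrictScalars K).comap (proj ty n q qh i) := by
    rw [← iSup_component hn hq htwo]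
    refine iSup_le fun j u hu => ?_
    rw [Submodule.mem_comap, proj_apply_of_mem_component hn hq htwo hu]
    split_ifs with h
    · exact h ▸ hu
    · exact Submodule.zero_mem _
  exact this trivial

theorem completeOrthogonalIdempotents_proj [CharZero K] (hn : ty.minRank ≤ n)
    (hq : Transcendental ℚ q) (htwo : ty = .A2even → two qh ≠ 0) :
    CompleteOrthogonalIdempotents (proj ty n q qh) where
  idem i := LinearMap.ext fun u => by
    rw [Module.End.mul_apply,
      proj_apply_of_mem_component hn hq htwo (proj_mem_component hn hq htwo i u), if_pos rfl]
  ortho i j hij := LinearMap.ext fun u => by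
    rw [Module.End.mul_apply,
      proj_apply_of_mem_component hn hq htwo (proj_mem_component hn hq htwo j u), if_neg hij]
    rfl
  complete := End_ext_of_component hn hq htwo fun j u hu => by
    simp [LinearMap.sum_apply, proj_apply_of_mem_component hn hq htwo hu]

theorem range_proj [CharZero K] (hn : ty.minRank ≤ n) (hq : Transcendental ℚ q)
    (htwo : ty = .A2even → two qh ≠ 0) (i : Fin 3) :
    LinearMap.range (proj ty n q qh i) = (component ty n q qh i).restrictScalars K := by
  refine le_antisymm ?_ fun u hu => ⟨u, ?_⟩
  · rintro _ ⟨u, rfl⟩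
    exact proj_mem_component hn hq htwo i u
  · rw [proj_apply_of_mem_component hn hq htwo hu, if_pos rfl]

theorem Rcheck_eq_sum_proj [CharZero K] (hn : ty.minRank ≤ n) (hq : Transcendental ℚ q)
    (htwo : ty = .A2even → two qh ≠ 0) (z : K) :
    Rcheck ty n q qh z = ∑ i, eigenvalue ty n q z i • proj ty n q qh i :=
  End_ext_of_component hn hq htwo fun j u hu => by
    simp [LinearMap.sum_apply, proj_apply_of_mem_component hn hq htwo hu,
      Rcheck_apply_of_mem_component hn hq htwo hu]

end

end QWedge

theorem proposition2p2 {K : Type*} [Field K] [CharZero K] (ty : QWedge.AffType) (n : ℕ)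
    (hn : ty.minRank ≤ n) (q qh : K) (hq : Transcendental ℚ q)
    (hqh : ty = QWedge.AffType.A2even → qh ^ 2 = q) :
    (∀ k : Fin 3, QWedge.IsIrreducible ty n q qh (QWedge.component ty n q qh k)) ∧
    ∃ P : Fin 3 → Module.End K (QWedge.VV K ty n),
      CompleteOrthogonalIdempotents P ∧
      (∀ k : Fin 3,
        LinearMap.range (P k) = (QWedge.component ty n q qh k).restrictScalars K) ∧
      ∀ z : K, QWedge.Rcheck ty n q qh z = ∑ k : Fin 3, QWedge.eigenvalue ty n q z k • P k := by
  have htwo : ty = .A2even → QWedge.two qh ≠ 0 :=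
    fun h => QWedge.two_ne_zero_of_transcendental hq (hqh h)
  exact ⟨QWedge.isIrreducible_component hn hq htwo, QWedge.proj ty n q qh,
    QWedge.completeOrthogonalIdempotents_proj hn hq htwo, QWedge.range_proj hn hq htwo,
    QWedge.Rcheck_eq_sum_proj hn hq htwo⟩
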